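/- Let $N\ge 1$. Let $V=V^*\in L^1(0,1)$ be an $N\times N$ complex matrix-valued potential (potentials that agree almost everywhere are identified), and let $\lambda_1(V)<\lambda_2(V)<\dots$ be the distinct eigenvalues of the Dirichlet problem $$-\psi''+V(x)\psi=\lambda\psi,\qquad \psi(0)=\psi(1)=0,$$ for $\mathbb C^N$-valued $\psi$, where $\lambda_\beta(V)$ has multiplicity $k_\beta(V)$, the dimension of the space of its eigenfunctions. Let $\varphi(x,\lambda,V)$ be the $N\times N$ matrix solution of $-\varphi''+V\varphi=\lambda\varphi$ with $\varphi(0)=0$, $\varphi'(0)=I$. For $\beta\ge1$ put $$S_\beta(V)=\int_0^1\varphi(t,\lambda_\beta(V),V)^*\varphi(t,\lambda_\beta(V),V)\,dt,\qquad \mathcal E_\beta(V)=\operatorname{Ker}\varphi(1,\lambda_\beta(V),V)\subset\mathbb C^N,$$ let $P_\beta(V)$ be the orthogonal projector of $\mathbb C^N$ onto $\mathcal E_\beta(V)$, let $g_\beta(V)=P_\beta(V)S_\beta(V)P_\beta(V)\big|_{\mathcal E_\beta(V)}$, an operator in $\mathcal E_\beta(V)$, and let $\mathcal F_\beta(V)=\mathbb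 C^N\ominus S_\beta(V)(\mathcal E_\beta(V))$ be the orthogonal complement of $S_\beta(V)(\mathcal E_\beta(V))$. Let $\operatorname{Iso}(V)$ be the set of all $N\times N$ potentials $\widetilde V=\widetilde V^*\in L^1(0,1)$ with $\lambda_\beta(\widetilde V)=\lambda_\beta(V)$ and $k_\beta(\widetilde V)=k_\beta(V)$ for all $\beta\ge1$. Fix $\alpha\ge1$. Then the mapping $\widetilde V\mapsto(\mathcal E_\alpha(\widetilde V),g_\alpha(\widetilde V))$ is a bijection from the set $$\{\widetilde V\in\operatorname{Iso}(V):\ \mathcal E_\beta(\widetilde V)=\mathcal E_\beta(V),\ g_\beta(\widetilde V)=g_\beta(V)\ \text{for all }\beta\ge1,\ \beta\ne\alpha\}$$ onto the set of all pairs $(\mathcal E,g)$ in which $\mathcal E\subset\mathbb C^N$ is a subspace with $\dim\mathcal E=k_\alpha(V)$ and $\mathcal E\cap\mathcal F_\alpha(V)=\{0\}$, and $g=g^*>0$ is an operator in $\mathcal E$. -/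

import Mathlib

open MeasureTheory Set
open scoped Matrix Matrix.Norms.L2Operator

noncomputable section

namespace MatrixSL

/-- `ℂ^N` with its standard inner product. -/
abbrev Vec (N : ℕ) : Type := EuclideanSpace ℂ (Fin N)

/-- `N × N` complex matrices (with the operator norm). -/
abbrev Mat (N : ℕ) : Type := Matrix (Fin N) (Fin N) ℂ

/-- Lebesgue measure on the interval `(0,1)`. -/
abbrev μ01 : Measure ℝ := volume.restrict (Ioo 0 1)

/-- Matrix potentials of class `L¹(0,1)`, identified when they agree almost everywhere. -/
abbrev Potential (N : ℕ) : Type := Lp (Mat N) 1 μ01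

/-- `V = V*` almost everywhere on `(0,1)`. -/
def IsSelfAdjointPotential {N : ℕ} (V : Potential N) : Prop :=
  ∀ᵐ x ∂μ01, (V x).IsHermitian

/-- The matrix `A` as an operator on `ℂ^N`. -/
abbrev op {N : ℕ} (A : Mat N) : Vec N →ₗ[ℂ] Vec N := Matrix.toEuclideanLin A

/-- `ψ` is a vector solution of `-ψ'' + V ψ = l ψ` on `[0,1]` with derivative `ψ'`: both `ψ` and
`ψ'` are absolutely continuous on `[0,1]` and `ψ'' = (V - l) ψ` almost everywhere, which is
written in integrated form. -/
structure IsVecSolution {N : ℕ} (V : Potential N) (l : ℂ) (ψ ψ' : ℝ → Vec N) : Prop where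
  cont : ContinuousOn ψ (Icc 0 1)
  cont' : ContinuousOn ψ' (Icc 0 1)
  eq : ∀ x ∈ Icc (0 : ℝ) 1, ψ x = ψ 0 + ∫ t in (0 : ℝ)..x, ψ' t
  eq' : ∀ x ∈ Icc (0 : ℝ) 1,
    ψ' x = ψ' 0 + ∫ t in (0 : ℝ)..x, (op (V t) (ψ t) - l • ψ t)

/-- The same for matrix solutions of `-Y'' + V Y = l Y` on `[0,1]`. -/
structure IsMatSolution {N : ℕ} (V : Potential N) (l : ℂ) (Y Y' : ℝ → Mat N) : Prop where
  cont : ContinuousOn Y (Icc 0 1)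
  cont' : ContinuousOn Y' (Icc 0 1)
  eq : ∀ x ∈ Icc (0 : ℝ) 1, Y x = Y 0 + ∫ t in (0 : ℝ)..x, Y' t
  eq' : ∀ x ∈ Icc (0 : ℝ) 1,
    Y' x = Y' 0 + ∫ t in (0 : ℝ)..x, (V t * Y t - l • Y t)

lemma intervalIntegrable_of_cont {F : Type*} [NormedAddCommGroup F] {f : ℝ → F}
    (hf : ContinuousOn f (Icc 0 1)) {x : ℝ} (hx : x ∈ Icc (0 : ℝ) 1) :
    IntervalIntegrable f volume 0 x :=
  (hf.mono (by rw [uIcc_of_le hx.1]; exact Icc_subset_Icc_right hx.2)).intervalIntegrable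

lemma intervalIntegrable_rhs {N : ℕ} (V : Potential N) (l : ℂ) {ψ : ℝ → Vec N}
    (hψ : ContinuousOn ψ (Icc 0 1)) {x : ℝ} (hx : x ∈ Icc (0 : ℝ) 1) :
    IntervalIntegrable (fun t => op (V t) (ψ t) - l • ψ t) volume 0 x := by
  refine IntervalIntegrable.sub ?_ (intervalIntegrable_of_cont (hψ.const_smul l) hx)
  have hV : IntegrableOn (fun t => V t) (Icc 0 1) volume := by
    have h := L1.integrable_coeFn V
    rw [integrableOn_Icc_iff_integrableOn_Ioo]
    exact h
  have hT : IntegrableOn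
      (fun t => Matrix.toEuclideanCLM (n := Fin N) (𝕜 := ℂ) (V t)) (Icc 0 1) volume := by
    let L : Mat N →L[ℂ] (Vec N →L[ℂ] Vec N) := LinearMap.toContinuousLinearMap
      ((Matrix.toEuclideanCLM (n := Fin N) (𝕜 := ℂ)).toAlgEquiv.toLinearMap)
    exact L.integrable_comp hV
  have hI : IntegrableOn (fun t => op (V t) (ψ t)) (Icc 0 1) volume := by
    obtain ⟨C, hC⟩ := isCompact_Icc.exists_bound_of_continuousOn hψ
    have hm : AEStronglyMeasurable ψ (volume.restrict (Icc (0 : ℝ) 1)) :=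
      hψ.aestronglyMeasurable measurableSet_Icc
    refine Integrable.mono' (hT.norm.mul_const C)
      ((ContinuousLinearMap.id ℂ (Vec N →L[ℂ] Vec N)).aestronglyMeasurable_comp₂
        hT.aestronglyMeasurable hm) ?_
    filter_upwards [ae_restrict_mem measurableSet_Icc] with t ht
    exact ((Matrix.toEuclideanCLM (n := Fin N) (𝕜 := ℂ) (V t)).le_opNorm (ψ t)).trans
      (mul_le_mul_of_nonneg_left (hC t ht) (norm_nonneg _))
  rw [intervalIntegrable_iff_integrableOn_Icc_of_le hx.1]
  exact hI.mono_set (Icc_subset_Icc_right hx.2)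

lemma IsVecSolution.add {N : ℕ} {V : Potential N} {l : ℂ} {ψ ψ' η η' : ℝ → Vec N}
    (h : IsVecSolution V l ψ ψ') (k : IsVecSolution V l η η') :
    IsVecSolution V l (ψ + η) (ψ' + η') where
  cont := h.cont.add k.cont
  cont' := h.cont'.add k.cont'
  eq x hx := by
    simp only [Pi.add_apply]
    rw [intervalIntegral.integral_add (intervalIntegrable_of_cont h.cont' hx)
      (intervalIntegrable_of_cont k.cont' hx), h.eq x hx, k.eq x hx]
    abel
  eq' x hx := by
    have e : ∀ t, op (V t) ((ψ + η) t) - l • (ψ + η) t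
        = (op (V t) (ψ t) - l • ψ t) + (op (V t) (η t) - l • η t) := by
      intro t
      simp only [Pi.add_apply, map_add, smul_add]
      abel
    simp only [e]
    rw [intervalIntegral.integral_add (intervalIntegrable_rhs V l h.cont hx)
      (intervalIntegrable_rhs V l k.cont hx)]
    simp only [Pi.add_apply]
    rw [h.eq' x hx, k.eq' x hx]
    abel

lemma IsVecSolution.smul {N : ℕ} {V : Potential N} {l : ℂ} {ψ ψ' : ℝ → Vec N} (c : ℂ)
    (h : IsVecSolution V l ψ ψ') : IsVecSolution V l (c • ψ) (c • ψ') where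
  cont := h.cont.const_smul c
  cont' := h.cont'.const_smul c
  eq x hx := by
    simp only [Pi.smul_apply]
    rw [intervalIntegral.integral_smul, ← smul_add, ← h.eq x hx]
  eq' x hx := by
    have e : ∀ t, op (V t) ((c • ψ) t) - l • (c • ψ) t = c • (op (V t) (ψ t) - l • ψ t) := by
      intro t
      simp only [Pi.smul_apply, map_smul, smul_sub, smul_comm l c]
    simp only [e]
    simp only [Pi.smul_apply]
    rw [intervalIntegral.integral_smul, ← smul_add, ← h.eq' x hx]

lemma IsVecSolution.zero {N : ℕ} (V : Potential N) (l : ℂ) :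
    IsVecSolution V l (0 : ℝ → Vec N) 0 where
  cont := continuousOn_const
  cont' := continuousOn_const
  eq x _ := by simp
  eq' x _ := by simp

/-- The space of functions `f : [0,1] → ℂ^N` with `-f'' + V f = l f` and `f(0) = f(1) = 0`. -/
def eigenspace {N : ℕ} (V : Potential N) (l : ℝ) : Submodule ℂ (Icc (0 : ℝ) 1 → Vec N) where
  carrier := {f | ∃ ψ ψ' : ℝ → Vec N, IsVecSolution V (l : ℂ) ψ ψ' ∧ ψ 0 = 0 ∧ ψ 1 = 0 ∧
    ∀ x : Icc (0 : ℝ) 1, f x = ψ x}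
  zero_mem' := ⟨0, 0, IsVecSolution.zero V _, rfl, rfl, fun _ => rfl⟩
  add_mem' := by
    rintro f g ⟨ψ, ψ', h, h0, h1, hf⟩ ⟨η, η', k, k0, k1, hg⟩
    exact ⟨ψ + η, ψ' + η', h.add k, by simp [h0, k0], by simp [h1, k1],
      fun x => by simp [hf x, hg x]⟩
  smul_mem' := by
    rintro c f ⟨ψ, ψ', h, h0, h1, hf⟩
    exact ⟨c • ψ, c • ψ', h.smul c, by simp [h0], by simp [h1], fun x => by simp [hf x]⟩

/-- The set of eigenvalues of the Dirichlet problem `-ψ'' + V ψ = l ψ`, `ψ(0) = ψ(1) = 0`. -/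
def eigenvalues {N : ℕ} (V : Potential N) : Set ℝ := {l | eigenspace V l ≠ ⊥}

/-- The eigenvalue `λ_α`, `α ≥ 1`, in the enumeration `λ_1 < λ_2 < …` of the distinct
eigenvalues: the eigenvalue `l` such that exactly `α` eigenvalues are at most `l`. -/
def eigenvalue {N : ℕ} (V : Potential N) (α : ℕ) : ℝ :=
  sInf {l | l ∈ eigenvalues V ∧ (eigenvalues V ∩ Iic l).encard = α}

/-- The multiplicity `k_α` of `λ_α`. -/
def multiplicity {N : ℕ} (V : Potential N) (α : ℕ) : ℕ :=
  Module.finrank ℂ (eigenspace V (eigenvalue V α))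

/-- `Y` is a matrix solution of `-Y'' + V Y = l Y` with `Y(0) = 0`, `Y'(0) = I`. -/
def IsFundamental {N : ℕ} (V : Potential N) (l : ℂ) (Y : ℝ → Mat N) : Prop :=
  ∃ Y' : ℝ → Mat N, IsMatSolution V l Y Y' ∧ Y 0 = 0 ∧ Y' 0 = 1

open Classical in
/-- The solution `φ(x, l)` of `-φ'' + V φ = l φ`, `φ(0) = 0`, `φ'(0) = I`, which exists and is
unique on `[0,1]`. Only its values for `x ∈ [0,1]` are meaningful. -/
def phi {N : ℕ} (V : Potential N) (l : ℂ) : ℝ → Mat N :=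
  if h : ∃ Y, IsFundamental V l Y then h.choose else 0

/-- `S_α = ∫₀¹ φ(t, λ_α)* φ(t, λ_α) dt`. -/
def S {N : ℕ} (V : Potential N) (α : ℕ) : Mat N :=
  ∫ t in (0 : ℝ)..1, (phi V (eigenvalue V α : ℂ) t)ᴴ * phi V (eigenvalue V α : ℂ) t

/-- `E_α = Ker φ(1, λ_α)`. -/
def E {N : ℕ} (V : Potential N) (α : ℕ) : Submodule ℂ (Vec N) :=
  LinearMap.ker (op (phi V (eigenvalue V α : ℂ) 1))

/-- `g_α : E_α → E_α`, the restriction of `P_α S_α P_α` to `E_α`, where `P_α` is the orthogonal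
projector onto `E_α`; that is, `g_α h = P_α (S_α h)` for `h ∈ E_α`. -/
def g {N : ℕ} (V : Potential N) (α : ℕ) : E V α →ₗ[ℂ] E V α :=
  ((E V α).orthogonalProjectionOnto : Vec N →ₗ[ℂ] E V α) ∘ₗ op (S V α) ∘ₗ (E V α).subtype

/-- Pairs of a subspace of `ℂ^N` and a linear operator in it. -/
abbrev SubspaceWithOp (N : ℕ) : Type :=
  Σ K : Submodule ℂ (Vec N), (K →ₗ[ℂ] K)

/-- The pair `(E_α, g_α)`. -/
def spectralData {N : ℕ} (V : Potential N) (α : ℕ) : SubspaceWithOp N := ⟨E V α, g V α⟩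

/-- The forbidden subspace `F_α = ℂ^N ⊖ S_α(E_α)`. -/
def F {N : ℕ} (V : Potential N) (α : ℕ) : Submodule ℂ (Vec N) :=
  ((E V α).map (op (S V α)))ᗮ

/-- `Iso(V)`: the self-adjoint potentials with the same eigenvalues and multiplicities as `V`. -/
def Iso {N : ℕ} (V : Potential N) : Set (Potential N) :=
  {W | IsSelfAdjointPotential W ∧
    ∀ α : ℕ, 1 ≤ α → eigenvalue W α = eigenvalue V α ∧ multiplicity W α = multiplicity V α}

/-- `A = A* > 0` for an operator `A` in a subspace `K` of `ℂ^N`. -/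
def IsPosDefOp {N : ℕ} {K : Submodule ℂ (Vec N)} (A : K →ₗ[ℂ] K) : Prop :=
  (∀ u v : K, inner ℂ (A u) v = inner ℂ u (A v)) ∧ ∀ h : K, h ≠ 0 → 0 < (inner ℂ h (A h)).re

end MatrixSL

end

set_option linter.unusedSectionVars false

/-! Everything is read off from the meromorphic function `φ(1,z)⁻¹`. Write `E`, `P`, `S`, `g` for
the kernel, its projector, the Gram matrix and the norming operator of `V` at `λ = λ_α`, and a dot
for the derivative in the spectral parameter. The Lagrange identity gives `P φ'(1,λ)* φ̇(1,λ) = P S`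
(`SAPot.proj_mul_deriv`). As `P S P` is positive on `E`, every pole of `φ(1,·)⁻¹` is simple
(`SAPot.inverse_eventuallyEq`). The rigidity arguments share one tool: a function of `z = w²` with
removable singularities, bounded where `|sin w|` is comparable to `exp |Im w|`, is constant
(`exists_const_of_bounded_on_goodPt`).

Values avoid the forbidden subspace. If `W` shares the data of `V` except at `λ`, then `φ_W(1,z)
φ_V(1,z)⁻¹` has at most one pole, at `λ`, and is close to `1` at large good points, so it equals `1
+ C/(z-λ)`. Comparing Taylor coefficients at `λ` gives `C φ_V = 0` and `φ_W = φ_V + C φ̇_V`. A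
vector `v` with `φ_W v = 0` and `P S v = 0` then satisfies `φ_V v = 0`, so `v ∈ E` and `P S P v =
0`, hence `v = 0` (`SAPot.eq_zero_of_forbidden`).

Injectivity. The residue of the Weyl function `φ(1,z)⁻¹ θ(1,z)` is the inverse of `g` on `E`, so
equal data make the difference of two Weyl functions entire. The transfer matrix between the two
equations is then entire and bounded, which forces `φ₂(x,z) = K(x) φ₁(x,z)`; the asymptotics give `K
= 1`, and the equation returns the potential (`SAPot.ae_eq_of_sameData`).

Surjectivity. Given `(E', G)`, let `P'` project onto `E'`, let `A` and `A'` be the inverses of `P S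
P` and `G` on `E` and `E'`, extended by zero, and put `s(x) = ∫₀ˣ φ*φ` and `R = (1 +
(A'-A)s)⁻¹(A'-A)`. The potential `V - 2(φRφ*)'` has data `(E', G)` at `λ` and unchanged data
elsewhere (`SAPot.exists_commuted`). The inverse exists on all of `[0,1]` by a positivity argument;
only at `x = 1` does it need `E' ∩ F = 0`, which with equal dimensions makes `P S P'` an isomorphism
`E' → E` (`exists_inverse_pairing`). -/

noncomputable section

namespace MatrixSL

/-! ### Calculus of absolutely continuous functions -/

/-- `f` is absolutely continuous on `[0,1]` with derivative `f' ∈ L¹`, in integrated form. -/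
structure HasACDeriv {F : Type*} [NormedAddCommGroup F] [NormedSpace ℝ F] (f f' : ℝ → F) :
    Prop where
  int : IntervalIntegrable f' volume 0 1
  eq : ∀ x ∈ Icc (0 : ℝ) 1, f x = f 0 + ∫ t in (0 : ℝ)..x, f' t

namespace HasACDeriv

section Vector

variable {F G : Type*} [NormedAddCommGroup F] [NormedSpace ℝ F] [NormedAddCommGroup G]
  [NormedSpace ℝ G]

lemma intervalIntegrable_sub {f : ℝ → F} (h : IntervalIntegrable f volume 0 1) {x y : ℝ}
    (hx : x ∈ Icc (0 : ℝ) 1) (hy : y ∈ Icc (0 : ℝ) 1) : IntervalIntegrable f volume x y :=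
  h.mono_set (by rw [uIcc_of_le zero_le_one]; exact uIcc_subset_Icc hx hy)

lemma norm_sub_le {f f' : ℝ → F} (h : HasACDeriv f f') {x y : ℝ}
    (hx : x ∈ Icc (0 : ℝ) 1) (hy : y ∈ Icc (0 : ℝ) 1) :
    ‖f x - f y‖ ≤ |∫ t in y..x, ‖f' t‖| := by
  have z : (0 : ℝ) ∈ Icc (0 : ℝ) 1 := by simp
  rw [h.eq x hx, h.eq y hy, add_sub_add_left_eq_sub,
    intervalIntegral.integral_interval_sub_left (intervalIntegrable_sub h.int z hx)
      (intervalIntegrable_sub h.int z hy)]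
  exact intervalIntegral.norm_integral_le_abs_integral_norm

lemma continuousOn {f f' : ℝ → F} (h : HasACDeriv f f') : ContinuousOn f (Icc 0 1) := by
  have h1 : ContinuousOn (fun x => f 0 + ∫ t in (0 : ℝ)..x, f' t) (Icc 0 1) := by
    refine continuousOn_const.add ?_
    have := intervalIntegral.continuousOn_primitive_interval (a := 0) (b := 1) (μ := volume)
      (f := f') (by
        have := h.int
        rwa [intervalIntegrable_iff_integrableOn_Icc_of_le zero_le_one,
          ← uIcc_of_le (zero_le_one' ℝ)] at this)
    rwa [uIcc_of_le zero_le_one] at this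
  exact h1.congr fun x hx => h.eq x hx

lemma ae_hasDerivAt [CompleteSpace F] {f f' : ℝ → F} (h : HasACDeriv f f') :
    ∀ᵐ x, x ∈ Ioo (0 : ℝ) 1 → HasDerivAt f (f' x) x := by
  filter_upwards [h.int.ae_hasDerivAt_integral] with x hx hx1
  have := (hx (by rw [uIcc_of_le zero_le_one]; exact Ioo_subset_Icc_self hx1) 0
    (by simp)).const_add (f 0)
  refine this.congr_of_eventuallyEq ?_
  filter_upwards [Ioo_mem_nhds hx1.1 hx1.2] with y hy
  exact h.eq y (Ioo_subset_Icc_self hy)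

/-- The primitive of `k` is absolutely continuous, and it dominates the increments of `f` interval
by interval. -/
lemma ac_of_bound {f : ℝ → F} {k : ℝ → ℝ} (hk : IntervalIntegrable k volume 0 1)
    (hf : ∀ x ∈ Icc (0 : ℝ) 1, ∀ y ∈ Icc (0 : ℝ) 1, ‖f x - f y‖ ≤ |∫ t in y..x, k t|) :
    AbsolutelyContinuousOnInterval f 0 1 := by
  have h1 := hk.absolutelyContinuousOnInterval_intervalIntegral (c := 0) (by simp)
  unfold AbsolutelyContinuousOnInterval at h1 ⊢
  refine squeeze_zero' ?_ ?_ h1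
  · exact Filter.Eventually.of_forall <| fun _ ↦ Finset.sum_nonneg (fun i hi ↦ dist_nonneg)
  rw [Filter.eventually_inf_principal]
  filter_upwards with (n, I) hnI
  simp only [AbsolutelyContinuousOnInterval.disjWithin, mem_ofPred_eq] at hnI
  refine Finset.sum_le_sum fun i hi => ?_
  obtain ⟨h2, h3⟩ := hnI.1 i hi
  rw [uIcc_of_le zero_le_one] at h2 h3
  have z : (0 : ℝ) ∈ Icc (0 : ℝ) 1 := by simp
  rw [dist_eq_norm, dist_eq_norm, intervalIntegral.integral_interval_sub_left
    (intervalIntegrable_sub hk z h2) (intervalIntegrable_sub hk z h3)]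
  exact hf _ h2 _ h3

/-- The difference `f - ∫ f'` is absolutely continuous with derivative zero almost everywhere, hence
constant. The product and inverse rules follow from this: each needs only a bound on increments and
the pointwise derivative. -/
lemma of_ae [CompleteSpace F] {f f' : ℝ → F} {k : ℝ → ℝ} (hk : IntervalIntegrable k volume 0 1)
    (hf : ∀ x ∈ Icc (0 : ℝ) 1, ∀ y ∈ Icc (0 : ℝ) 1, ‖f x - f y‖ ≤ |∫ t in y..x, k t|)
    (hf' : IntervalIntegrable f' volume 0 1)
    (hd : ∀ᵐ x, x ∈ Ioo (0 : ℝ) 1 → HasDerivAt f (f' x) x) : HasACDeriv f f' := by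
  refine ⟨hf', ?_⟩
  let g : ℝ → F := fun x => f x - ∫ t in (0 : ℝ)..x, f' t
  have z : (0 : ℝ) ∈ Icc (0 : ℝ) 1 := by simp
  have hac : AbsolutelyContinuousOnInterval g 0 1 := by
    refine (ac_of_bound hk hf).sub (ac_of_bound hf'.norm ?_)
    intro x hx y hy
    rw [intervalIntegral.integral_interval_sub_left (intervalIntegrable_sub hf' z hx)
      (intervalIntegrable_sub hf' z hy)]
    exact intervalIntegral.norm_integral_le_abs_integral_norm
  obtain ⟨C, hC⟩ := hac.const_of_ae_hasDerivAt_zero (by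
    have h₁ : ∀ᵐ x : ℝ, x ≠ 0 := by simp [ae_iff, measure_singleton]
    have h₂ : ∀ᵐ x : ℝ, x ≠ 1 := by simp [ae_iff, measure_singleton]
    filter_upwards [hd, hf'.ae_hasDerivAt_integral, h₁, h₂] with x h1 h2 h3 h4 h5
    have h6 : x ∈ Ioo (0 : ℝ) 1 := by
      rw [uIcc_of_le zero_le_one] at h5
      exact ⟨lt_of_le_of_ne h5.1 (Ne.symm h3), lt_of_le_of_ne h5.2 h4⟩
    have := (h1 h6).sub (h2 h5 0 (by simp))
    rwa [sub_self] at this)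
  intro x hx
  rw [uIcc_of_le zero_le_one] at hC
  have h0 := hC 0 z
  have h1 := hC x hx
  simp only [g, intervalIntegral.integral_same, sub_zero] at h0 h1
  rw [h0, ← h1]; abel

lemma congr {f f' g g' : ℝ → F} (h : HasACDeriv f f') (hfg : ∀ x ∈ Icc (0 : ℝ) 1, f x = g x)
    (hfg' : ∀ᵐ x, x ∈ Ioo (0 : ℝ) 1 → f' x = g' x) : HasACDeriv g g' := by
  have h₂ : ∀ᵐ x : ℝ, x ≠ 1 := by simp [ae_iff, measure_singleton]
  have key : ∀ᵐ x, x ∈ Ioc (0 : ℝ) 1 → f' x = g' x := by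
    filter_upwards [hfg', h₂] with x h1 h2 h3
    exact h1 ⟨h3.1, lt_of_le_of_ne h3.2 h2⟩
  refine ⟨?_, ?_⟩
  · have := h.int
    rw [intervalIntegrable_iff_integrableOn_Ioc_of_le zero_le_one] at this ⊢
    exact Integrable.congr this ((ae_restrict_iff' measurableSet_Ioc).2 key)
  · intro x hx
    rw [← hfg x hx, ← hfg 0 (by simp), h.eq x hx]
    congr 1
    refine intervalIntegral.integral_congr_ae ?_
    filter_upwards [key] with y hy hy2
    rw [uIoc_of_le hx.1] at hy2
    exact hy ⟨hy2.1, hy2.2.trans hx.2⟩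

lemma ae_eq [CompleteSpace F] {f f' g g' : ℝ → F} (h : HasACDeriv f f') (k : HasACDeriv g g')
    (hfg : ∀ x ∈ Ioo (0 : ℝ) 1, f x = g x) : ∀ᵐ x, x ∈ Ioo (0 : ℝ) 1 → f' x = g' x := by
  filter_upwards [h.ae_hasDerivAt, k.ae_hasDerivAt] with x h1 h2 hx
  refine (h1 hx).unique ((h2 hx).congr_of_eventuallyEq ?_)
  filter_upwards [Ioo_mem_nhds hx.1 hx.2] with y hy
  exact hfg y hy

lemma hasDerivAt [CompleteSpace F] {f f' : ℝ → F} (h : HasACDeriv f f')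
    (hc : ContinuousOn f' (Icc 0 1)) {x : ℝ} (hx : x ∈ Ioo (0 : ℝ) 1) :
    HasDerivAt f (f' x) x := by
  have hx' := Ioo_subset_Icc_self hx
  have hca : ContinuousAt f' x := hc.continuousAt (Icc_mem_nhds hx.1 hx.2)
  have hm : StronglyMeasurableAtFilter f' (nhds x) volume :=
    (hc.mono Ioo_subset_Icc_self).stronglyMeasurableAtFilter isOpen_Ioo x hx
  have := (intervalIntegral.integral_hasDerivAt_right
    (intervalIntegrable_sub h.int (x := 0) (by simp) hx') hm hca).const_add (f 0)
  refine this.congr_of_eventuallyEq ?_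
  filter_upwards [Ioo_mem_nhds hx.1 hx.2] with y hy
  exact h.eq y (Ioo_subset_Icc_self hy)

lemma reflect {f f' : ℝ → F} (h : HasACDeriv f f') :
    HasACDeriv (fun x => f (1 - x)) (fun x => -f' (1 - x)) := by
  refine ⟨?_, fun x hx => ?_⟩
  · have := (h.int.comp_sub_left 1).symm
    simp only [sub_zero, sub_self] at this
    exact this.neg
  · have h1 : 1 - x ∈ Icc (0 : ℝ) 1 := ⟨by linarith [hx.2], by linarith [hx.1]⟩
    have z : (0 : ℝ) ∈ Icc (0 : ℝ) 1 := by simp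
    have o : (1 : ℝ) ∈ Icc (0 : ℝ) 1 := by simp
    rw [intervalIntegral.integral_neg, intervalIntegral.integral_comp_sub_left, sub_zero,
      h.eq _ h1, h.eq 1 o, ← intervalIntegral.integral_add_adjacent_intervals
        (intervalIntegrable_sub h.int z h1) (intervalIntegrable_sub h.int h1 o)]
    abel

lemma const (c : F) : HasACDeriv (fun _ => c) (fun _ => 0) :=
  ⟨_root_.intervalIntegrable_const, fun x _ => by simp⟩

lemma add {f f' g g' : ℝ → F} (h : HasACDeriv f f') (k : HasACDeriv g g') :
    HasACDeriv (fun x => f x + g x) (fun x => f' x + g' x) := by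
  refine ⟨h.int.add k.int, fun x hx => ?_⟩
  have z : (0 : ℝ) ∈ Icc (0 : ℝ) 1 := by simp
  rw [intervalIntegral.integral_add (intervalIntegrable_sub h.int z hx)
    (intervalIntegrable_sub k.int z hx), h.eq x hx, k.eq x hx]
  abel

lemma clm [CompleteSpace F] [CompleteSpace G] {f f' : ℝ → F} (h : HasACDeriv f f')
    (L : F →L[ℝ] G) : HasACDeriv (fun x => L (f x)) (fun x => L (f' x)) := by
  refine ⟨⟨L.integrable_comp h.int.1, L.integrable_comp h.int.2⟩, fun x hx => ?_⟩
  have z : (0 : ℝ) ∈ Icc (0 : ℝ) 1 := by simp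
  rw [L.intervalIntegral_comp_comm (intervalIntegrable_sub h.int z hx), ← map_add, ← h.eq x hx]

lemma neg {f f' : ℝ → F} (h : HasACDeriv f f') :
    HasACDeriv (fun x => -f x) (fun x => -f' x) := by
  refine ⟨h.int.neg, fun x hx => ?_⟩
  rw [intervalIntegral.integral_neg, h.eq x hx, neg_add]

lemma sub {f f' g g' : ℝ → F} (h : HasACDeriv f f') (k : HasACDeriv g g') :
    HasACDeriv (fun x => f x - g x) (fun x => f' x - g' x) := by
  simpa only [sub_eq_add_neg] using h.add k.neg

lemma of_continuousOn {f' : ℝ → F} (c : F) (h : ContinuousOn f' (Icc 0 1)) :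
    HasACDeriv (fun x => c + ∫ t in (0 : ℝ)..x, f' t) f' :=
  ⟨(h.mono (by rw [uIcc_of_le zero_le_one])).intervalIntegrable, fun x _ => by simp⟩

lemma of_hasDerivAt [CompleteSpace F] {f f' : ℝ → F} (hf : ∀ x, HasDerivAt f (f' x) x)
    (h : Continuous f') : HasACDeriv f f' := by
  refine ⟨h.intervalIntegrable _ _, fun x _ => ?_⟩
  rw [intervalIntegral.integral_eq_sub_of_hasDerivAt (fun y _ => hf y) (h.intervalIntegrable _ _)]
  abel

end Vector

section Ring

variable {A : Type*} [NormedRing A] [NormedAlgebra ℝ A] [CompleteSpace A]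

lemma intervalIntegrable_mul_cont {f g : ℝ → A} (hf : IntervalIntegrable f volume 0 1)
    (hg : ContinuousOn g (Icc 0 1)) : IntervalIntegrable (fun x => f x * g x) volume 0 1 :=
  hf.mul_continuousOn (by rwa [uIcc_of_le zero_le_one])

lemma intervalIntegrable_cont_mul {f g : ℝ → A} (hf : IntervalIntegrable f volume 0 1)
    (hg : ContinuousOn g (Icc 0 1)) : IntervalIntegrable (fun x => g x * f x) volume 0 1 :=
  hf.continuousOn_mul (by rwa [uIcc_of_le zero_le_one])

lemma mul {f f' g g' : ℝ → A} (h : HasACDeriv f f') (k : HasACDeriv g g') :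
    HasACDeriv (fun x => f x * g x) (fun x => f' x * g x + f x * g' x) := by
  obtain ⟨C, hC⟩ := isCompact_Icc.exists_bound_of_continuousOn h.continuousOn
  obtain ⟨D, hD⟩ := isCompact_Icc.exists_bound_of_continuousOn k.continuousOn
  have z : (0 : ℝ) ∈ Icc (0 : ℝ) 1 := by simp
  have hC0 : 0 ≤ C := (norm_nonneg _).trans (hC 0 z)
  have hD0 : 0 ≤ D := (norm_nonneg _).trans (hD 0 z)
  refine of_ae (k := fun t => D * ‖f' t‖ + C * ‖g' t‖)
    ((h.int.norm.const_mul D).add (k.int.norm.const_mul C)) ?_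
    ((intervalIntegrable_mul_cont h.int k.continuousOn).add
      (intervalIntegrable_cont_mul k.int h.continuousOn)) ?_
  · intro x hx y hy
    have e : f x * g x - f y * g y = (f x - f y) * g x + f y * (g x - g y) := by noncomm_ring
    rw [e]
    have h1 := h.norm_sub_le hx hy
    have h2 := k.norm_sub_le hx hy
    have i1 := (intervalIntegrable_sub h.int hy hx).norm
    have i2 := (intervalIntegrable_sub k.int hy hx).norm
    rw [intervalIntegral.integral_add (i1.const_mul D) (i2.const_mul C),
      intervalIntegral.integral_const_mul, intervalIntegral.integral_const_mul]
    -- Both integrals carry the sign of `x - y`, so the absolute value is additive here.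
    have h3 : |D * (∫ t in y..x, ‖f' t‖) + C * ∫ t in y..x, ‖g' t‖|
        = D * |∫ t in y..x, ‖f' t‖| + C * |∫ t in y..x, ‖g' t‖| := by
      rcases le_total y x with hyx | hyx
      · have p1 := intervalIntegral.integral_nonneg (μ := volume) hyx
          (fun t _ => norm_nonneg (f' t))
        have p2 := intervalIntegral.integral_nonneg (μ := volume) hyx
          (fun t _ => norm_nonneg (g' t))
        rw [abs_of_nonneg p1, abs_of_nonneg p2, abs_of_nonneg]
        positivity
      · have p1 := intervalIntegral.integral_nonneg (μ := volume) hyx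
          (fun t _ => norm_nonneg (f' t))
        have p2 := intervalIntegral.integral_nonneg (μ := volume) hyx
          (fun t _ => norm_nonneg (g' t))
        rw [intervalIntegral.integral_symm x y, intervalIntegral.integral_symm x y, abs_neg,
          abs_neg, abs_of_nonneg p1, abs_of_nonneg p2,
          show ∀ a b : ℝ, D * -a + C * -b = -(D * a + C * b) by intros; ring, abs_neg,
          abs_of_nonneg]
        positivity
    rw [h3]
    calc ‖(f x - f y) * g x + f y * (g x - g y)‖
        ≤ ‖f x - f y‖ * ‖g x‖ + ‖f y‖ * ‖g x - g y‖ :=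
          (norm_add_le _ _).trans (add_le_add (norm_mul_le _ _) (norm_mul_le _ _))
      _ ≤ |∫ t in y..x, ‖f' t‖| * D + C * |∫ t in y..x, ‖g' t‖| := by
          gcongr
          · exact hD x hx
          · exact hC y hy
      _ = _ := by ring
  · filter_upwards [h.ae_hasDerivAt, k.ae_hasDerivAt] with x h1 h2 hx
    exact (h1 hx).mul (h2 hx)

lemma const_mul {f f' : ℝ → A} (c : A) (h : HasACDeriv f f') :
    HasACDeriv (fun x => c * f x) (fun x => c * f' x) := by
  simpa using (const c).mul h

lemma mul_const {f f' : ℝ → A} (h : HasACDeriv f f') (c : A) :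
    HasACDeriv (fun x => f x * c) (fun x => f' x * c) := by
  simpa using h.mul (const c)

lemma continuousOn_inv {U D : ℝ → A} (h : ContinuousOn U (Icc 0 1))
    (h1 : ∀ x ∈ Icc (0 : ℝ) 1, D x * U x = 1) (h2 : ∀ x ∈ Icc (0 : ℝ) 1, U x * D x = 1) :
    ContinuousOn D (Icc 0 1) := by
  intro x hx
  have hu : ∀ y ∈ Icc (0 : ℝ) 1, Ring.inverse (U y) = D y := fun y hy =>
    Ring.inverse_unit ⟨U y, D y, h2 y hy, h1 y hy⟩
  have := (NormedRing.inverse_continuousAt ⟨U x, D x, h2 x hx, h1 x hx⟩).comp_continuousWithinAt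
    (f := U) (s := Icc 0 1) (x := x) (h x hx)
  exact this.congr (fun y hy => (hu y hy).symm) (hu x hx).symm

lemma inv {U U' D : ℝ → A} (h : HasACDeriv U U')
    (h1 : ∀ x ∈ Icc (0 : ℝ) 1, D x * U x = 1) (h2 : ∀ x ∈ Icc (0 : ℝ) 1, U x * D x = 1) :
    HasACDeriv D (fun x => -(D x * U' x * D x)) := by
  have hc := continuousOn_inv h.continuousOn h1 h2
  have hu : ∀ y ∈ Icc (0 : ℝ) 1, Ring.inverse (U y) = D y := fun y hy =>
    Ring.inverse_unit ⟨U y, D y, h2 y hy, h1 y hy⟩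
  obtain ⟨C, hC⟩ := isCompact_Icc.exists_bound_of_continuousOn hc
  have z : (0 : ℝ) ∈ Icc (0 : ℝ) 1 := by simp
  have hC0 : 0 ≤ C := (norm_nonneg _).trans (hC 0 z)
  refine of_ae (k := fun t => C * C * ‖U' t‖) (h.int.norm.const_mul _) ?_
    (intervalIntegrable_mul_cont (intervalIntegrable_cont_mul h.int hc) hc).neg ?_
  · intro x hx y hy
    have e : D x - D y = -(D x * (U x - U y) * D y) := by
      rw [mul_sub, sub_mul, h1 x hx, mul_assoc, h2 y hy]; simp
    rw [e, norm_neg, intervalIntegral.integral_const_mul, abs_mul,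
      abs_of_nonneg (mul_nonneg hC0 hC0)]
    calc ‖D x * (U x - U y) * D y‖ ≤ ‖D x‖ * ‖U x - U y‖ * ‖D y‖ :=
          (norm_mul_le _ _).trans (mul_le_mul_of_nonneg_right (norm_mul_le _ _) (norm_nonneg _))
      _ ≤ C * |∫ t in y..x, ‖U' t‖| * C := by
          gcongr
          · exact hC x hx
          · exact h.norm_sub_le hx hy
          · exact hC y hy
      _ = _ := by ring
  · filter_upwards [h.ae_hasDerivAt] with x hx hx1
    have hx2 := Ioo_subset_Icc_self hx1
    have := (hasFDerivAt_ringInverse (𝕜 := ℝ) (⟨U x, D x, h2 x hx2, h1 x hx2⟩ : Aˣ)).comp_hasDerivAt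
      x (hx hx1)
    refine HasDerivAt.congr_of_eventuallyEq (f := Ring.inverse ∘ U) ?_ ?_
    · simpa using this
    · filter_upwards [Ioo_mem_nhds hx1.1 hx1.2] with y hy
      exact (hu y (Ioo_subset_Icc_self hy)).symm

end Ring

section ComplexRing

variable {A : Type*} [NormedRing A] [NormedAlgebra ℂ A] [CompleteSpace A]

lemma star [StarRing A] [NormedStarGroup A] [StarModule ℂ A] {f f' : ℝ → A}
    (h : HasACDeriv f f') : HasACDeriv (fun x => star (f x)) (fun x => star (f' x)) :=
  h.clm ((starL' ℝ (A := A)) : A →L[ℝ] A)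

end ComplexRing

end HasACDeriv
end MatrixSL

end

/-! ### Volterra equations and entire dependence on the spectral parameter -/

noncomputable section

namespace MatrixSL

section Volterra

variable {F : Type*} [NormedAddCommGroup F] [NormedSpace ℂ F] [CompleteSpace F]

/-- The integrand of the Volterra operator. -/
lemma volterra_intervalIntegrable {Q : ℝ → F →L[ℂ] F} (hQ : IntervalIntegrable Q volume 0 1)
    {f : ℝ → F} (hf : ContinuousOn f (Icc 0 1)) :
    IntervalIntegrable (fun t => Q t (f t)) volume 0 1 := by
  obtain ⟨C, hC⟩ := isCompact_Icc.exists_bound_of_continuousOn hf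
  rw [intervalIntegrable_iff_integrableOn_Icc_of_le zero_le_one] at hQ ⊢
  have hm : AEStronglyMeasurable f (volume.restrict (Icc (0 : ℝ) 1)) :=
    hf.aestronglyMeasurable measurableSet_Icc
  refine Integrable.mono' (hQ.norm.mul_const C)
    ((ContinuousLinearMap.id ℂ (F →L[ℂ] F)).aestronglyMeasurable_comp₂
      hQ.aestronglyMeasurable hm) ?_
  filter_upwards [ae_restrict_mem measurableSet_Icc] with t ht
  exact ((Q t).le_opNorm (f t)).trans (mul_le_mul_of_nonneg_left (hC t ht) (norm_nonneg _))

/-- A continuous function on `[0,1]`, extended to the line. -/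
abbrev ext01 (f : C(Icc (0 : ℝ) 1, F)) : ℝ → F := IccExtend zero_le_one f

lemma ext01_continuous (f : C(Icc (0 : ℝ) 1, F)) : Continuous (ext01 f) :=
  f.continuous.Icc_extend'

lemma ext01_norm_le (f : C(Icc (0 : ℝ) 1, F)) (t : ℝ) : ‖ext01 f t‖ ≤ ‖f‖ :=
  f.norm_coe_le_norm _

lemma hasACDeriv_volterra {Q : ℝ → F →L[ℂ] F} (hQ : IntervalIntegrable Q volume 0 1)
    {f : ℝ → F} (hf : ContinuousOn f (Icc 0 1)) :
    HasACDeriv (fun x => ∫ t in (0 : ℝ)..x, Q t (f t)) (fun t => Q t (f t)) :=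
  ⟨volterra_intervalIntegrable hQ hf, fun x _ => by simp⟩

/-- The operator `f ↦ ∫₀ˣ Q f` on `C([0,1])`. -/
def volterra (Q : ℝ → F →L[ℂ] F) (hQ : IntervalIntegrable Q volume 0 1) :
    C(Icc (0 : ℝ) 1, F) →L[ℂ] C(Icc (0 : ℝ) 1, F) :=
  LinearMap.mkContinuous
    { toFun := fun f => ⟨fun x => ∫ t in (0 : ℝ)..x, Q t (ext01 f t),
        (hasACDeriv_volterra hQ (ext01_continuous f).continuousOn).continuousOn.domRestrict⟩
      map_add' := fun f g => by
        ext x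
        have e : ∀ t, Q t (ext01 (f + g) t) = Q t (ext01 f t) + Q t (ext01 g t) := fun t => by
          rw [← map_add]; rfl
        simp only [ContinuousMap.coe_mk, ContinuousMap.add_apply, e]
        exact intervalIntegral.integral_add
          (HasACDeriv.intervalIntegrable_sub (volterra_intervalIntegrable hQ
            (ext01_continuous f).continuousOn) (by simp) x.2)
          (HasACDeriv.intervalIntegrable_sub (volterra_intervalIntegrable hQ
            (ext01_continuous g).continuousOn) (by simp) x.2)
      map_smul' := fun c f => by
        ext x
        have e : ∀ t, Q t (ext01 (c • f) t) = c • Q t (ext01 f t) := fun t => by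
          rw [← map_smul]; rfl
        simp only [ContinuousMap.coe_mk, ContinuousMap.smul_apply, e, RingHom.id_apply]
        exact intervalIntegral.integral_smul _ _ }
    (∫ t in (0 : ℝ)..1, ‖Q t‖) (fun f => by
      refine (ContinuousMap.norm_le _ ?_).2 fun x => ?_
      · exact mul_nonneg (intervalIntegral.integral_nonneg zero_le_one fun t _ => norm_nonneg _)
          (norm_nonneg _)
      · have hx := x.2
        have hQx := HasACDeriv.intervalIntegrable_sub hQ (x := 0) (by simp) hx
        calc ‖∫ t in (0 : ℝ)..x, Q t (ext01 f t)‖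
            ≤ ∫ t in (0 : ℝ)..x, ‖Q t‖ * ‖f‖ := by
              refine intervalIntegral.norm_integral_le_of_norm_le hx.1
                (Filter.Eventually.of_forall fun t _ => ?_) (hQx.norm.mul_const _)
              exact ((Q t).le_opNorm _).trans
                (mul_le_mul_of_nonneg_left (ext01_norm_le f t) (norm_nonneg _))
          _ = (∫ t in (0 : ℝ)..x, ‖Q t‖) * ‖f‖ := intervalIntegral.integral_mul_const _ _
          _ ≤ _ := by
              refine mul_le_mul_of_nonneg_right ?_ (norm_nonneg _)
              exact intervalIntegral.integral_mono_interval le_rfl hx.1 hx.2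
                (Filter.Eventually.of_forall fun t => norm_nonneg _) hQ.norm)

lemma volterra_apply (Q : ℝ → F →L[ℂ] F) (hQ : IntervalIntegrable Q volume 0 1)
    (f : C(Icc (0 : ℝ) 1, F)) (x : Icc (0 : ℝ) 1) :
    volterra Q hQ f x = ∫ t in (0 : ℝ)..x, Q t (ext01 f t) := rfl

lemma hasACDeriv_pow {s s' : ℝ → ℝ} (h : HasACDeriv s s') (n : ℕ) :
    HasACDeriv (fun x => s x ^ (n + 1)) (fun x => (n + 1) * s' x * s x ^ n) := by
  induction n with
  | zero => simpa using h
  | succ n ih =>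
    refine (ih.mul h).congr (fun x _ => by ring) (Filter.Eventually.of_forall fun x _ => ?_)
    push_cast; ring

/-- With `s(x) = ∫₀ˣ ‖Q‖`, the function `s^(n+1)` has derivative `(n+1)‖Q‖ s^n`. The factorial
gained this way replaces any smallness assumption on `Q`. -/
lemma volterra_pow_le (Q : ℝ → F →L[ℂ] F) (hQ : IntervalIntegrable Q volume 0 1)
    (f : C(Icc (0 : ℝ) 1, F)) (n : ℕ) (x : Icc (0 : ℝ) 1) :
    ‖(volterra Q hQ ^ n) f x‖ ≤ (∫ t in (0 : ℝ)..x, ‖Q t‖) ^ n / n.factorial * ‖f‖ := by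
  induction n generalizing x with
  | zero => simpa using f.norm_coe_le_norm x
  | succ n ih =>
    rw [pow_succ', mul_apply_eq_comp, volterra_apply]
    have hs : HasACDeriv (fun x => ∫ t in (0 : ℝ)..x, ‖Q t‖) (fun t => ‖Q t‖) :=
      ⟨hQ.norm, fun x _ => by simp⟩
    have hp := hasACDeriv_pow hs n
    have hx := x.2
    have hi := HasACDeriv.intervalIntegrable_sub hp.int (x := 0) (by simp) hx
    have e := hp.eq x hx
    calc ‖∫ t in (0 : ℝ)..x, Q t (ext01 ((volterra Q hQ ^ n) f) t)‖
        ≤ ∫ t in (0 : ℝ)..x, ((n + 1) * ‖Q t‖ * (∫ s in (0 : ℝ)..t, ‖Q s‖) ^ n)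
            * (((n + 1).factorial : ℝ)⁻¹ * ‖f‖) := by
          refine intervalIntegral.norm_integral_le_of_norm_le hx.1
            (Filter.Eventually.of_forall fun t ht => ?_) (hi.mul_const _)
          have ht' : t ∈ Icc (0 : ℝ) 1 := ⟨ht.1.le, ht.2.trans hx.2⟩
          have h1 := ih ⟨t, ht'⟩
          have h2 : ext01 ((volterra Q hQ ^ n) f) t = (volterra Q hQ ^ n) f ⟨t, ht'⟩ :=
            IccExtend_of_mem zero_le_one _ ht'
          rw [h2]
          refine ((Q t).le_opNorm _).trans ((mul_le_mul_of_nonneg_left h1 (norm_nonneg _)).trans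
            (le_of_eq ?_))
          rw [Nat.factorial_succ]
          push_cast
          field_simp
      _ = _ := by
          rw [intervalIntegral.integral_mul_const]
          simp only [intervalIntegral.integral_same, ne_eq, Nat.add_eq_zero_iff, one_ne_zero,
            and_false, not_false_eq_true, zero_pow, zero_add] at e
          rw [← e]
          ring

/-- Some power `K^n` has norm below one, so `1 - K^n` is invertible; it is the product of the
commuting factors `1 - K` and `∑ K^i`, hence `1 - K` is invertible too. -/
lemma isUnit_one_sub_volterra (Q : ℝ → F →L[ℂ] F) (hQ : IntervalIntegrable Q volume 0 1) :
    IsUnit (1 - volterra Q hQ) := by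
  set K := volterra Q hQ
  set s := ∫ t in (0 : ℝ)..1, ‖Q t‖
  obtain ⟨n, hn⟩ := ((FloorSemiring.tendsto_pow_div_factorial_atTop s).eventually
    (gt_mem_nhds one_pos)).exists
  have hs : 0 ≤ s := intervalIntegral.integral_nonneg zero_le_one fun t _ => norm_nonneg _
  have hK : ‖K ^ n‖ < 1 := by
    refine lt_of_le_of_lt (ContinuousLinearMap.opNorm_le_bound _ (by positivity) fun f => ?_) hn
    refine (ContinuousMap.norm_le _ (by positivity)).2 fun x => ?_
    refine (volterra_pow_le Q hQ f n x).trans ?_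
    have h0 := intervalIntegral.integral_nonneg (μ := volume) x.2.1
      (fun t _ => norm_nonneg (Q t))
    gcongr
    exact intervalIntegral.integral_mono_interval le_rfl x.2.1 x.2.2
      (Filter.Eventually.of_forall fun t => norm_nonneg _) hQ.norm
  have hu : IsUnit (1 - K ^ n) := isUnit_one_sub_of_norm_lt_one
    (R := C(Icc (0 : ℝ) 1, F) →L[ℂ] C(Icc (0 : ℝ) 1, F)) hK
  have e := mul_neg_geom_sum K n
  have hc : Commute (1 - K) (∑ i ∈ Finset.range n, K ^ i) :=
    (Commute.sum_right _ _ _ fun i _ =>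
      ((Commute.one_left _).sub_left ((Commute.refl K).pow_right i)))
  rw [← e, hc.isUnit_mul_iff] at hu
  exact hu.1

end Volterra

lemma intervalIntegrable_clm_comp {E F : Type*} [NormedAddCommGroup E] [NormedSpace ℂ E]
    [NormedAddCommGroup F] [NormedSpace ℂ F] (L : E →L[ℂ] F) {f : ℝ → E}
    (hf : IntervalIntegrable f volume 0 1) : IntervalIntegrable (fun t => L (f t)) volume 0 1 :=
  ⟨L.integrable_comp hf.1, L.integrable_comp hf.2⟩

section Family

set_option maxSynthPendingDepth 6

variable {A : Type*} [NormedRing A] [NormedAlgebra ℂ A] [CompleteSpace A]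

/-- The pair `(Y, Y')` solves `Y'' = (Q - l) Y` on `[0,1]`. -/
structure IsSol (Q : ℝ → A) (l : ℂ) (Y Y' : ℝ → A) : Prop where
  d1 : HasACDeriv Y Y'
  d2 : HasACDeriv Y' (fun t => Q t * Y t - l • Y t)

/-- The coefficient of the first order system, as a function of the potential. -/
def sysL : A →L[ℂ] ((A × A) →L[ℂ] (A × A)) :=
  (ContinuousLinearMap.compL ℂ (A × A) A (A × A) (ContinuousLinearMap.inr ℂ A A)) ∘L
    ((ContinuousLinearMap.compL ℂ (A × A) A A).flip (ContinuousLinearMap.fst ℂ A A)) ∘L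
    (ContinuousLinearMap.mul ℂ A)

lemma sysL_apply (q : A) (z : A × A) : sysL q z = (0, q * z.1) := by
  simp [sysL]

/-- The nilpotent part of the first order system. -/
def sysN : (A × A) →L[ℂ] (A × A) :=
  (ContinuousLinearMap.inl ℂ A A) ∘L (ContinuousLinearMap.snd ℂ A A)

lemma sysN_apply (z : A × A) : sysN z = (z.2, 0) := by
  simp [sysN]

/-- The coefficient of the first order system. -/
def sysQ (Q : ℝ → A) (l : ℂ) (t : ℝ) : (A × A) →L[ℂ] (A × A) :=
  (sysN + sysL (Q t)) - l • sysL 1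

lemma sysQ_apply (Q : ℝ → A) (l : ℂ) (t : ℝ) (z : A × A) :
    sysQ Q l t z = (z.2, Q t * z.1 - l • z.1) := by
  simp [sysQ, sysL_apply, sysN_apply]

lemma intervalIntegrable_affine {F : Type*} [NormedAddCommGroup F] [NormedSpace ℂ F] (N c : F →L[ℂ] F)
    (L : A →L[ℂ] (F →L[ℂ] F)) {Q : ℝ → A} (hQ : IntervalIntegrable Q volume 0 1) :
    IntervalIntegrable (fun t => N + L (Q t) - c) volume 0 1 := by
  have h1 : IntervalIntegrable (fun t => L (Q t)) volume 0 1 :=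
    intervalIntegrable_clm_comp L hQ
  have h2 : IntervalIntegrable (fun _ : ℝ => N) volume 0 1 :=
    _root_.intervalIntegrable_const
  have h3 : IntervalIntegrable (fun _ : ℝ => c) volume 0 1 :=
    _root_.intervalIntegrable_const
  exact (h2.add h1).sub h3

lemma sysQ_int {Q : ℝ → A} (hQ : IntervalIntegrable Q volume 0 1) (l : ℂ) :
    IntervalIntegrable (sysQ Q l) volume 0 1 :=
  intervalIntegrable_affine (F := A × A) sysN (l • sysL 1) sysL hQ

/-- The operator is affine in `l`. Inversion being analytic, solutions are therefore entire in `l`,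
as elements of the space of continuous functions. -/
lemma volterra_sysQ {Q : ℝ → A} (hQ : IntervalIntegrable Q volume 0 1) (l : ℂ) :
    volterra (sysQ Q l) (sysQ_int hQ l) = volterra (sysQ Q 0) (sysQ_int hQ 0)
      - l • volterra (fun _ => sysL 1) intervalIntegrable_const := by
  ext1 f
  ext1 x
  simp only [sub_apply, smul_apply,
    ContinuousMap.sub_apply, ContinuousMap.smul_apply, volterra_apply]
  have hf := (ext01_continuous f).continuousOn (s := Icc (0 : ℝ) 1)
  rw [← intervalIntegral.integral_smul, ← intervalIntegral.integral_sub]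
  · refine intervalIntegral.integral_congr fun t _ => ?_
    simp [sysQ]
  · exact HasACDeriv.intervalIntegrable_sub
      (volterra_intervalIntegrable (sysQ_int hQ 0) hf) (by simp) x.2
  · exact (HasACDeriv.intervalIntegrable_sub
      (volterra_intervalIntegrable (Q := fun _ : ℝ => sysL (1 : A)) intervalIntegrable_const hf)
      (by simp) x.2).smul l

/-- The solution of the first order system with initial value `z`. -/
def sysSol {Q : ℝ → A} (hQ : IntervalIntegrable Q volume 0 1) (z : A × A) (l : ℂ) :
    C(Icc (0 : ℝ) 1, A × A) :=
  Ring.inverse (1 - volterra (sysQ Q l) (sysQ_int hQ l)) (ContinuousMap.const _ z)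

lemma sysSol_eq {Q : ℝ → A} (hQ : IntervalIntegrable Q volume 0 1) (z : A × A) (l : ℂ)
    (x : Icc (0 : ℝ) 1) :
    sysSol hQ z l x = z + ∫ t in (0 : ℝ)..x, sysQ Q l t (ext01 (sysSol hQ z l) t) := by
  have h := Ring.mul_inverse_cancel _ (isUnit_one_sub_volterra (sysQ Q l) (sysQ_int hQ l))
  have h1 := DFunLike.congr_fun (DFunLike.congr_fun h (ContinuousMap.const _ z)) x
  simp only [mul_apply_eq_comp, sub_apply,
    one_apply_eq_self, ContinuousMap.sub_apply, ContinuousMap.const_apply] at h1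
  rw [← volterra_apply _ (sysQ_int hQ l)]
  exact sub_eq_iff_eq_add.1 h1

lemma sysSol_differentiable {Q : ℝ → A} (hQ : IntervalIntegrable Q volume 0 1) (z : A × A) :
    Differentiable ℂ (sysSol hQ z) := by
  intro l
  have h1 : DifferentiableAt ℂ
      (fun l => Ring.inverse (1 - volterra (sysQ Q l) (sysQ_int hQ l))) l := by
    have h2 : DifferentiableAt ℂ Ring.inverse (1 - volterra (sysQ Q l) (sysQ_int hQ l)) :=
      differentiableAt_inverse (isUnit_one_sub_volterra (sysQ Q l) (sysQ_int hQ l))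
    refine DifferentiableAt.comp (𝕜 := ℂ) l (g := Ring.inverse)
      (f := fun l => 1 - volterra (sysQ Q l) (sysQ_int hQ l)) h2 ?_
    have e : (fun l => 1 - volterra (sysQ Q l) (sysQ_int hQ l)) = fun l =>
        1 - (volterra (sysQ Q 0) (sysQ_int hQ 0)
          - l • volterra (fun _ => sysL 1) intervalIntegrable_const) :=
      funext fun l => by rw [volterra_sysQ hQ l]
    rw [e]
    fun_prop
  exact h1.clm_apply (differentiableAt_const _)

/-- The solution of `Y'' = (Q - l) Y` with `Y(0) = a`, `Y'(0) = b`. -/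
def sol {Q : ℝ → A} (hQ : IntervalIntegrable Q volume 0 1) (a b : A) (l : ℂ) (x : ℝ) : A :=
  (ext01 (sysSol hQ (a, b) l) x).1

/-- The derivative of `sol`. -/
def sol' {Q : ℝ → A} (hQ : IntervalIntegrable Q volume 0 1) (a b : A) (l : ℂ) (x : ℝ) : A :=
  (ext01 (sysSol hQ (a, b) l) x).2

lemma hasACDeriv_sysSol {Q : ℝ → A} (hQ : IntervalIntegrable Q volume 0 1) (z : A × A) (l : ℂ) :
    HasACDeriv (ext01 (sysSol hQ z l)) (fun t => sysQ Q l t (ext01 (sysSol hQ z l) t)) := by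
  refine ⟨volterra_intervalIntegrable (sysQ_int hQ l) (ext01_continuous _).continuousOn, ?_⟩
  intro x hx
  rw [ext01, IccExtend_of_mem zero_le_one _ hx, IccExtend_of_mem zero_le_one _ (x := 0) (by simp),
    sysSol_eq, sysSol_eq]
  simp

variable {Q : ℝ → A} (hQ : IntervalIntegrable Q volume 0 1) (a b : A) (l : ℂ)

lemma sol_isSol : IsSol Q l (sol hQ a b l) (sol' hQ a b l) := by
  have h := hasACDeriv_sysSol hQ (a, b) l
  have h1 := h.clm (ContinuousLinearMap.fst ℝ A A)
  have h2 := h.clm (ContinuousLinearMap.snd ℝ A A)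
  simp only [sysQ_apply] at h1 h2
  exact ⟨h1, h2⟩

lemma sol_zero : sol hQ a b l 0 = a := by
  rw [sol, ext01, IccExtend_of_mem zero_le_one _ (x := 0) (by simp), sysSol_eq]; simp

lemma sol'_zero : sol' hQ a b l 0 = b := by
  rw [sol', ext01, IccExtend_of_mem zero_le_one _ (x := 0) (by simp), sysSol_eq]; simp

lemma sol_differentiable (x : ℝ) : Differentiable ℂ (fun l => sol hQ a b l x) := by
  let e : C(Icc (0 : ℝ) 1, A × A) →L[ℂ] A × A :=
    ContinuousMap.evalCLM ℂ (projIcc (0 : ℝ) 1 zero_le_one x)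
  exact fun l => ((ContinuousLinearMap.fst ℂ A A ∘L e).differentiableAt).comp l
    (sysSol_differentiable hQ (a, b) l)

lemma sol'_differentiable (x : ℝ) : Differentiable ℂ (fun l => sol' hQ a b l x) := by
  let e : C(Icc (0 : ℝ) 1, A × A) →L[ℂ] A × A :=
    ContinuousMap.evalCLM ℂ (projIcc (0 : ℝ) 1 zero_le_one x)
  exact fun l => ((ContinuousLinearMap.snd ℂ A A ∘L e).differentiableAt).comp l
    (sysSol_differentiable hQ (a, b) l)

lemma sol_continuous : Continuous (fun p : ℂ × ℝ => sol hQ a b p.1 p.2) := by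
  have h := (sysSol_differentiable hQ (a, b)).continuous
  have h2 : Continuous (fun p : ℂ × ℝ =>
      (sysSol hQ (a, b) p.1) (projIcc (0 : ℝ) 1 zero_le_one p.2)) :=
    (h.comp continuous_fst).eval (continuous_projIcc.comp continuous_snd)
  exact continuous_fst.comp h2

variable {a b l} in
lemma IsSol.eq_zero {Y Y' : ℝ → A} (hQ : IntervalIntegrable Q volume 0 1) (h : IsSol Q l Y Y')
    (h0 : Y 0 = 0) (h0' : Y' 0 = 0) {x : ℝ}
    (hx : x ∈ Icc (0 : ℝ) 1) : Y x = 0 ∧ Y' x = 0 := by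
  let z : C(Icc (0 : ℝ) 1, A × A) := ⟨fun x => (Y x, Y' x),
    (h.d1.continuousOn.prodMk h.d2.continuousOn).domRestrict⟩
  have hz : (1 - volterra (sysQ Q l) (sysQ_int hQ l)) z = 0 := by
    ext1 x
    have hx := x.2
    simp only [sub_apply, one_apply_eq_self,
      ContinuousMap.sub_apply, ContinuousMap.zero_apply, volterra_apply]
    have e : ∫ t in (0 : ℝ)..x, sysQ Q l t (ext01 z t)
        = ∫ t in (0 : ℝ)..x, (Y' t, Q t * Y t - l • Y t) := by
      refine intervalIntegral.integral_congr fun t ht => ?_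
      rw [uIcc_of_le hx.1] at ht
      have ht' : t ∈ Icc (0 : ℝ) 1 := ⟨ht.1, ht.2.trans hx.2⟩
      simp only [ext01, IccExtend_of_mem zero_le_one _ ht', sysQ_apply]
      rfl
    have i1 := HasACDeriv.intervalIntegrable_sub h.d1.int (x := 0) (by simp) hx
    have i2 := HasACDeriv.intervalIntegrable_sub h.d2.int (x := 0) (by simp) hx
    have e2 : ∫ t in (0 : ℝ)..x, (Y' t, Q t * Y t - l • Y t)
        = (∫ t in (0 : ℝ)..x, Y' t, ∫ t in (0 : ℝ)..x, (Q t * Y t - l • Y t)) := by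
      simp only [intervalIntegral.integral_of_le hx.1]
      exact integral_pair i1.1 i2.1
    rw [e, e2]
    have a1 := h.d1.eq x hx
    have a2 := h.d2.eq x hx
    rw [h0, zero_add] at a1
    rw [h0', zero_add] at a2
    rw [← a1, ← a2]
    exact sub_self _
  have hu := Ring.inverse_mul_cancel _ (isUnit_one_sub_volterra (sysQ Q l) (sysQ_int hQ l))
  have h1 := DFunLike.congr_fun hu z
  rw [mul_apply_eq_comp, hz, map_zero] at h1
  have h2 := DFunLike.congr_fun h1.symm ⟨x, hx⟩
  exact Prod.ext_iff.1 (show (Y x, Y' x) = (0 : A × A) from h2)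

end Family
end MatrixSL

end

/-! ### Wronskian identities and estimates for large spectral parameter -/

noncomputable section

namespace MatrixSL

section SolutionAlgebra

variable {A : Type*} [NormedRing A] [NormedAlgebra ℂ A] [CompleteSpace A]
variable {Q : ℝ → A} {l m : ℂ} {Y Y' Z Z' : ℝ → A}

lemma IsSol.sub (h : IsSol Q l Y Y') (k : IsSol Q l Z Z') :
    IsSol Q l (fun x => Y x - Z x) (fun x => Y' x - Z' x) := by
  refine ⟨h.d1.sub k.d1, (h.d2.sub k.d2).congr (fun _ _ => rfl)
    (Filter.Eventually.of_forall fun x _ => ?_)⟩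
  simp only [mul_sub, smul_sub]
  abel

lemma IsSol.mul_const (h : IsSol Q l Y Y') (c : A) :
    IsSol Q l (fun x => Y x * c) (fun x => Y' x * c) := by
  refine ⟨h.d1.mul_const c, (h.d2.mul_const c).congr (fun _ _ => rfl)
    (Filter.Eventually.of_forall fun x _ => ?_)⟩
  simp only [sub_mul, mul_assoc, smul_mul_assoc]

lemma IsSol.unique (hQ : IntervalIntegrable Q volume 0 1) (h : IsSol Q l Y Y')
    (k : IsSol Q l Z Z') (h0 : Y 0 = Z 0) (h0' : Y' 0 = Z' 0) {x : ℝ}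
    (hx : x ∈ Icc (0 : ℝ) 1) : Y x = Z x ∧ Y' x = Z' x := by
  have := (h.sub k).eq_zero hQ (by simp [h0]) (by simp [h0']) hx
  exact ⟨sub_eq_zero.1 this.1, sub_eq_zero.1 this.2⟩

/-- Self-adjointness of `Q` cancels the potential and only the two spectral parameters survive.
Since `star` conjugates `l`, the Wronskian is constant for the parameters `star l` and `l`. -/
lemma IsSol.wronskian [StarRing A] [NormedStarGroup A] [StarModule ℂ A]
    (hs : ∀ᵐ t, t ∈ Ioo (0 : ℝ) 1 → star (Q t) = Q t)
    (h : IsSol Q l Y Y') (k : IsSol Q m Z Z') :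
    HasACDeriv (fun x => star (Y' x) * Z x - star (Y x) * Z' x)
      (fun x => (m - star l) • (star (Y x) * Z x)) := by
  refine ((h.d2.star.mul k.d1).sub (h.d1.star.mul k.d2)).congr (fun _ _ => rfl) ?_
  filter_upwards [hs] with t ht ht1
  simp only [star_sub, star_mul, star_smul, ht ht1, sub_smul, sub_mul, mul_sub, mul_assoc,
    smul_mul_assoc, mul_smul_comm]
  abel

lemma IsSol.wronskian_eq [StarRing A] [NormedStarGroup A] [StarModule ℂ A]
    (hs : ∀ᵐ t, t ∈ Ioo (0 : ℝ) 1 → star (Q t) = Q t)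
    (h : IsSol Q l Y Y') (k : IsSol Q m Z Z') {x : ℝ} (hx : x ∈ Icc (0 : ℝ) 1) :
    star (Y' x) * Z x - star (Y x) * Z' x = star (Y' 0) * Z 0 - star (Y 0) * Z' 0
      + (m - star l) • ∫ t in (0 : ℝ)..x, star (Y t) * Z t := by
  rw [(h.wronskian hs k).eq x hx, intervalIntegral.integral_smul]

lemma IsSol.wronskian_const [StarRing A] [NormedStarGroup A] [StarModule ℂ A]
    (hs : ∀ᵐ t, t ∈ Ioo (0 : ℝ) 1 → star (Q t) = Q t)
    (h : IsSol Q (star l) Y Y') (k : IsSol Q l Z Z') {x : ℝ} (hx : x ∈ Icc (0 : ℝ) 1) :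
    star (Y' x) * Z x - star (Y x) * Z' x = star (Y' 0) * Z 0 - star (Y 0) * Z' 0 := by
  rw [h.wronskian_eq hs k hx]
  simp

lemma hasACDeriv_smul {s s' : ℝ → ℂ} (hs : ∀ t, HasDerivAt s (s' t) t) (hs' : Continuous s')
    (h : HasACDeriv Y Y') :
    HasACDeriv (fun t => s t • Y t) (fun t => s' t • Y t + s t • Y' t) := by
  have h1 : HasACDeriv (fun t => s t • (1 : A)) (fun t => s' t • (1 : A)) :=
    HasACDeriv.of_hasDerivAt (fun t => (hs t).smul_const 1) (hs'.smul continuous_const)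
  simpa using h1.mul h

/-- Since `s'' = -l s`, the terms with `l` cancel. With `s` a sine or cosine of `w (x - t)`,
integrating from `0` to `x` yields the integral equations for `Y` and `Y'`. -/
lemma IsSol.variation {s s' : ℝ → ℂ} (h : IsSol Q l Y Y') (hs : ∀ t, HasDerivAt s (s' t) t)
    (hs' : ∀ t, HasDerivAt s' (-(l * s t)) t) :
    HasACDeriv (fun t => s t • Y' t - s' t • Y t) (fun t => s t • (Q t * Y t)) := by
  have c1 : Continuous s := continuous_iff_continuousAt.2 fun t => (hs t).continuousAt
  have c2 : Continuous s' := continuous_iff_continuousAt.2 fun t => (hs' t).continuousAt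
  refine ((hasACDeriv_smul hs c2 h.d2).sub
    (hasACDeriv_smul hs' (continuous_const.mul c1).neg h.d1)).congr (fun _ _ => rfl)
    (Filter.Eventually.of_forall fun x _ => ?_)
  simp only [smul_sub, neg_smul, mul_smul, smul_comm l (s x)]
  abel

variable {w : ℂ}

lemma hasDerivAt_sin_shift (w : ℂ) (x t : ℝ) :
    HasDerivAt (fun t : ℝ => Complex.sin (w * (x - t))) (-(w * Complex.cos (w * (x - t)))) t := by
  have h1 : HasDerivAt (fun t : ℝ => w * ((x : ℂ) - t)) (w * (0 - 1)) t :=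
    ((hasDerivAt_const t (x : ℂ)).sub (HasDerivAt.ofReal_comp (hasDerivAt_id t))).const_mul w
  convert! (Complex.hasDerivAt_sin _).comp t h1 using 1
  ring

lemma hasDerivAt_cos_shift (w : ℂ) (x t : ℝ) :
    HasDerivAt (fun t : ℝ => Complex.cos (w * (x - t))) (w * Complex.sin (w * (x - t))) t := by
  have h1 : HasDerivAt (fun t : ℝ => w * ((x : ℂ) - t)) (w * (0 - 1)) t :=
    ((hasDerivAt_const t (x : ℂ)).sub (HasDerivAt.ofReal_comp (hasDerivAt_id t))).const_mul w
  convert! (Complex.hasDerivAt_cos _).comp t h1 using 1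
  ring

lemma IsSol.sin_formula (h : IsSol Q (w ^ 2) Y Y') (hw : w ≠ 0) (h0 : Y 0 = 0) (h0' : Y' 0 = 1)
    {x : ℝ} (hx : x ∈ Icc (0 : ℝ) 1) :
    Y x = (Complex.sin (w * x) / w) • (1 : A)
      + ∫ t in (0 : ℝ)..x, (Complex.sin (w * (x - t)) / w) • (Q t * Y t) := by
  have k := h.variation (s := fun t => Complex.sin (w * (x - t)) / w)
    (s' := fun t => -Complex.cos (w * (x - t)))
    (fun t => by
      convert! (hasDerivAt_sin_shift w x t).div_const w using 1
      field_simp)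
    (fun t => by
      convert! (hasDerivAt_cos_shift w x t).neg using 1
      field_simp)
  have e := k.eq x hx
  simpa [h0, h0'] using e

lemma IsSol.cos_formula (h : IsSol Q (w ^ 2) Y Y') (h0 : Y 0 = 0) (h0' : Y' 0 = 1)
    {x : ℝ} (hx : x ∈ Icc (0 : ℝ) 1) :
    Y' x = (Complex.cos (w * x)) • (1 : A)
      + ∫ t in (0 : ℝ)..x, (Complex.cos (w * (x - t))) • (Q t * Y t) := by
  have k := h.variation (s := fun t => Complex.cos (w * (x - t)))
    (s' := fun t => w * Complex.sin (w * (x - t)))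
    (fun t => hasDerivAt_cos_shift w x t)
    (fun t => by
      convert! (hasDerivAt_sin_shift w x t).const_mul w using 1
      ring)
  have e := k.eq x hx
  simpa [h0, h0'] using e

lemma norm_cexp_mul_I_le (z : ℂ) : ‖Complex.exp (z * Complex.I)‖ ≤ Real.exp |z.im| := by
  rw [Complex.norm_exp]
  simp only [Complex.mul_re, Complex.I_re, mul_zero, Complex.I_im, mul_one, zero_sub]
  exact Real.exp_le_exp.2 (neg_le_abs _)

lemma norm_cexp_neg_mul_I_le (z : ℂ) : ‖Complex.exp (-z * Complex.I)‖ ≤ Real.exp |z.im| := by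
  simpa using norm_cexp_mul_I_le (-z)

lemma norm_sin_le (z : ℂ) : ‖Complex.sin z‖ ≤ Real.exp |z.im| := by
  rw [Complex.sin, norm_div, norm_mul, Complex.norm_I, mul_one, Complex.norm_two]
  have := norm_sub_le (Complex.exp (-z * Complex.I)) (Complex.exp (z * Complex.I))
  linarith [norm_cexp_mul_I_le z, norm_cexp_neg_mul_I_le z]

lemma norm_cos_le (z : ℂ) : ‖Complex.cos z‖ ≤ Real.exp |z.im| := by
  rw [Complex.cos, norm_div, Complex.norm_two]
  have := norm_add_le (Complex.exp (z * Complex.I)) (Complex.exp (-z * Complex.I))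
  linarith [norm_cexp_mul_I_le z, norm_cexp_neg_mul_I_le z]

lemma abs_im_mul_ofReal (w : ℂ) {y : ℝ} (hy : 0 ≤ y) : |(w * y).im| = |w.im| * y := by
  simp [Complex.mul_im, abs_mul, abs_of_nonneg hy]

lemma norm_integral_le_of_kernel {K : ℝ → ℂ} {Q Y : ℝ → A} {x b M τ : ℝ}
    (hQ : IntervalIntegrable Q volume 0 1) (hx : x ∈ Icc (0 : ℝ) 1)
    (hK : ∀ t ∈ Icc (0 : ℝ) x, ‖K t‖ ≤ b * Real.exp (τ * (x - t)))
    (hY : ∀ t ∈ Icc (0 : ℝ) 1, ‖Y t‖ ≤ M * Real.exp (τ * t)) (hb : 0 ≤ b) (hM : 0 ≤ M) :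
    ‖∫ t in (0 : ℝ)..x, K t • (Q t * Y t)‖
      ≤ b * M * Real.exp (τ * x) * ∫ t in (0 : ℝ)..1, ‖Q t‖ := by
  have hQx := HasACDeriv.intervalIntegrable_sub hQ (x := 0) (by simp) hx
  calc ‖∫ t in (0 : ℝ)..x, K t • (Q t * Y t)‖
      ≤ ∫ t in (0 : ℝ)..x, b * M * Real.exp (τ * x) * ‖Q t‖ := by
        refine intervalIntegral.norm_integral_le_of_norm_le hx.1
          (Filter.Eventually.of_forall fun t ht => ?_) (hQx.norm.const_mul _)
        have h1 := hK t ⟨ht.1.le, ht.2⟩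
        have h2 := hY t ⟨ht.1.le, ht.2.trans hx.2⟩
        calc ‖K t • (Q t * Y t)‖ ≤ ‖K t‖ * (‖Q t‖ * ‖Y t‖) := by
              rw [norm_smul]
              exact mul_le_mul_of_nonneg_left (norm_mul_le _ _) (norm_nonneg _)
          _ ≤ (b * Real.exp (τ * (x - t))) * (‖Q t‖ * (M * Real.exp (τ * t))) := by
              gcongr
          _ = b * M * (Real.exp (τ * (x - t)) * Real.exp (τ * t)) * ‖Q t‖ := by ring
          _ = _ := by rw [← Real.exp_add]; ring_nf
    _ = b * M * Real.exp (τ * x) * ∫ t in (0 : ℝ)..x, ‖Q t‖ :=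
        intervalIntegral.integral_const_mul _ _
    _ ≤ _ := by
        refine mul_le_mul_of_nonneg_left ?_ (by positivity)
        exact intervalIntegral.integral_mono_interval le_rfl hx.1 hx.2
          (Filter.Eventually.of_forall fun t => norm_nonneg _) hQ.norm

variable [NormOneClass A]

lemma sin_kernel_le (w : ℂ) (x : ℝ) :
    ∀ t ∈ Icc (0 : ℝ) x, ‖Complex.sin (w * (x - t)) / w‖
      ≤ ‖w‖⁻¹ * Real.exp (|w.im| * (x - t)) := by
  intro t ht
  have h1 := norm_sin_le (w * ((x - t : ℝ) : ℂ))
  rw [abs_im_mul_ofReal w (sub_nonneg.2 ht.2)] at h1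
  push_cast at h1
  rw [norm_div, div_eq_inv_mul]
  gcongr

/-- The fundamental solution is bounded by the free one, for large `|w|`. -/
lemma IsSol.norm_le (hQ : IntervalIntegrable Q volume 0 1) (h : IsSol Q (w ^ 2) Y Y')
    (hw : w ≠ 0) (hw2 : 2 * ∫ t in (0 : ℝ)..1, ‖Q t‖ ≤ ‖w‖) (h0 : Y 0 = 0) (h0' : Y' 0 = 1)
    {x : ℝ} (hx : x ∈ Icc (0 : ℝ) 1) : ‖Y x‖ ≤ 2 * ‖w‖⁻¹ * Real.exp (|w.im| * x) := by
  set τ := |w.im|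
  set c := ∫ t in (0 : ℝ)..1, ‖Q t‖
  have hwp : 0 < ‖w‖ := norm_pos_iff.2 hw
  have hcont : ContinuousOn (fun x => ‖Y x‖ * Real.exp (-(τ * x))) (Icc 0 1) :=
    h.d1.continuousOn.norm.mul (by fun_prop)
  -- The maximum `M` of the weighted norm absorbs the integral term: `M ≤ 1/‖w‖ + M c/‖w‖`, and
  -- `c/‖w‖ ≤ 1/2`.
  obtain ⟨x0, hx0, hmax⟩ := isCompact_Icc.exists_isMaxOn ⟨0, by simp⟩ hcont
  set M := ‖Y x0‖ * Real.exp (-(τ * x0))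
  have hM0 : 0 ≤ M := by positivity
  have hY : ∀ t ∈ Icc (0 : ℝ) 1, ‖Y t‖ ≤ M * Real.exp (τ * t) := by
    intro t ht
    have h1 : ‖Y t‖ * Real.exp (-(τ * t)) ≤ M := hmax ht
    calc ‖Y t‖ = ‖Y t‖ * Real.exp (-(τ * t)) * Real.exp (τ * t) := by
          rw [mul_assoc, ← Real.exp_add]; simp
      _ ≤ _ := by gcongr
  have h1 := norm_integral_le_of_kernel hQ hx0 (sin_kernel_le w x0) hY (by positivity) hM0
  have h2 : ‖Y x0‖ ≤ ‖w‖⁻¹ * Real.exp (τ * x0) + ‖w‖⁻¹ * M * Real.exp (τ * x0) * c := by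
    rw [h.sin_formula hw h0 h0' hx0]
    refine (norm_add_le _ _).trans (add_le_add ?_ h1)
    rw [norm_smul, norm_one, mul_one]
    have := sin_kernel_le w x0 0 ⟨le_rfl, hx0.1⟩
    simpa using this
  have h3 : M ≤ ‖w‖⁻¹ + ‖w‖⁻¹ * M * c := by
    have e1 : Real.exp (τ * x0) * Real.exp (-(τ * x0)) = 1 := by
      rw [← Real.exp_add]; simp
    calc M ≤ (‖w‖⁻¹ * Real.exp (τ * x0) + ‖w‖⁻¹ * M * Real.exp (τ * x0) * c)
          * Real.exp (-(τ * x0)) := by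
          simp only [M]; gcongr
      _ = (‖w‖⁻¹ + ‖w‖⁻¹ * M * c) * (Real.exp (τ * x0) * Real.exp (-(τ * x0))) := by ring
      _ = _ := by rw [e1, mul_one]
  have h4 : ‖w‖⁻¹ * c ≤ 1 / 2 := by
    rw [inv_mul_le_iff₀ hwp]; linarith
  have h5 : M ≤ 2 * ‖w‖⁻¹ := by nlinarith
  exact (hY x hx).trans (by gcongr)

lemma IsSol.norm_sub_sin_le (hQ : IntervalIntegrable Q volume 0 1) (h : IsSol Q (w ^ 2) Y Y')
    (hw : w ≠ 0) (hw2 : 2 * ∫ t in (0 : ℝ)..1, ‖Q t‖ ≤ ‖w‖) (h0 : Y 0 = 0) (h0' : Y' 0 = 1)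
    {x : ℝ} (hx : x ∈ Icc (0 : ℝ) 1) :
    ‖Y x - (Complex.sin (w * x) / w) • (1 : A)‖
      ≤ 2 * (∫ t in (0 : ℝ)..1, ‖Q t‖) * ‖w‖⁻¹ ^ 2 * Real.exp (|w.im| * x) := by
  rw [h.sin_formula hw h0 h0' hx, add_sub_cancel_left]
  refine (norm_integral_le_of_kernel (M := 2 * ‖w‖⁻¹) hQ hx (sin_kernel_le w x) (fun t ht =>
    h.norm_le hQ hw hw2 h0 h0' ht) (by positivity) (by positivity)).trans (le_of_eq ?_)
  ring

lemma IsSol.norm_deriv_le (hQ : IntervalIntegrable Q volume 0 1) (h : IsSol Q (w ^ 2) Y Y')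
    (hw : w ≠ 0) (hw2 : 2 * ∫ t in (0 : ℝ)..1, ‖Q t‖ ≤ ‖w‖) (h0 : Y 0 = 0) (h0' : Y' 0 = 1)
    {x : ℝ} (hx : x ∈ Icc (0 : ℝ) 1) : ‖Y' x‖ ≤ 2 * Real.exp (|w.im| * x) := by
  have hwp : 0 < ‖w‖ := norm_pos_iff.2 hw
  have hK : ∀ t ∈ Icc (0 : ℝ) x, ‖Complex.cos (w * (x - t))‖
      ≤ 1 * Real.exp (|w.im| * (x - t)) := by
    intro t ht
    have h1 := norm_cos_le (w * ((x - t : ℝ) : ℂ))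
    rw [abs_im_mul_ofReal w (sub_nonneg.2 ht.2)] at h1
    push_cast at h1
    simpa using h1
  have h1 := norm_integral_le_of_kernel (M := 2 * ‖w‖⁻¹) hQ hx hK (fun t ht =>
    h.norm_le hQ hw hw2 h0 h0' ht) (by positivity) (by positivity)
  have h2 := hK 0 ⟨le_rfl, hx.1⟩
  have h4 : 2 * ‖w‖⁻¹ * (∫ t in (0 : ℝ)..1, ‖Q t‖) ≤ 1 := by
    rw [mul_assoc, mul_left_comm, inv_mul_le_iff₀ hwp]; linarith
  rw [h.cos_formula h0 h0' hx]
  refine (norm_add_le _ _).trans ?_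
  rw [norm_smul, norm_one, mul_one]
  have h5 : ‖Complex.cos (w * x)‖ ≤ Real.exp (|w.im| * x) := by simpa using h2
  have h6 := mul_le_mul_of_nonneg_right h4 (Real.exp_pos (|w.im| * x)).le
  linarith

lemma isUnit_of_norm_sub_le {X : A} {c : ℂ} (hc : c ≠ 0) (h : ‖X - c • (1 : A)‖ ≤ ‖c‖ / 2) :
    IsUnit X ∧ ‖Ring.inverse X‖ ≤ 2 * ‖c‖⁻¹ := by
  have hcp : 0 < ‖c‖ := norm_pos_iff.2 hc
  have h1 : ‖1 - c⁻¹ • X‖ ≤ 1 / 2 := by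
    have e : 1 - c⁻¹ • X = -(c⁻¹ • (X - c • (1 : A))) := by
      rw [smul_sub, smul_smul, inv_mul_cancel₀ hc, one_smul]; abel
    rw [e, norm_neg, norm_smul, norm_inv, inv_mul_le_iff₀ hcp]
    linarith
  have hu : IsUnit (c⁻¹ • X) := by
    have := isUnit_one_sub_of_norm_lt_one (x := 1 - c⁻¹ • X) (by linarith)
    simpa using this
  have hX : IsUnit X := by
    have := hu.smul (Units.mk0 c hc)
    simpa [Units.smul_def, smul_smul, hc] using this
  refine ⟨hX, ?_⟩
  have e : Ring.inverse X = c⁻¹ • (1 : A) + (1 - c⁻¹ • X) * Ring.inverse X := by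
    rw [sub_mul, smul_mul_assoc, Ring.mul_inverse_cancel _ hX, one_mul]; abel
  have h2 : ‖Ring.inverse X‖ ≤ ‖c‖⁻¹ + 1 / 2 * ‖Ring.inverse X‖ := by
    calc ‖Ring.inverse X‖ = ‖c⁻¹ • (1 : A) + (1 - c⁻¹ • X) * Ring.inverse X‖ := by rw [← e]
      _ ≤ ‖c⁻¹ • (1 : A)‖ + ‖1 - c⁻¹ • X‖ * ‖Ring.inverse X‖ :=
        (norm_add_le _ _).trans (add_le_add_right (norm_mul_le _ _) _)
      _ ≤ _ := by
        rw [norm_smul, norm_inv, norm_one, mul_one]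
        gcongr
  linarith

/-- The points `w` where `sin w` is comparable to `exp |Im w|`. -/
def GoodPt (w : ℂ) : Prop := Real.exp |w.im| / 4 ≤ ‖Complex.sin w‖

/-- Write `c` for the integral of `‖Q‖`. The error `2c‖w‖⁻² exp|Im w|` must be at most half of `‖sin
w‖/‖w‖`; since `‖sin w‖ ≥ exp|Im w| / 4`, it suffices that `‖w‖ ≥ 16c`. The extra `1` keeps `w` away
from zero. -/
lemma IsSol.isUnit_of_goodPt (hQ : IntervalIntegrable Q volume 0 1) (h : IsSol Q (w ^ 2) Y Y')
    (hw : 1 + 16 * ∫ t in (0 : ℝ)..1, ‖Q t‖ ≤ ‖w‖) (h0 : Y 0 = 0) (h0' : Y' 0 = 1)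
    (hg : GoodPt w) :
    IsUnit (Y 1) ∧ ‖Ring.inverse (Y 1)‖ ≤ 8 * ‖w‖ * Real.exp (-|w.im|) := by
  have hc0 : 0 ≤ ∫ t in (0 : ℝ)..1, ‖Q t‖ :=
    intervalIntegral.integral_nonneg zero_le_one fun t _ => norm_nonneg _
  have hwp : 0 < ‖w‖ := by linarith
  have hw0 : w ≠ 0 := norm_pos_iff.1 hwp
  have hs : 0 < ‖Complex.sin w‖ := lt_of_lt_of_le (by positivity) hg
  have h1 := h.norm_sub_sin_le hQ hw0 (by linarith) h0 h0' (x := 1) (by simp)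
  simp only [Complex.ofReal_one, mul_one] at h1
  have h2 := isUnit_of_norm_sub_le (X := Y 1) (c := Complex.sin w / w)
    (div_ne_zero (norm_pos_iff.1 hs) hw0) (by
      refine h1.trans ?_
      rw [norm_div]
      unfold GoodPt at hg
      have h3 : 2 * (∫ t in (0 : ℝ)..1, ‖Q t‖) * ‖w‖⁻¹ ≤ 1 / 8 := by
        rw [← div_eq_mul_inv, div_le_iff₀ hwp]; linarith
      have h4 := mul_le_mul h3 hg (by positivity) (by positivity)
      calc 2 * (∫ t in (0 : ℝ)..1, ‖Q t‖) * ‖w‖⁻¹ ^ 2 * Real.exp |w.im|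
          = (2 * (∫ t in (0 : ℝ)..1, ‖Q t‖) * ‖w‖⁻¹ * (Real.exp |w.im| / 4)) * (4 * ‖w‖⁻¹) := by
            ring
        _ ≤ (1 / 8 * ‖Complex.sin w‖) * (4 * ‖w‖⁻¹) := by gcongr
        _ = _ := by ring)
  refine ⟨h2.1, h2.2.trans ?_⟩
  unfold GoodPt at hg
  rw [norm_div, inv_div, Real.exp_neg]
  have h5 : ‖Complex.sin w‖⁻¹ ≤ (Real.exp |w.im| / 4)⁻¹ := inv_anti₀ (by positivity) hg
  calc 2 * (‖w‖ / ‖Complex.sin w‖) = 2 * ‖w‖ * ‖Complex.sin w‖⁻¹ := by ring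
    _ ≤ 2 * ‖w‖ * (Real.exp |w.im| / 4)⁻¹ := by gcongr
    _ = _ := by field_simp; norm_num

end SolutionAlgebra
end MatrixSL

end

/-! ### Liouville arguments on squares of good points -/

noncomputable section

namespace MatrixSL

section Liouville

open Filter Topology

lemma goodPt_of_one_le_im {w : ℂ} (h : 1 ≤ |w.im|) : GoodPt w := by
  unfold GoodPt
  rw [Complex.sin, norm_div, norm_mul, Complex.norm_I, mul_one, Complex.norm_two]
  have e1 : ‖Complex.exp (-w * Complex.I)‖ = Real.exp w.im := by
    rw [Complex.norm_exp]; simp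
  have e2 : ‖Complex.exp (w * Complex.I)‖ = Real.exp (-w.im) := by
    rw [Complex.norm_exp]; simp
  have h1 := abs_norm_sub_norm_le (Complex.exp (-w * Complex.I)) (Complex.exp (w * Complex.I))
  rw [e1, e2] at h1
  have h2 : Real.exp |w.im| - Real.exp (-|w.im|) ≤ |Real.exp w.im - Real.exp (-w.im)| := by
    rcases abs_cases w.im with ⟨h3, _⟩ | ⟨h3, _⟩
    · rw [h3]; exact le_abs_self _
    · rw [h3, neg_neg, abs_sub_comm]; exact le_abs_self _
  have h3 : Real.exp (-|w.im|) ≤ Real.exp |w.im| / 2 := by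
    have a1 : Real.exp |w.im| = Real.exp (2 * |w.im|) * Real.exp (-|w.im|) := by
      rw [← Real.exp_add]; ring_nf
    have a2 : 2 ≤ Real.exp (2 * |w.im|) := by
      have := Real.add_one_le_exp (2 * |w.im|); linarith
    have a3 := Real.exp_pos (-|w.im|)
    rw [a1]; nlinarith
  linarith

/-- On these vertical lines the cosine of `Re w` vanishes, so `‖sin w‖ = cosh(Im w)`. Together with
`goodPt_of_one_le_im` they supply whole boundaries of arbitrarily large squares. -/
lemma goodPt_of_abs_re {w : ℂ} {n : ℕ} (h : |w.re| = Real.pi * (n + 1 / 2)) : GoodPt w := by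
  have hc : Real.cos w.re = 0 := by
    rw [← Real.cos_abs, h, Real.cos_eq_zero_iff]
    exact ⟨n, by push_cast; ring⟩
  have hs : |Real.sin w.re| = 1 := by
    have := Real.sin_sq_add_cos_sq w.re
    rw [hc] at this
    have h2 : |Real.sin w.re| ^ 2 = 1 := by rw [sq_abs]; linarith
    nlinarith [abs_nonneg (Real.sin w.re)]
  have e : Complex.sin w = Real.sin w.re * Real.cosh w.im := by
    conv_lhs => rw [← Complex.re_add_im w, Complex.sin_add, Complex.cos_mul_I]
    rw [← Complex.ofReal_cos, hc]
    push_cast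
    ring
  unfold GoodPt
  rw [e, norm_mul, Complex.norm_real, Complex.norm_real, Real.norm_eq_abs, Real.norm_eq_abs, hs,
    one_mul, abs_of_pos (Real.cosh_pos _), ← Real.cosh_abs, Real.cosh_eq]
  have := Real.exp_pos (-|w.im|)
  have := Real.exp_pos (|w.im|)
  linarith

/-- A differentiable function of `w²` that is bounded at the good points is bounded. -/
lemma eq_of_bounded_on_goodPt {E : Type*} [NormedAddCommGroup E] [NormedSpace ℂ E]
    {f : ℂ → E} (hf : Differentiable ℂ f) {C R : ℝ}
    (h : ∀ w : ℂ, R ≤ ‖w‖ → GoodPt w → ‖f (w ^ 2)‖ ≤ C) (z z' : ℂ) : f z = f z' := by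
  have hd : Differentiable ℂ (fun w => f (w ^ 2)) := hf.comp (differentiable_id.pow 2)
  have hb : ∀ w : ℂ, ‖f (w ^ 2)‖ ≤ C := by
    intro w
    -- The square of half-side `π(n + 1/2)` contains `w`, and its boundary consists of good points
    -- of modulus at least `R`; the maximum principle carries the bound inside.
    obtain ⟨n, hn⟩ := exists_nat_gt (max R (max |w.re| |w.im|))
    set r : ℝ := Real.pi * (n + 1 / 2)
    have hnr : (n : ℝ) + 1 ≤ r := by
      have := Real.pi_gt_three
      have : (0 : ℝ) ≤ n := Nat.cast_nonneg n
      simp only [r]; nlinarith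
    have hn0 : (0 : ℝ) ≤ n := Nat.cast_nonneg n
    have hr : -r ≠ r := by intro h; linarith
    set U : Set ℂ := Ioo (-r) r ×ℂ Ioo (-r) r
    have hcl : closure U = Icc (-r) r ×ℂ Icc (-r) r := by
      simp only [U, Complex.closure_reProdIm, closure_Ioo hr]
    have hU : Bornology.IsBounded U :=
      (Metric.isBounded_Ioo _ _).reProdIm (Metric.isBounded_Ioo _ _)
    have hopen : IsOpen U := isOpen_Ioo.reProdIm isOpen_Ioo
    refine Complex.norm_le_of_forall_mem_frontier_norm_le hU hd.diffContOnCl (C := C) ?_ ?_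
    · intro v hv
      rw [hopen.frontier_eq, hcl] at hv
      obtain ⟨hv1, hv2⟩ := hv
      rw [Complex.mem_reProdIm] at hv1
      have hcase : |v.re| = r ∨ |v.im| = r := by
        by_contra hne
        push Not at hne
        refine hv2 (Complex.mem_reProdIm.2 ⟨abs_lt.1 ?_, abs_lt.1 ?_⟩)
        · exact lt_of_le_of_ne (abs_le.2 hv1.1) hne.1
        · exact lt_of_le_of_ne (abs_le.2 hv1.2) hne.2
      have hRn : R ≤ n := (le_max_left _ _).trans hn.le
      rcases hcase with hc | hc
      · refine h v ?_ (goodPt_of_abs_re hc)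
        have := Complex.abs_re_le_norm v; linarith
      · refine h v ?_ (goodPt_of_one_le_im (by linarith))
        have := Complex.abs_im_le_norm v; linarith
    · rw [hcl, Complex.mem_reProdIm]
      have h1 : |w.re| ≤ r := by
        have := (le_max_left |w.re| |w.im|).trans (le_max_right R _); linarith
      have h2 : |w.im| ≤ r := by
        have := (le_max_right |w.re| |w.im|).trans (le_max_right R _); linarith
      exact ⟨abs_le.1 h1, abs_le.1 h2⟩
  obtain ⟨w, rfl⟩ := IsAlgClosed.exists_pow_nat_eq z zero_lt_two
  obtain ⟨w', rfl⟩ := IsAlgClosed.exists_pow_nat_eq z' zero_lt_two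
  exact hd.apply_eq_apply_of_bounded
    (isBounded_iff_forall_norm_le.2 ⟨C, by rintro _ ⟨w, rfl⟩; exact hb w⟩) w w'

/-- Removal of the singularities of a function that locally extends analytically. -/
lemma exists_entire_extension {E : Type*} [NormedAddCommGroup E] [NormedSpace ℂ E]
    [CompleteSpace E] {f : ℂ → E}
    (hf : ∀ z, ∃ g : ℂ → E, AnalyticAt ℂ g z ∧ f =ᶠ[𝓝[≠] z] g) :
    ∃ F : ℂ → E, Differentiable ℂ F ∧ ∀ z, ContinuousAt f z → F z = f z := by
  refine ⟨fun z => limUnder (𝓝[≠] z) f, ?_, ?_⟩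
  · intro z
    obtain ⟨g, hg, hfg⟩ := hf z
    have hlim : ∀ y, f =ᶠ[𝓝[≠] y] g → ContinuousAt g y → limUnder (𝓝[≠] y) f = g y := by
      intro y h1 h2
      exact Tendsto.limUnder_eq ((h2.mono_left nhdsWithin_le_nhds).congr' h1.symm)
    have key : (fun z => limUnder (𝓝[≠] z) f) =ᶠ[𝓝 z] g := by
      have h1 : ∀ᶠ y in 𝓝[≠] z, f =ᶠ[𝓝 y] g := by
        rw [Filter.EventuallyEq, eventually_nhdsWithin_iff] at hfg
        rw [eventually_nhdsWithin_iff]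
        filter_upwards [hfg.eventually_nhds] with y hy hyz
        filter_upwards [hy, isOpen_ne.mem_nhds hyz] with x hx hxz
        exact hx hxz
      have h2 := hg.eventually_analyticAt
      rw [eventually_nhdsWithin_iff] at h1
      filter_upwards [h1, h2] with y hy1 hy2
      by_cases hyz : y = z
      · subst hyz; exact hlim y hfg hy2.continuousAt
      · exact hlim y ((hy1 hyz).filter_mono nhdsWithin_le_nhds) hy2.continuousAt
    exact (hg.congr key.symm).differentiableAt
  · intro z hz
    exact Tendsto.limUnder_eq (hz.mono_left nhdsWithin_le_nhds)

/-- Liouville's theorem for functions with removable singularities. -/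
lemma exists_const_of_bounded_on_goodPt {E : Type*} [NormedAddCommGroup E] [NormedSpace ℂ E]
    [CompleteSpace E] {f : ℂ → E}
    (hf : ∀ z, ∃ g : ℂ → E, AnalyticAt ℂ g z ∧ f =ᶠ[𝓝[≠] z] g) {C R : ℝ}
    (h : ∀ w : ℂ, R ≤ ‖w‖ → GoodPt w → ContinuousAt f (w ^ 2) ∧ ‖f (w ^ 2)‖ ≤ C) :
    ∃ K, ∀ z, ContinuousAt f z → f z = K := by
  obtain ⟨F, hF, hFf⟩ := exists_entire_extension hf
  refine ⟨F 0, fun z hz => ?_⟩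
  rw [← hFf z hz]
  refine eq_of_bounded_on_goodPt hF (C := C) (R := R) (fun w h1 h2 => ?_) _ _
  rw [hFf _ (h w h1 h2).1]
  exact (h w h1 h2).2

lemma exists_goodPt (R : ℝ) : ∃ w : ℂ, R ≤ ‖w‖ ∧ GoodPt w := by
  refine ⟨((max R 1 : ℝ) : ℂ) * Complex.I, ?_, goodPt_of_one_le_im ?_⟩
  · rw [norm_mul, Complex.norm_I, mul_one, Complex.norm_real]
    exact (le_max_left _ _).trans (le_abs_self _)
  · simp only [Complex.mul_im, Complex.ofReal_re, Complex.I_im, mul_one, Complex.ofReal_im,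
      Complex.I_re, mul_zero, add_zero]
    exact (le_max_right _ _).trans (le_abs_self _)

/-- A constant that is bounded by `C / ‖w‖` at the good points vanishes. -/
lemma eq_zero_of_le_div {E : Type*} [NormedAddCommGroup E] {K : E} {C R : ℝ}
    (h : ∀ w : ℂ, R ≤ ‖w‖ → GoodPt w → ‖K‖ ≤ C * ‖w‖⁻¹) : K = 0 := by
  by_contra hK
  have hKp : 0 < ‖K‖ := norm_pos_iff.2 hK
  obtain ⟨w, hw, hg⟩ := exists_goodPt (max R (max 1 ((|C| + 1) / ‖K‖)))
  have h1 := h w ((le_max_left _ _).trans hw) hg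
  have h2 : (|C| + 1) / ‖K‖ ≤ ‖w‖ := ((le_max_right _ _).trans (le_max_right _ _)).trans hw
  have h3 : 1 ≤ ‖w‖ := ((le_max_left _ _).trans (le_max_right _ _)).trans hw
  rw [div_le_iff₀ hKp] at h2
  rw [← div_eq_mul_inv, le_div_iff₀ (by linarith)] at h1
  have := le_abs_self C
  nlinarith

end Liouville
end MatrixSL

end

/-! ### Gram matrices and the simple poles of the inverse of `φ(1,·)` -/

noncomputable section

namespace MatrixSL

section Matrices

variable {N : ℕ}

/-- A kernel vector repeated in every column is a matrix `X`. Kernels are tested on square matrices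
from here on, which keeps the computations inside one algebra. -/
lemma isUnit_of_forall_mul_eq_zero {M : Mat N} (h : ∀ X : Mat N, M * X = 0 → X = 0) :
    IsUnit M := by
  rw [Matrix.isUnit_iff_isUnit_det, isUnit_iff_ne_zero]
  intro hd
  obtain ⟨v, hv, hMv⟩ := Matrix.exists_mulVec_eq_zero_iff.2 hd
  obtain ⟨i, hi⟩ := Function.ne_iff.1 hv
  have := h (Matrix.of fun a _ => v a) (by
    ext a b
    simpa [Matrix.mul_apply, Matrix.mulVec, dotProduct] using congrFun hMv a)
  exact hi (by simpa using congrFun (congrFun this i) i)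

/-- `P` is the orthogonal projector onto the kernel of `M`. -/
structure IsKerProj (M P : Mat N) : Prop where
  herm : star P = P
  mul_self : P * P = P
  ker : M * P = 0
  eq : ∀ X : Mat N, M * X = 0 → P * X = X

open scoped ComplexOrder MatrixOrder

/-- The quadratic form of the Gram matrix of a continuous family. -/
lemma gram_quadratic {f : ℝ → Mat N} {a b : ℝ} (hf : ContinuousOn f (uIcc a b))
    (v : Fin N → ℂ) :
    star v ⬝ᵥ ((∫ t in a..b, star (f t) * f t) *ᵥ v)
      = ((∫ t in a..b, ∑ j, ‖(f t *ᵥ v) j‖ ^ 2 : ℝ) : ℂ) := by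
  let L : Mat N →ₗ[ℂ] ℂ :=
    { toFun := fun M => star v ⬝ᵥ (M *ᵥ v)
      map_add' := fun M M' => by rw [Matrix.add_mulVec, dotProduct_add]
      map_smul' := fun c M => by rw [Matrix.smul_mulVec, dotProduct_smul]; rfl }
  have hi : IntervalIntegrable (fun t => star (f t) * f t) volume a b :=
    (hf.star.mul hf).intervalIntegrable
  have h1 := (LinearMap.toContinuousLinearMap L).intervalIntegral_comp_comm hi
  rw [← intervalIntegral.integral_ofReal]
  refine h1.symm.trans (intervalIntegral.integral_congr fun t _ => ?_)
  change star v ⬝ᵥ ((star (f t) * f t) *ᵥ v) = _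
  rw [← Matrix.mulVec_mulVec, Matrix.star_eq_conjTranspose, Matrix.dotProduct_mulVec,
    Matrix.vecMul_conjTranspose, star_star]
  simp only [dotProduct, Pi.star_apply, RCLike.star_def]
  push_cast
  refine Finset.sum_congr rfl fun j _ => ?_
  rw [mul_comm, Complex.mul_conj']

lemma star_intervalIntegral (f : ℝ → Mat N) (a b : ℝ) :
    star (∫ t in a..b, f t) = ∫ t in a..b, star (f t) := by
  have e : ∀ s : Set ℝ, star (∫ t in s, f t) = ∫ t in s, star (f t) := fun s =>
    ((starL' ℝ (A := Mat N)).integral_comp_comm f).symm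
  rw [intervalIntegral, star_sub, e, e, intervalIntegral]

lemma star_gram (f : ℝ → Mat N) (a b : ℝ) :
    star (∫ t in a..b, star (f t) * f t) = ∫ t in a..b, star (f t) * f t := by
  rw [star_intervalIntegral]
  simp

lemma gram_posSemidef {f : ℝ → Mat N} {a b : ℝ} (hab : a ≤ b) (hf : ContinuousOn f (Icc a b)) :
    0 ≤ ∫ t in a..b, star (f t) * f t := by
  rw [Matrix.nonneg_iff_posSemidef]
  refine Matrix.PosSemidef.of_dotProduct_mulVec_nonneg (star_gram f a b) fun v => ?_
  rw [gram_quadratic (by rwa [uIcc_of_le hab])]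
  have : 0 ≤ ∫ t in a..b, ∑ j, ‖(f t *ᵥ v) j‖ ^ 2 :=
    intervalIntegral.integral_nonneg hab fun t _ => by positivity
  exact_mod_cast this

lemma mul_eq_zero_of_gram {f : ℝ → Mat N} {a b : ℝ} (hab : a < b)
    (hf : ContinuousOn f (Icc a b)) {X : Mat N}
    (h : star X * (∫ t in a..b, star (f t) * f t) * X = 0) {t : ℝ} (ht : t ∈ Icc a b) :
    f t * X = 0 := by
  have key : ∀ v : Fin N → ℂ, star v ⬝ᵥ ((∫ t in a..b, star (f t) * f t) *ᵥ v) = 0 →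
      f t *ᵥ v = 0 := by
    intro v hv
    rw [gram_quadratic (by rwa [uIcc_of_le hab.le])] at hv
    have hv' : ∫ t in a..b, ∑ j, ‖(f t *ᵥ v) j‖ ^ 2 = 0 := by exact_mod_cast hv
    have hc : ContinuousOn (fun t => ∑ j, ‖(f t *ᵥ v) j‖ ^ 2) (Icc a b) := by
      refine continuousOn_finsetSum _ fun j _ => ?_
      refine ContinuousOn.pow (ContinuousOn.norm ?_) 2
      have h1 : ContinuousOn (fun t => f t *ᵥ v) (Icc a b) :=
        (Continuous.matrix_mulVec continuous_id continuous_const).comp_continuousOn hf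
      exact (continuous_apply j).comp_continuousOn h1
    by_contra hne
    obtain ⟨j, hj⟩ := Function.ne_iff.1 hne
    have hpos := intervalIntegral.integral_pos hab hc (fun s _ => by positivity) ⟨t, ht, by
      refine Finset.sum_pos' (fun i _ => by positivity) ⟨j, Finset.mem_univ j, ?_⟩
      have : 0 < ‖(f t *ᵥ v) j‖ := norm_pos_iff.2 hj
      positivity⟩
    linarith
  ext i j
  have h1 := key (fun k => X k j) (by
    have h2 := congrFun (congrFun h j) j
    rw [mul_assoc, Matrix.mul_apply] at h2
    simpa [dotProduct, Matrix.mulVec, Matrix.mul_apply, Matrix.star_apply] using h2)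
  simpa [Matrix.mulVec, dotProduct, Matrix.mul_apply] using congrFun h1 i

end Matrices

section Fundamental

open Filter Topology

variable {N : ℕ}

/-- Integrable self-adjoint potentials, as functions. -/
structure SAPot (Q : ℝ → Mat N) : Prop where
  int : IntervalIntegrable Q volume 0 1
  herm : ∀ᵐ t, t ∈ Ioo (0 : ℝ) 1 → star (Q t) = Q t

variable {Q : ℝ → Mat N} (h : SAPot Q)

namespace SAPot

/-- The solution with `φ(0) = 0`, `φ'(0) = 1`. -/
def ph (l : ℂ) (x : ℝ) : Mat N := sol h.int 0 1 l x

/-- The derivative of `ph`. -/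
def ph' (l : ℂ) (x : ℝ) : Mat N := sol' h.int 0 1 l x

/-- The solution with `θ(0) = 1`, `θ'(0) = 0`. -/
def th (l : ℂ) (x : ℝ) : Mat N := sol h.int 1 0 l x

/-- The derivative of `th`. -/
def th' (l : ℂ) (x : ℝ) : Mat N := sol' h.int 1 0 l x

lemma ph_isSol (l : ℂ) : IsSol Q l (h.ph l) (h.ph' l) := sol_isSol h.int 0 1 l
lemma th_isSol (l : ℂ) : IsSol Q l (h.th l) (h.th' l) := sol_isSol h.int 1 0 l
@[simp] lemma ph_zero (l : ℂ) : h.ph l 0 = 0 := sol_zero h.int 0 1 l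
@[simp] lemma ph'_zero (l : ℂ) : h.ph' l 0 = 1 := sol'_zero h.int 0 1 l
@[simp] lemma th_zero (l : ℂ) : h.th l 0 = 1 := sol_zero h.int 1 0 l
@[simp] lemma th'_zero (l : ℂ) : h.th' l 0 = 0 := sol'_zero h.int 1 0 l
lemma ph_differentiable (x : ℝ) : Differentiable ℂ (fun l => h.ph l x) :=
  sol_differentiable h.int 0 1 x
lemma ph'_differentiable (x : ℝ) : Differentiable ℂ (fun l => h.ph' l x) :=
  sol'_differentiable h.int 0 1 x
lemma th_differentiable (x : ℝ) : Differentiable ℂ (fun l => h.th l x) :=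
  sol_differentiable h.int 1 0 x
lemma th'_differentiable (x : ℝ) : Differentiable ℂ (fun l => h.th' l x) :=
  sol'_differentiable h.int 1 0 x
lemma ph_continuous₂ : Continuous (fun p : ℂ × ℝ => h.ph p.1 p.2) := sol_continuous h.int 0 1
lemma ph_continuous (l : ℂ) : Continuous (h.ph l) :=
  Continuous.comp (g := fun p : ℂ × ℝ => h.ph p.1 p.2) (f := fun x : ℝ => (l, x))
    h.ph_continuous₂ (by fun_prop)

variable {x : ℝ} (hx : x ∈ Icc (0 : ℝ) 1)

include hx

lemma ph_wronskian (l : ℂ) :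
    star (h.ph' (star l) x) * h.ph l x = star (h.ph (star l) x) * h.ph' l x := by
  have := (h.ph_isSol (star l)).wronskian_const h.herm (h.ph_isSol l) hx
  simpa [sub_eq_zero] using this

lemma ph_th_wronskian (l : ℂ) :
    star (h.ph' (star l) x) * h.th l x - star (h.ph (star l) x) * h.th' l x = 1 := by
  have := (h.ph_isSol (star l)).wronskian_const h.herm (h.th_isSol l) hx
  simpa using this

lemma th_wronskian (l : ℂ) :
    star (h.th' (star l) x) * h.th l x = star (h.th (star l) x) * h.th' l x := by
  have := (h.th_isSol (star l)).wronskian_const h.herm (h.th_isSol l) hx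
  simpa [sub_eq_zero] using this

/-- The conjugated Wronskian identity exhibits a left inverse of the column `(φ, φ')`. -/
lemma eq_zero_of_ph_mul {l : ℂ} {X : Mat N} (h1 : h.ph l x * X = 0) (h2 : h.ph' l x * X = 0) :
    X = 0 := by
  have e := congrArg star (h.ph_th_wronskian hx (star l))
  simp only [star_sub, star_mul, star_star, star_one] at e
  calc X = (star (h.th (star l) x) * h.ph' l x - star (h.th' (star l) x) * h.ph l x) * X := by
        rw [e, one_mul]
    _ = 0 := by rw [sub_mul, mul_assoc, mul_assoc, h1, h2]; simp

omit hx

/-- At an interior point where the almost everywhere derivative exists, both `φ X` and `φ' X`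
vanish. -/
lemma eq_zero_of_ph_mul_on {l : ℂ} {a b : ℝ} (ha : 0 ≤ a) (hab : a < b) (hb : b ≤ 1) {X : Mat N}
    (hz : ∀ t ∈ Icc a b, h.ph l t * X = 0) : X = 0 := by
  have hae := ((h.ph_isSol l).mul_const X).d1.ae_hasDerivAt
  have hpos : volume (Ioo a b) ≠ 0 := by simp [hab]
  obtain ⟨t, ht, htd⟩ : ∃ t ∈ Ioo a b, HasDerivAt (fun t => h.ph l t * X) (h.ph' l t * X) t := by
    by_contra hne
    push Not at hne
    refine hpos (measure_mono_null (fun t ht => ?_) hae)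
    simp only [mem_compl_iff, mem_ofPred_eq, Classical.not_imp]
    exact ⟨⟨ha.trans_lt ht.1, ht.2.trans_le hb⟩, hne t ht⟩
  have h0 : HasDerivAt (fun t => h.ph l t * X) 0 t := by
    refine (hasDerivAt_const t (0 : Mat N)).congr_of_eventuallyEq ?_
    filter_upwards [Ioo_mem_nhds ht.1 ht.2] with s hs
    exact hz s (Ioo_subset_Icc_self hs)
  have ht1 : t ∈ Icc (0 : ℝ) 1 := ⟨ha.trans ht.1.le, ht.2.le.trans hb⟩
  exact h.eq_zero_of_ph_mul ht1 (hz t (Ioo_subset_Icc_self ht)) (htd.unique h0)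

lemma eq_zero_of_gram {l : ℂ} {a b : ℝ} (ha : 0 ≤ a) (hab : a < b) (hb : b ≤ 1) {X : Mat N}
    (hX : star X * (∫ t in a..b, star (h.ph l t) * h.ph l t) * X = 0) : X = 0 :=
  h.eq_zero_of_ph_mul_on ha hab hb fun _ ht =>
    mul_eq_zero_of_gram hab (h.ph_continuous l).continuousOn hX ht

/-- A kernel vector would give a nonreal Dirichlet eigenvalue of the self-adjoint problem on
`[0,x]`; the Lagrange identity excludes it. -/
lemma ph_isUnit_of_im_ne_zero {l : ℂ} (hl : l.im ≠ 0) {x : ℝ} (hx0 : 0 < x) (hx1 : x ≤ 1) :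
    IsUnit (h.ph l x) := by
  refine isUnit_of_forall_mul_eq_zero fun X hX => ?_
  have hx : x ∈ Icc (0 : ℝ) 1 := ⟨hx0.le, hx1⟩
  have e := (h.ph_isSol l).wronskian_eq h.herm (h.ph_isSol l) hx
  simp only [ph_zero, ph'_zero, star_zero, mul_zero, zero_mul, sub_zero, zero_add] at e
  refine h.eq_zero_of_gram (l := l) le_rfl hx0 hx1 ?_
  have hne : l - star l ≠ 0 := by
    intro h0
    apply hl
    have := congrArg Complex.im h0
    simp at this
    linarith
  have e2 : (l - star l) • (star X * (∫ t in (0 : ℝ)..x, star (h.ph l t) * h.ph l t) * X) = 0 := by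
    rw [← smul_mul_assoc, ← mul_smul_comm, ← e]
    have : star X * star (h.ph l x) = 0 := by rw [← star_mul, hX, star_zero]
    rw [mul_sub, sub_mul, ← mul_assoc, ← mul_assoc, this, mul_assoc _ (h.ph l x), hX]
    simp
  exact (smul_eq_zero.1 e2).resolve_left hne

/-- The Gram matrix `∫₀¹ φ* φ`. -/
def gram (l : ℂ) : Mat N := ∫ t in (0 : ℝ)..1, star (h.ph l t) * h.ph l t

variable {l : ℝ} {P : Mat N} (hP : IsKerProj (h.ph l 1) P)

include hP

lemma proj_mul_star_ph : P * star (h.ph l 1) = 0 := by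
  have := congrArg star hP.ker
  simpa [hP.herm] using this

lemma proj_mul_ph : P * star (h.ph' l 1) * h.ph l 1 = 0 := by
  have e := h.ph_wronskian (x := 1) (by simp) l
  simp only [RCLike.star_def, Complex.conj_ofReal] at e
  rw [mul_assoc, e, ← mul_assoc, h.proj_mul_star_ph hP, zero_mul]

/-- The Lagrange identity between the parameters `l` and `z` carries a factor `z - l`. Dividing by
it and letting `z → l` turns the derivative in the spectral parameter into the Gram matrix. -/
lemma proj_mul_deriv :
    P * star (h.ph' l 1) * deriv (fun z => h.ph z 1) l = P * h.gram l := by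
  let J : ℂ → Mat N := fun z => ∫ t in (0 : ℝ)..1, star (h.ph l t) * h.ph z t
  have hJ : Continuous J := by
    refine intervalIntegral.continuous_parametric_intervalIntegral_of_continuous' ?_ _ _
    exact (((h.ph_continuous l).comp continuous_snd).star).mul h.ph_continuous₂
  have e : ∀ z : ℂ, P * star (h.ph' l 1) * h.ph z 1 = (z - l) • (P * J z) := by
    intro z
    have e1 := (h.ph_isSol l).wronskian_eq h.herm (h.ph_isSol z) (x := 1) (by simp)
    simp only [ph_zero, ph'_zero, star_zero, mul_zero, zero_mul, sub_zero, zero_add,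
      RCLike.star_def, Complex.conj_ofReal] at e1
    rw [← mul_smul_comm, ← e1, mul_sub, ← mul_assoc P (star (h.ph l 1)), h.proj_mul_star_ph hP]
    simp [mul_assoc]
  have d1 : HasDerivAt (fun z => P * star (h.ph' l 1) * h.ph z 1)
      (P * star (h.ph' l 1) * deriv (fun z => h.ph z 1) l) l :=
    ((h.ph_differentiable 1 l).hasDerivAt).const_mul _
  have d2 : HasDerivAt (fun z => P * star (h.ph' l 1) * h.ph z 1) (P * J l) l := by
    rw [hasDerivAt_iff_tendsto_slope]
    have hc : Tendsto (fun z => P * J z) (𝓝[≠] (l : ℂ)) (𝓝 (P * J l)) :=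
      ((continuous_const.mul hJ).tendsto (l : ℂ)).mono_left nhdsWithin_le_nhds
    refine hc.congr' ?_
    filter_upwards [self_mem_nhdsWithin] with z hz
    have hz' : z - l ≠ 0 := sub_ne_zero.2 hz
    rw [slope_def_module, e, e]
    simp [smul_smul, inv_mul_cancel₀ hz']
  exact d1.unique d2

/-- The matrix that governs the pole of `φ(1,·)⁻¹`. -/
lemma isUnit_polar :
    IsUnit (h.ph l 1 * (1 - P) + deriv (fun z => h.ph z 1) l * P) := by
  refine isUnit_of_forall_mul_eq_zero fun X hX => ?_
  -- Multiplication by `P φ'(1)*` kills the first summand and turns the second into `P S P X`.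
  have e := congrArg (fun Z => P * star (h.ph' l 1) * Z) hX
  simp only [mul_zero] at e
  have e1 : P * h.gram l * P * X = 0 := by
    rw [← h.proj_mul_deriv hP, ← e, add_mul, mul_add]
    rw [← mul_assoc, ← mul_assoc _ (h.ph l 1), h.proj_mul_ph hP]
    simp [mul_assoc]
  have e2 : P * X = 0 := by
    refine h.eq_zero_of_gram (l := l) le_rfl zero_lt_one le_rfl ?_
    have : star (P * X) = star X * P := by rw [star_mul, hP.herm]
    rw [this]
    calc _ = star X * (P * h.gram l * P * X) := by simp only [gram, mul_assoc]
      _ = 0 := by rw [e1, mul_zero]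
  have e3 : h.ph l 1 * X = 0 := by
    rw [add_mul, mul_assoc, mul_assoc, e2, sub_mul, one_mul, e2] at hX
    simpa using hX
  rw [← hP.eq X e3, e2]

/-- `φ(1,·)` with its kernel at `l` divided out. -/
def regular (P : Mat N) (l z : ℂ) : Mat N :=
  h.ph z 1 * (1 - P) + dslope (fun z => h.ph z 1) l z * P

omit hP in
lemma dslope_analyticAt (z0 z : ℂ) : AnalyticAt ℂ (dslope (fun z => h.ph z 1) z0) z := by
  have : DifferentiableOn ℂ (dslope (fun z => h.ph z 1) z0) univ :=
    (Complex.differentiableOn_dslope Filter.univ_mem).2 (h.ph_differentiable 1).differentiableOn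
  exact this.analyticAt Filter.univ_mem

omit hP in
lemma ph_analyticAt (x : ℝ) (z : ℂ) : AnalyticAt ℂ (fun z => h.ph z x) z :=
  (h.ph_differentiable x).analyticAt z

omit hP in
lemma regular_analyticAt (P : Mat N) (z0 z : ℂ) : AnalyticAt ℂ (h.regular P z0) z :=
  ((h.ph_analyticAt 1 z).mul analyticAt_const).add
    ((h.dslope_analyticAt z0 z).mul analyticAt_const)

omit hP in
lemma analyticAt_inverse {f : ℂ → Mat N} {z : ℂ} (hf : AnalyticAt ℂ f z) (hu : IsUnit (f z)) :
    AnalyticAt ℂ (fun z => Ring.inverse (f z)) z := by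
  obtain ⟨u, hu⟩ := hu
  have := _root_.analyticAt_inverse (𝕜 := ℂ) u
  rw [hu] at this
  exact this.comp hf

lemma regular_isUnit : IsUnit (h.regular P l l) := by
  rw [regular, dslope_same]
  exact h.isUnit_polar hP

/-- Away from `l` there is a factorization `φ(1,z) = regular(z) ((z-l)P + 1 - P)`, and `regular` is
invertible near `l`. Thus the pole is simple and the singular points are isolated. -/
lemma inverse_eventuallyEq :
    ∀ᶠ z in 𝓝[≠] (l : ℂ), IsUnit (h.ph z 1) ∧
      Ring.inverse (h.ph z 1) = ((z - l)⁻¹ • P + (1 - P)) * Ring.inverse (h.regular P l z) := by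
  have hu : ∀ᶠ z in 𝓝 (l : ℂ), IsUnit (h.regular P l z) :=
    (h.regular_analyticAt P l l).continuousAt.eventually
      (Units.isOpen.mem_nhds (h.regular_isUnit hP))
  filter_upwards [hu.filter_mono nhdsWithin_le_nhds, self_mem_nhdsWithin] with z hz hzl
  have hz' : z - l ≠ 0 := sub_ne_zero.2 hzl
  have e1 : h.ph z 1 * ((z - l)⁻¹ • P + (1 - P)) = h.regular P l z := by
    have e0 : dslope (fun z => h.ph z 1) l z * P = (z - l)⁻¹ • (h.ph z 1 * P) := by
      rw [dslope_of_ne _ hzl, slope_def_module, smul_mul_assoc, sub_mul, hP.ker, sub_zero]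
    rw [regular, e0, mul_add, mul_smul_comm, add_comm]
  have e2 : ((z - l)⁻¹ • P + (1 - P)) * ((z - l) • P + (1 - P)) = 1 := by
    rw [add_mul, mul_add, mul_add, smul_mul_smul_comm, inv_mul_cancel₀ hz', hP.mul_self,
      smul_mul_assoc, mul_smul_comm, mul_sub, sub_mul, mul_sub, sub_mul, hP.mul_self]
    simp [sub_mul, hP.mul_self]
  have e3 : ((z - l) • P + (1 - P)) * ((z - l)⁻¹ • P + (1 - P)) = 1 := by
    rw [add_mul, mul_add, mul_add, smul_mul_smul_comm, mul_inv_cancel₀ hz', hP.mul_self,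
      smul_mul_assoc, mul_smul_comm, mul_sub, sub_mul, mul_sub, sub_mul, hP.mul_self]
    simp [sub_mul, hP.mul_self]
  have e4 : h.ph z 1 = h.regular P l z * ((z - l) • P + (1 - P)) := by
    rw [← e1, mul_assoc, e2, mul_one]
  let u : (Mat N)ˣ := ⟨_, _, e3, e2⟩
  have hu' : IsUnit (h.ph z 1) := by
    rw [e4]; exact hz.mul u.isUnit
  refine ⟨hu', ?_⟩
  calc Ring.inverse (h.ph z 1)
      = Ring.inverse (h.ph z 1) * (h.regular P l z * Ring.inverse (h.regular P l z)) := by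
        rw [Ring.mul_inverse_cancel _ hz, mul_one]
    _ = Ring.inverse (h.ph z 1) * h.ph z 1 * (((z - l)⁻¹ • P + (1 - P))
          * Ring.inverse (h.regular P l z)) := by
        rw [← e1]; simp only [mul_assoc]
    _ = _ := by rw [Ring.inverse_mul_cancel _ hu', one_mul]

end SAPot
end Fundamental
end MatrixSL

end

/-! ### Translation of the spectral data into matrices -/

noncomputable section

namespace MatrixSL

section Operators

variable {N : ℕ}

lemma op_mul (A B : Mat N) (v : Vec N) : op (A * B) v = op A (op B v) := by
  have := map_mul (Matrix.toEuclideanCLM (n := Fin N) (𝕜 := ℂ)) A B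
  exact DFunLike.congr_fun this v

lemma mat_ext {A B : Mat N} (h : ∀ v : Vec N, op A v = op B v) : A = B :=
  (Matrix.toEuclideanLin (𝕜 := ℂ) (m := Fin N) (n := Fin N)).injective (LinearMap.ext h)

lemma inner_op_left (A : Mat N) (u v : Vec N) : inner ℂ (op A u) v = inner ℂ u (op (star A) v) := by
  have h := map_star (Matrix.toEuclideanCLM (n := Fin N) (𝕜 := ℂ)) A
  have h2 := ContinuousLinearMap.adjoint_inner_right
    (Matrix.toEuclideanCLM (n := Fin N) (𝕜 := ℂ) A) u v
  rw [← ContinuousLinearMap.star_eq_adjoint, ← h] at h2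
  exact h2.symm

/-- The matrix of a linear operator on `ℂ^N`. -/
def ofLin (T : Vec N →ₗ[ℂ] Vec N) : Mat N :=
  (Matrix.toEuclideanLin (𝕜 := ℂ) (m := Fin N) (n := Fin N)).symm T

@[simp] lemma op_ofLin (T : Vec N →ₗ[ℂ] Vec N) (v : Vec N) : op (ofLin T) v = T v := by
  rw [op, ofLin, LinearEquiv.apply_symm_apply]

/-- The matrix of the orthogonal projector onto a subspace. -/
def projM (K : Submodule ℂ (Vec N)) : Mat N := ofLin (K.starProjection : Vec N →ₗ[ℂ] Vec N)

@[simp] lemma op_projM (K : Submodule ℂ (Vec N)) (v : Vec N) :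
    op (projM K) v = K.starProjection v := op_ofLin _ v

lemma op_projM_of_mem {K : Submodule ℂ (Vec N)} {v : Vec N} (hv : v ∈ K) :
    op (projM K) v = v := by
  rw [op_projM]; exact Submodule.starProjection_eq_self_iff.2 hv

lemma op_projM_mem (K : Submodule ℂ (Vec N)) (v : Vec N) : op (projM K) v ∈ K := by
  rw [op_projM]; exact Submodule.starProjection_apply_mem K v

lemma projM_mul_self (K : Submodule ℂ (Vec N)) : projM K * projM K = projM K :=
  mat_ext fun v => by rw [op_mul, op_projM_of_mem (op_projM_mem K v)]

lemma star_eq_iff_inner (A : Mat N) :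
    star A = A ↔ ∀ u v : Vec N, inner ℂ (op A u) v = inner ℂ u (op A v) := by
  constructor
  · intro h u v
    rw [inner_op_left, h]
  · intro h
    refine mat_ext fun v => ext_inner_left ℂ fun u => ?_
    rw [← inner_op_left, h]

lemma star_projM (K : Submodule ℂ (Vec N)) : star (projM K) = projM K := by
  rw [star_eq_iff_inner]
  intro u v
  rw [op_projM, op_projM]
  exact Submodule.inner_starProjection_left_eq_right K u v

lemma isKerProj_projM (M : Mat N) : IsKerProj M (projM (LinearMap.ker (op M))) where
  herm := star_projM _
  mul_self := projM_mul_self _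
  ker := mat_ext fun v => by
    rw [op_mul]
    rw [LinearMap.mem_ker.1 (op_projM_mem (LinearMap.ker (op M)) v)]
    simp
  eq X hX := mat_ext fun v => by
    rw [op_mul, op_projM_of_mem]
    rw [LinearMap.mem_ker, ← op_mul, hX]
    simp

lemma ker_op_eq_bot_iff (M : Mat N) : LinearMap.ker (op M) = ⊥ ↔ IsUnit M := by
  constructor
  · intro h
    refine isUnit_of_forall_mul_eq_zero fun X hX => mat_ext fun v => ?_
    have : op X v ∈ LinearMap.ker (op M) := by
      rw [LinearMap.mem_ker, ← op_mul, hX]; simp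
    rw [h] at this
    simpa using this
  · rintro ⟨u, rfl⟩
    refine (Submodule.eq_bot_iff _).2 fun v hv => ?_
    rw [LinearMap.mem_ker] at hv
    have : op ((↑u⁻¹ : Mat N) * (u : Mat N)) v = 0 := by rw [op_mul, hv, map_zero]
    simpa using this

lemma projM_injective : Function.Injective (projM : Submodule ℂ (Vec N) → Mat N) := by
  intro K L h
  ext v
  constructor
  · intro hv
    have := op_projM_of_mem hv
    rw [h] at this
    rw [← this]; exact op_projM_mem L v
  · intro hv
    have := op_projM_of_mem hv
    rw [← h] at this
    rw [← this]; exact op_projM_mem K v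

/-- The matrix of an operator in a subspace, extended by zero to the orthogonal complement. -/
def dataM (p : SubspaceWithOp N) : Mat N :=
  ofLin (p.1.subtype ∘ₗ p.2 ∘ₗ (p.1.orthogonalProjectionOnto : Vec N →ₗ[ℂ] p.1))

lemma op_dataM (p : SubspaceWithOp N) (u : p.1) : op (dataM p) u = p.2 u := by
  simp [dataM]

lemma op_dataM' (p : SubspaceWithOp N) (v : Vec N) :
    op (dataM p) v = p.2 (p.1.orthogonalProjectionOnto v) := by
  simp [dataM]

/-- The operators live on different types until the subspaces are identified; comparing their
extensions by zero to `ℂ^N` avoids that dependence. -/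
lemma data_ext {p q : SubspaceWithOp N} (h1 : projM p.1 = projM q.1) (h2 : dataM p = dataM q) :
    p = q := by
  obtain ⟨K, f⟩ := p
  obtain ⟨L, f'⟩ := q
  obtain rfl : K = L := projM_injective h1
  congr 1
  refine LinearMap.ext fun u => Subtype.ext ?_
  have e1 := op_dataM (⟨K, f⟩ : SubspaceWithOp N) u
  have e2 := op_dataM (⟨K, f'⟩ : SubspaceWithOp N) u
  rw [h2] at e1
  exact e1.symm.trans e2

end Operators

section Dictionary

variable {N : ℕ} {V : Potential N}

lemma potential_intervalIntegrable (V : Potential N) :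
    IntervalIntegrable (fun t => V t) volume 0 1 := by
  rw [intervalIntegrable_iff_integrableOn_Ioo_of_le zero_le_one]
  exact L1.integrable_coeFn V

lemma saPot (hV : IsSelfAdjointPotential V) : SAPot (fun t => V t) where
  int := potential_intervalIntegrable V
  herm := by
    have := (ae_restrict_iff' measurableSet_Ioo).1 hV
    filter_upwards [this] with t ht h1
    exact ht h1

lemma IsMatSolution.isSol {l : ℂ} {Y Y' : ℝ → Mat N} (h : IsMatSolution V l Y Y') :
    IsSol (fun t => V t) l Y Y' where
  d1 := ⟨(h.cont'.mono (by rw [uIcc_of_le zero_le_one])).intervalIntegrable, h.eq⟩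
  d2 := ⟨(HasACDeriv.intervalIntegrable_mul_cont (potential_intervalIntegrable V) h.cont).sub
    ((h.cont.const_smul l).mono (by rw [uIcc_of_le zero_le_one])).intervalIntegrable, h.eq'⟩

lemma IsSol.isMatSolution {l : ℂ} {Y Y' : ℝ → Mat N} (h : IsSol (fun t => V t) l Y Y') :
    IsMatSolution V l Y Y' where
  cont := h.d1.continuousOn
  cont' := h.d2.continuousOn
  eq := h.d1.eq
  eq' := h.d2.eq

/-- Uniqueness for the initial value problem makes the choice in `phi` harmless on `[0,1]`. -/
lemma phi_eq (hV : IsSelfAdjointPotential V) (l : ℂ) {x : ℝ} (hx : x ∈ Icc (0 : ℝ) 1) :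
    phi V l x = (saPot hV).ph l x := by
  have hex : ∃ Y, IsFundamental V l Y := ⟨_, _, ((saPot hV).ph_isSol l).isMatSolution,
    (saPot hV).ph_zero l, (saPot hV).ph'_zero l⟩
  rw [phi, dif_pos hex]
  obtain ⟨Y', h1, h2, h3⟩ := hex.choose_spec
  exact (h1.isSol.unique (potential_intervalIntegrable V) ((saPot hV).ph_isSol l)
    (by simp [h2]) (by simp [h3]) hx).1

lemma S_eq (hV : IsSelfAdjointPotential V) (α : ℕ) :
    S V α = (saPot hV).gram (eigenvalue V α) := by
  refine intervalIntegral.integral_congr fun t ht => ?_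
  rw [uIcc_of_le zero_le_one] at ht
  simp only [phi_eq hV _ ht]
  rfl

lemma E_eq (hV : IsSelfAdjointPotential V) (α : ℕ) :
    E V α = LinearMap.ker (op ((saPot hV).ph (eigenvalue V α) 1)) := by
  rw [E, phi_eq hV _ (by simp)]

/-- The matrix with all columns equal to a given vector. -/
def colM : Vec N →L[ℂ] Mat N := LinearMap.toContinuousLinearMap
  { toFun := fun v => Matrix.of fun i _ => v i
    map_add' := fun _ _ => rfl
    map_smul' := fun _ _ => rfl }

lemma colM_apply (v : Vec N) (i j : Fin N) : colM v i j = v i := rfl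

lemma colM_injective : Function.Injective (colM : Vec N → Mat N) := by
  intro u v h
  ext i
  exact congrFun (congrFun h i) i

lemma colM_op (A : Mat N) (v : Vec N) : colM (op A v) = A * colM v := by
  ext i j
  simp [colM_apply, Matrix.mul_apply, Matrix.toLpLin_apply, Matrix.mulVec, dotProduct]

lemma IsVecSolution.isSol {l : ℂ} {ψ ψ' : ℝ → Vec N} (h : IsVecSolution V l ψ ψ') :
    IsSol (fun t => V t) l (fun x => colM (ψ x)) (fun x => colM (ψ' x)) where
  d1 := HasACDeriv.clm (f := ψ) (f' := ψ')
    ⟨(h.cont'.mono (by rw [uIcc_of_le zero_le_one])).intervalIntegrable, h.eq⟩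
    (colM.restrictScalars ℝ)
  d2 := (HasACDeriv.clm (f := ψ') (f' := fun t => op (V t) (ψ t) - l • ψ t)
    ⟨intervalIntegrable_rhs V l h.cont (by simp), h.eq'⟩ (colM.restrictScalars ℝ)).congr
      (fun _ _ => rfl) (Filter.Eventually.of_forall fun t _ => by
        simp [map_sub, colM_op])

lemma IsVecSolution.eq_op_ph (hV : IsSelfAdjointPotential V) {l : ℂ} {ψ ψ' : ℝ → Vec N}
    (h : IsVecSolution V l ψ ψ') (h0 : ψ 0 = 0) {x : ℝ} (hx : x ∈ Icc (0 : ℝ) 1) :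
    ψ x = op ((saPot hV).ph l x) (ψ' 0) := by
  apply colM_injective
  rw [colM_op]
  exact (h.isSol.unique (potential_intervalIntegrable V)
    (((saPot hV).ph_isSol l).mul_const (colM (ψ' 0))) (by simp [h0]) (by simp) hx).1

lemma isVecSolution_op_ph (hV : IsSelfAdjointPotential V) (l : ℂ) (v : Vec N) :
    IsVecSolution V l (fun x => op ((saPot hV).ph l x) v) (fun x => op ((saPot hV).ph' l x) v) := by
  let L : Mat N →L[ℝ] Vec N := (LinearMap.toContinuousLinearMap
    ((LinearMap.applyₗ v) ∘ₗ (Matrix.toEuclideanLin (𝕜 := ℂ) (m := Fin N)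
      (n := Fin N)).toLinearMap)).restrictScalars ℝ
  have h := (saPot hV).ph_isSol l
  have h1 := h.d1.clm L
  have h2 := h.d2.clm L
  refine ⟨h1.continuousOn, h2.continuousOn, h1.eq, fun x hx => ?_⟩
  refine (h2.eq x hx).trans ?_
  congr 1
  refine intervalIntegral.integral_congr fun t _ => ?_
  change op ((V t) * (saPot hV).ph l t - l • (saPot hV).ph l t) v = _
  simp only [← op_mul, map_sub, LinearMap.sub_apply, map_smul, LinearMap.smul_apply]

/-- The map from initial slopes to solutions. -/
def solMap (hV : IsSelfAdjointPotential V) (l : ℝ) : Vec N →ₗ[ℂ] (Icc (0 : ℝ) 1 → Vec N) :=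
  LinearMap.pi fun x => op ((saPot hV).ph l x)

lemma solMap_injective (hV : IsSelfAdjointPotential V) (l : ℝ) :
    Function.Injective (solMap hV l) := by
  rw [← LinearMap.ker_eq_bot, Submodule.eq_bot_iff]
  intro v hv
  apply colM_injective
  rw [map_zero]
  refine (saPot hV).eq_zero_of_ph_mul_on (l := l) le_rfl zero_lt_one le_rfl fun t ht => ?_
  have : op ((saPot hV).ph l t) v = 0 := congrFun hv ⟨t, ht⟩
  rw [← colM_op, this, map_zero]

/-- A solution vanishing at `0` is `φ v` with `v` its initial slope, and the condition at `1` reads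
`φ(1) v = 0`. -/
lemma eigenspace_eq (hV : IsSelfAdjointPotential V) (l : ℝ) :
    eigenspace V l = (LinearMap.ker (op ((saPot hV).ph l 1))).map (solMap hV l) := by
  ext f
  constructor
  · rintro ⟨ψ, ψ', h, h0, h1, hf⟩
    refine ⟨ψ' 0, ?_, ?_⟩
    · rw [SetLike.mem_coe, LinearMap.mem_ker, ← h.eq_op_ph hV h0 (by simp), h1]
    · funext x
      rw [hf x, h.eq_op_ph hV h0 x.2]
      rfl
  · rintro ⟨v, hv, rfl⟩
    exact ⟨_, _, isVecSolution_op_ph hV l v, by simp, hv, fun x => rfl⟩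

lemma mem_eigenvalues_iff (hV : IsSelfAdjointPotential V) (l : ℝ) :
    l ∈ eigenvalues V ↔ ¬ IsUnit ((saPot hV).ph l 1) := by
  rw [eigenvalues, mem_ofPred_eq, eigenspace_eq hV, ← ker_op_eq_bot_iff, ne_eq,
    ← Submodule.map_bot (solMap hV l),
    (Submodule.map_injective_of_injective (solMap_injective hV l)).eq_iff]

lemma finrank_eigenspace (hV : IsSelfAdjointPotential V) (l : ℝ) :
    Module.finrank ℂ (eigenspace V l)
      = Module.finrank ℂ (LinearMap.ker (op ((saPot hV).ph l 1))) := by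
  rw [eigenspace_eq hV]
  exact (Submodule.equivMapOfInjective _ (solMap_injective hV l) _).finrank_eq.symm

lemma multiplicity_eq (hV : IsSelfAdjointPotential V) (α : ℕ) :
    multiplicity V α = Module.finrank ℂ (E V α) := by
  rw [multiplicity, finrank_eigenspace hV, E_eq hV]

lemma dataM_spectralData (hV : IsSelfAdjointPotential V) (α : ℕ) :
    dataM (spectralData V α) = projM (E V α) * (saPot hV).gram (eigenvalue V α)
      * projM (E V α) := by
  refine mat_ext fun v => ?_
  rw [op_mul, op_mul, op_dataM', ← S_eq hV, op_projM, op_projM]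
  rfl

lemma isKerProj_E (hV : IsSelfAdjointPotential V) (α : ℕ) :
    IsKerProj ((saPot hV).ph (eigenvalue V α) 1) (projM (E V α)) := by
  rw [E_eq hV]; exact isKerProj_projM _

end Dictionary
end MatrixSL

end

/-! ### Discreteness, infinitude and enumeration of the spectrum -/

noncomputable section

namespace MatrixSL

open Filter Topology

section PolynomialGrowth

/-- An entire function of polynomial growth at the good points is a polynomial. -/
lemma exists_polynomial_of_growth {f : ℂ → ℂ} (hf : Differentiable ℂ f) (k : ℕ) {C R : ℝ}
    (h : ∀ w : ℂ, R ≤ ‖w‖ → GoodPt w → ‖f (w ^ 2)‖ ≤ C * ‖w‖ ^ (2 * k)) :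
    ∃ p : Polynomial ℂ, ∀ z, f z = p.eval z := by
  induction k generalizing f C R with
  | zero =>
    refine ⟨Polynomial.C (f 0), fun z => ?_⟩
    rw [Polynomial.eval_C]
    exact eq_of_bounded_on_goodPt hf (by simpa using h) z 0
  | succ k ih =>
    -- The quotient `(f(z) - f(0))/z` lowers the growth exponent in `w` by two, because `z = w²`.
    have hd : Differentiable ℂ (dslope f 0) := differentiableOn_univ.1
      ((Complex.differentiableOn_dslope univ_mem).2 hf.differentiableOn)
    obtain ⟨p, hp⟩ := ih hd (C := |C| + ‖f 0‖) (R := max R 1) (by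
      intro w hw hg
      have hw1 : 1 ≤ ‖w‖ := (le_max_right _ _).trans hw
      have hw0 : w ≠ 0 := norm_pos_iff.1 (by linarith)
      have h1 := h w ((le_max_left _ _).trans hw) hg
      rw [dslope_of_ne _ (pow_ne_zero 2 hw0), slope_def_field, sub_zero, norm_div, norm_pow,
        div_le_iff₀ (by positivity)]
      have h2 : (1 : ℝ) ≤ ‖w‖ ^ (2 * (k + 1)) := one_le_pow₀ hw1
      have h3 := le_abs_self C
      have e : ‖w‖ ^ (2 * (k + 1)) = ‖w‖ ^ (2 * k) * ‖w‖ ^ 2 := by ring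
      calc ‖f (w ^ 2) - f 0‖ ≤ ‖f (w ^ 2)‖ + ‖f 0‖ := norm_sub_le _ _
        _ ≤ |C| * ‖w‖ ^ (2 * (k + 1)) + ‖f 0‖ * ‖w‖ ^ (2 * (k + 1)) := by
          refine add_le_add (h1.trans (by gcongr)) ?_
          exact le_mul_of_one_le_right (norm_nonneg _) h2
        _ = _ := by rw [e]; ring)
    refine ⟨Polynomial.C (f 0) + Polynomial.X * p, fun z => ?_⟩
    rw [Polynomial.eval_add, Polynomial.eval_C, Polynomial.eval_mul, Polynomial.eval_X, ← hp]
    have := sub_smul_dslope f 0 z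
    rw [sub_zero, smul_eq_mul] at this
    rw [this]; ring

/-- The growth makes `f` a polynomial, and the exponential factor makes it tend to zero along `w =
iy`; only the zero polynomial does so. -/
lemma eq_zero_of_growth_of_decay {f : ℂ → ℂ} (hf : Differentiable ℂ f) (k : ℕ) {C R : ℝ}
    (h : ∀ w : ℂ, R ≤ ‖w‖ → GoodPt w →
      ‖f (w ^ 2)‖ ≤ C * ‖w‖ ^ (2 * k) * Real.exp (-|w.im|)) (z : ℂ) : f z = 0 := by
  obtain ⟨p, hp⟩ := exists_polynomial_of_growth hf k (C := |C|) (R := R) fun w h1 h2 => by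
    refine (h w h1 h2).trans ?_
    have : Real.exp (-|w.im|) ≤ 1 := Real.exp_le_one_iff.2 (by simp)
    calc C * ‖w‖ ^ (2 * k) * Real.exp (-|w.im|)
        ≤ |C| * ‖w‖ ^ (2 * k) * Real.exp (-|w.im|) := by gcongr; exact le_abs_self C
      _ ≤ |C| * ‖w‖ ^ (2 * k) * 1 := by gcongr
      _ = _ := mul_one _
  let w : ℝ → ℂ := fun y => y * Complex.I
  have hlim : Tendsto (fun y : ℝ => p.eval (w y ^ 2)) atTop (𝓝 0) := by
    have h1 : Tendsto (fun y : ℝ => C * (y ^ (2 * k) * Real.exp (-y))) atTop (𝓝 0) := by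
      simpa using (Real.tendsto_pow_mul_exp_neg_atTop_nhds_zero (2 * k)).const_mul C
    refine squeeze_zero_norm' ?_ h1
    filter_upwards [eventually_ge_atTop (max R 1)] with y hy
    have hy1 : 1 ≤ y := (le_max_right _ _).trans hy
    have e1 : ‖w y‖ = y := by simp [w, abs_of_nonneg (zero_le_one.trans hy1)]
    have e2 : |(w y).im| = y := by simp [w, abs_of_nonneg (zero_le_one.trans hy1)]
    have := h (w y) (by rw [e1]; exact (le_max_left _ _).trans hy)
      (goodPt_of_one_le_im (by rw [e2]; exact hy1))
    rw [e1, e2, hp] at this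
    linarith
  have hinf : Tendsto (fun y : ℝ => ‖w y ^ 2‖) atTop atTop := by
    have e : (fun y : ℝ => ‖w y ^ 2‖) = fun y => y ^ 2 := by
      funext y; simp [w]
    rw [e]; exact tendsto_pow_atTop two_ne_zero
  have hdeg : p.degree ≤ 0 := by
    by_contra hd
    push Not at hd
    have := p.tendsto_norm_atTop hd hinf
    exact not_tendsto_nhds_of_tendsto_atTop this 0 (by simpa using hlim.norm)
  rw [hp, Polynomial.eq_C_of_degree_le_zero hdeg, Polynomial.eval_C]
  rw [Polynomial.eq_C_of_degree_le_zero hdeg] at hlim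
  simp only [Polynomial.eval_C] at hlim
  exact tendsto_nhds_unique tendsto_const_nhds hlim

end PolynomialGrowth

namespace SAPot

variable {N : ℕ} [NeZero N] {Q : ℝ → Mat N} (h : SAPot Q)

/-- The real points where `φ(1,·)` is singular. -/
def spec : Set ℝ := {l | ¬ IsUnit (h.ph l 1)}

omit [NeZero N] in
lemma eq_ofReal_of_not_isUnit {z : ℂ} (hz : ¬ IsUnit (h.ph z 1)) : ∃ l ∈ h.spec, (l : ℂ) = z := by
  have him : z.im = 0 := by
    by_contra him
    exact hz (h.ph_isUnit_of_im_ne_zero him zero_lt_one le_rfl)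
  have e : (z.re : ℂ) = z := Complex.ext (by simp) (by simp [him])
  exact ⟨z.re, by rw [spec, mem_ofPred_eq, e]; exact hz, e⟩

/-- The threshold beyond which the asymptotics hold. -/
def bnd (_ : SAPot Q) : ℝ := 1 + 16 * ∫ t in (0 : ℝ)..1, ‖Q t‖

lemma one_le_bnd : 1 ≤ h.bnd := by
  have := intervalIntegral.integral_nonneg (μ := volume) zero_le_one
    (fun t (_ : t ∈ Icc (0 : ℝ) 1) => norm_nonneg (Q t))
  unfold bnd; linarith

lemma two_mul_le_bnd : 2 * (∫ t in (0 : ℝ)..1, ‖Q t‖) ≤ h.bnd := by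
  have := intervalIntegral.integral_nonneg (μ := volume) zero_le_one
    (fun t (_ : t ∈ Icc (0 : ℝ) 1) => norm_nonneg (Q t))
  unfold bnd; linarith

lemma isUnit_of_goodPt {w : ℂ} (hw : h.bnd ≤ ‖w‖) (hg : GoodPt w) :
    IsUnit (h.ph (w ^ 2) 1) ∧
      ‖Ring.inverse (h.ph (w ^ 2) 1)‖ ≤ 8 * ‖w‖ * Real.exp (-|w.im|) :=
  (h.ph_isSol (w ^ 2)).isUnit_of_goodPt h.int hw (h.ph_zero _) (h.ph'_zero _) hg

lemma spec_bddBelow {l : ℝ} (hl : l ∈ h.spec) : -h.bnd ^ 2 ≤ l := by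
  by_contra hlt
  push Not at hlt
  have h1 := h.one_le_bnd
  set y := Real.sqrt (-l)
  have hy : h.bnd ≤ y := Real.le_sqrt_of_sq_le (by linarith)
  have e : ((y : ℂ) * Complex.I) ^ 2 = l := by
    rw [mul_pow, Complex.I_sq, ← Complex.ofReal_pow, Real.sq_sqrt (by nlinarith)]
    push_cast; ring
  have := (h.isUnit_of_goodPt (w := y * Complex.I) (by
    rw [norm_mul, Complex.norm_I, mul_one, Complex.norm_real]
    exact hy.trans (le_abs_self _)) (goodPt_of_one_le_im (by
      simp only [Complex.mul_im, Complex.ofReal_re, Complex.I_im, mul_one, Complex.ofReal_im,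
        Complex.I_re, mul_zero, add_zero]
      exact (h1.trans hy).trans (le_abs_self _)))).1
  rw [e] at this
  exact hl this

omit [NeZero N] in
lemma eventually_isUnit (l : ℝ) : ∀ᶠ z in 𝓝[≠] (l : ℂ), IsUnit (h.ph z 1) := by
  filter_upwards [h.inverse_eventuallyEq (isKerProj_projM (h.ph l 1))] with z hz using hz.1

/-- The points lie in a compact interval, and an accumulation point would contradict the isolation
of singular points. -/
lemma spec_inter_Iic_finite (b : ℝ) : (h.spec ∩ Iic b).Finite := by
  by_contra hinf
  have hsub : h.spec ∩ Iic b ⊆ Icc (-h.bnd ^ 2) b := fun l hl => ⟨h.spec_bddBelow hl.1, hl.2⟩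
  obtain ⟨l, _, hacc⟩ := Set.Infinite.exists_accPt_of_subset_isCompact hinf isCompact_Icc hsub
  have h1 : ∀ᶠ t : ℝ in 𝓝[≠] l, IsUnit (h.ph t 1) := by
    have ht : Tendsto (fun t : ℝ => (t : ℂ)) (𝓝[≠] l) (𝓝[≠] (l : ℂ)) :=
      (Complex.continuous_ofReal.continuousAt).continuousWithinAt.tendsto_nhdsWithin
        (fun t ht => by simpa using ht)
    exact ht.eventually (h.eventually_isUnit l)
  rw [accPt_iff_frequently_nhdsNE] at hacc
  obtain ⟨t, ht1, ht2⟩ := (hacc.and_eventually h1).exists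
  exact ht1.1 ht2

omit [NeZero N] in
lemma inverse_analyticAt {z : ℂ} (hz : IsUnit (h.ph z 1)) :
    AnalyticAt ℂ (fun z => Ring.inverse (h.ph z 1)) z :=
  analyticAt_inverse (h.ph_analyticAt 1 z) hz

/-- With finitely many simple poles, `∏(z - l) φ(1,z)⁻¹` would extend to an entire function that is
polynomial times `exp(-|Im w|)` at good points, hence zero, although `φ(1,·)` is invertible there.
-/
lemma spec_infinite : h.spec.Infinite := by
  intro hfin
  set s : Finset ℝ := hfin.toFinset
  have hs : ∀ l, l ∈ s ↔ l ∈ h.spec := fun l => hfin.mem_toFinset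
  let p : Finset ℝ → ℂ → ℂ := fun s z => ∏ l ∈ s, (z - l)
  have hpa : ∀ s z, AnalyticAt ℂ (p s) z := fun s z => by
    have : Differentiable ℂ (p s) := by
      intro z
      exact DifferentiableAt.fun_finsetProd fun i _ => by fun_prop
    exact this.analyticAt z
  let f : ℂ → Mat N := fun z => p s z • Ring.inverse (h.ph z 1)
  have hext : ∀ z, ∃ g : ℂ → Mat N, AnalyticAt ℂ g z ∧ f =ᶠ[𝓝[≠] z] g := by
    intro z
    by_cases hz : IsUnit (h.ph z 1)
    · exact ⟨f, (hpa s z).smul (h.inverse_analyticAt hz), EventuallyEq.rfl⟩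
    · obtain ⟨l, hl, rfl⟩ := h.eq_ofReal_of_not_isUnit hz
      set P := projM (LinearMap.ker (op (h.ph l 1)))
      have hP : IsKerProj (h.ph l 1) P := isKerProj_projM _
      refine ⟨fun z => p (s.erase l) z • ((P + (z - l) • (1 - P))
        * Ring.inverse (h.regular P l z)), ?_, ?_⟩
      · refine (hpa _ _).smul (AnalyticAt.mul ?_ ?_)
        · exact analyticAt_const.add ((analyticAt_id.sub analyticAt_const).smul analyticAt_const)
        · exact analyticAt_inverse (h.regular_analyticAt P l l) (h.regular_isUnit hP)
      · filter_upwards [h.inverse_eventuallyEq hP, self_mem_nhdsWithin] with z h1 h2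
        have h3 : z - l ≠ 0 := sub_ne_zero.2 h2
        have e : p s z = p (s.erase l) z * (z - l) :=
          (Finset.prod_erase_mul s _ ((hs l).2 hl)).symm
        simp only [f, h1.2, e, mul_smul]
        congr 1
        rw [← smul_mul_assoc, smul_add, smul_smul, mul_inv_cancel₀ h3, one_smul]
  obtain ⟨F, hF, hFf⟩ := exists_entire_extension hext
  have hcont : ∀ z, IsUnit (h.ph z 1) → ContinuousAt f z := fun z hz =>
    ((hpa s z).smul (h.inverse_analyticAt hz)).continuousAt
  obtain ⟨C, hC⟩ : ∃ C : ℝ, ∀ w : ℂ, 1 ≤ ‖w‖ → ‖p s (w ^ 2)‖ ≤ C * ‖w‖ ^ (2 * s.card) := by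
    refine ⟨∏ l ∈ s, (1 + |l|), fun w hw => ?_⟩
    rw [norm_prod, pow_mul, ← Finset.prod_const, ← Finset.prod_mul_distrib]
    refine Finset.prod_le_prod (fun _ _ => norm_nonneg _) fun l _ => ?_
    have h1 : (1 : ℝ) ≤ ‖w‖ ^ 2 := one_le_pow₀ hw
    calc ‖w ^ 2 - l‖ ≤ ‖w‖ ^ 2 + |l| := by
          refine (norm_sub_le _ _).trans ?_
          rw [norm_pow, Complex.norm_real, Real.norm_eq_abs]
      _ ≤ ‖w‖ ^ 2 + |l| * ‖w‖ ^ 2 := by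
          gcongr; exact le_mul_of_one_le_right (abs_nonneg _) h1
      _ = _ := by ring
  have hgrow : ∀ w : ℂ, h.bnd ≤ ‖w‖ → GoodPt w →
      ‖F (w ^ 2)‖ ≤ (|C| * 8) * ‖w‖ ^ (2 * (s.card + 1)) * Real.exp (-|w.im|) := by
    intro w hw hg
    have hw1 := h.one_le_bnd.trans hw
    obtain ⟨h1, h2⟩ := h.isUnit_of_goodPt hw hg
    rw [hFf _ (hcont _ h1), norm_smul]
    calc ‖p s (w ^ 2)‖ * ‖Ring.inverse (h.ph (w ^ 2) 1)‖
        ≤ (|C| * ‖w‖ ^ (2 * s.card)) * (8 * ‖w‖ * Real.exp (-|w.im|)) := by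
          gcongr
          exact (hC w hw1).trans (by gcongr; exact le_abs_self C)
      _ = (|C| * 8) * (‖w‖ ^ (2 * s.card) * ‖w‖) * Real.exp (-|w.im|) := by ring
      _ ≤ _ := by
          gcongr
          rw [show 2 * (s.card + 1) = 2 * s.card + 1 + 1 by ring, pow_succ, pow_succ]
          exact le_mul_of_one_le_right (by positivity) hw1
  have hF0 : ∀ z, F z = 0 := by
    intro z
    ext i j
    let L : Mat N →L[ℂ] ℂ := LinearMap.toContinuousLinearMap
      { toFun := fun M => M i j, map_add' := fun _ _ => rfl, map_smul' := fun _ _ => rfl }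
    refine eq_zero_of_growth_of_decay (f := fun z => L (F z)) (L.differentiable.comp hF)
      (s.card + 1) (C := ‖L‖ * (|C| * 8)) (R := h.bnd) (fun w h1 h2 => ?_) z
    refine (L.le_opNorm _).trans ?_
    have := mul_le_mul_of_nonneg_left (hgrow w h1 h2) (norm_nonneg L)
    linarith
  obtain ⟨w, hw, hg⟩ := exists_goodPt h.bnd
  obtain ⟨h1, -⟩ := h.isUnit_of_goodPt hw hg
  have e := hF0 (w ^ 2)
  rw [hFf _ (hcont _ h1)] at e
  rcases smul_eq_zero.1 e with e1 | e1
  · obtain ⟨l, hl, e2⟩ := Finset.prod_eq_zero_iff.1 e1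
    rw [sub_eq_zero] at e2
    rw [e2] at h1
    exact (hs l).1 hl h1
  · have := Ring.mul_inverse_cancel _ h1
    rw [e1, mul_zero] at this
    exact zero_ne_one this

end SAPot

section Enumeration

/-- Exactly one point of a discrete set bounded below has a given rank. -/
lemma exists_rank {s : Set ℝ} (hs : s.Infinite) (hf : ∀ b, (s ∩ Iic b).Finite) (n : ℕ) :
    ∃ l ∈ s, (s ∩ Iic l).encard = (n + 1 : ℕ) := by
  have key : ∀ t : Set ℝ, t ⊆ s → t.Nonempty → ∃ l ∈ t, ∀ m ∈ t, l ≤ m := by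
    intro t hts ⟨m, hm⟩
    obtain ⟨l, hl, hmin⟩ := Set.exists_min_image (t ∩ Iic m) id
      ((hf m).subset (inter_subset_inter_left _ hts)) ⟨m, hm, self_mem_Iic⟩
    refine ⟨l, hl.1, fun k hk => ?_⟩
    rcases le_total k m with h | h
    · exact hmin k ⟨hk, h⟩
    · exact hl.2.trans h
  induction n with
  | zero =>
    obtain ⟨l, hl, hmin⟩ := key s subset_rfl hs.nonempty
    refine ⟨l, hl, ?_⟩
    have : s ∩ Iic l = {l} := by
      ext m
      simp only [mem_inter_iff, mem_Iic, mem_singleton_iff]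
      exact ⟨fun h => le_antisymm h.2 (hmin m h.1), by rintro rfl; exact ⟨hl, le_rfl⟩⟩
    rw [this]; simp
  | succ n ih =>
    obtain ⟨l, hl, hcard⟩ := ih
    obtain ⟨m, hm, hmin⟩ := key (s \ Iic l) sdiff_subset (by
      by_contra hne
      rw [not_nonempty_iff_eq_empty, sdiff_eq_empty] at hne
      exact hs ((hf l).subset fun x hx => ⟨hx, hne hx⟩))
    have hlm : l < m := not_le.1 hm.2
    refine ⟨m, hm.1, ?_⟩
    have : s ∩ Iic m = insert m (s ∩ Iic l) := by
      ext k
      simp only [mem_inter_iff, mem_Iic, mem_insert_iff]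
      constructor
      · rintro ⟨h1, h2⟩
        rcases le_or_gt k l with h | h
        · exact Or.inr ⟨h1, h⟩
        · exact Or.inl (le_antisymm h2 (hmin k ⟨h1, not_le.2 h⟩))
      · rintro (rfl | ⟨h1, h2⟩)
        · exact ⟨hm.1, le_rfl⟩
        · exact ⟨h1, h2.trans hlm.le⟩
    rw [this, encard_insert_of_notMem (fun h => hm.2 h.2), hcard]
    push_cast
    rfl

lemma rank_unique {s : Set ℝ} (hf : ∀ b, (s ∩ Iic b).Finite) {l m : ℝ} (hl : l ∈ s) (hm : m ∈ s)
    (h : (s ∩ Iic l).encard = (s ∩ Iic m).encard) : l = m := by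
  wlog hlm : l ≤ m generalizing l m
  · exact (this hm hl h.symm (le_of_not_ge hlm)).symm
  have hsub : s ∩ Iic l ⊆ s ∩ Iic m := inter_subset_inter_right _ (Iic_subset_Iic.2 hlm)
  have := (hf l).eq_of_subset_of_encard_le hsub h.ge
  have h2 : m ∈ s ∩ Iic l := by rw [this]; exact ⟨hm, self_mem_Iic⟩
  exact le_antisymm hlm h2.2

variable {N : ℕ} [NeZero N] {V : Potential N}

omit [NeZero N] in
lemma eigenvalues_eq_spec (hV : IsSelfAdjointPotential V) : eigenvalues V = (saPot hV).spec := by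
  ext l
  exact mem_eigenvalues_iff hV l

lemma eigenvalues_infinite (hV : IsSelfAdjointPotential V) : (eigenvalues V).Infinite := by
  rw [eigenvalues_eq_spec hV]; exact (saPot hV).spec_infinite

lemma eigenvalues_finite (hV : IsSelfAdjointPotential V) (b : ℝ) :
    (eigenvalues V ∩ Iic b).Finite := by
  rw [eigenvalues_eq_spec hV]; exact (saPot hV).spec_inter_Iic_finite b

/-- Distinct points of a discrete spectrum have distinct ranks, so the infimum defining `eigenvalue`
runs over a single point. -/
lemma eigenvalue_eq_of_rank (hV : IsSelfAdjointPotential V) {l : ℝ} {α : ℕ}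
    (hl : l ∈ eigenvalues V) (hα : (eigenvalues V ∩ Iic l).encard = α) : eigenvalue V α = l := by
  have : {m | m ∈ eigenvalues V ∧ (eigenvalues V ∩ Iic m).encard = α} = {l} := by
    ext m
    simp only [mem_ofPred_eq, mem_singleton_iff]
    constructor
    · rintro ⟨h1, h2⟩
      exact rank_unique (eigenvalues_finite hV) h1 hl (h2.trans hα.symm)
    · rintro rfl; exact ⟨hl, hα⟩
  rw [eigenvalue, this, csInf_singleton]

lemma eigenvalue_spec (hV : IsSelfAdjointPotential V) {α : ℕ} (hα : 1 ≤ α) :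
    eigenvalue V α ∈ eigenvalues V ∧ (eigenvalues V ∩ Iic (eigenvalue V α)).encard = α := by
  obtain ⟨n, rfl⟩ := Nat.exists_eq_add_of_le' hα
  obtain ⟨l, hl, hc⟩ := exists_rank (eigenvalues_infinite hV) (eigenvalues_finite hV) n
  rw [eigenvalue_eq_of_rank hV hl hc]
  exact ⟨hl, hc⟩

lemma eigenvalue_injective (hV : IsSelfAdjointPotential V) {α β : ℕ} (hα : 1 ≤ α) (hβ : 1 ≤ β)
    (h : eigenvalue V α = eigenvalue V β) : α = β := by
  have h1 := (eigenvalue_spec hV hα).2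
  have h2 := (eigenvalue_spec hV hβ).2
  rw [h, h2] at h1
  exact_mod_cast h1.symm

lemma exists_eigenvalue_eq (hV : IsSelfAdjointPotential V) {l : ℝ} (hl : l ∈ eigenvalues V) :
    ∃ α, 1 ≤ α ∧ eigenvalue V α = l := by
  have hfin := eigenvalues_finite hV l
  refine ⟨(eigenvalues V ∩ Iic l).ncard, ?_, eigenvalue_eq_of_rank hV hl ?_⟩
  · exact (Set.ncard_pos hfin).2 ⟨l, hl, self_mem_Iic⟩
  · exact hfin.cast_ncard_eq.symm

end Enumeration
end MatrixSL

end

/-! ### The forbidden subspace -/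

noncomputable section

namespace MatrixSL

open Filter Topology

lemma analyticAt_dslope {E : Type*} [NormedAddCommGroup E] [NormedSpace ℂ E] [CompleteSpace E]
    {k : ℂ → E} {z : ℂ} (hk : AnalyticAt ℂ k z) : AnalyticAt ℂ (dslope k z) z := by
  obtain ⟨p, hp⟩ := hk
  exact ⟨_, hp.has_fpower_series_dslope_fslope⟩

namespace SAPot

variable {N : ℕ} {Q Q₁ Q₂ : ℝ → Mat N} (h : SAPot Q) (h₁ : SAPot Q₁) (h₂ : SAPot Q₂)

lemma proj_mul_eq_zero {l : ℝ} {P X : Mat N} (hP : IsKerProj (h.ph l 1) P)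
    (e : P * h.gram l * P * X = 0) : P * X = 0 := by
  refine h.eq_zero_of_gram (l := l) le_rfl zero_lt_one le_rfl ?_
  have : star (P * X) = star X * P := by rw [star_mul, hP.herm]
  rw [this]
  calc _ = star X * (P * h.gram l * P * X) := by simp only [gram, mul_assoc]
    _ = 0 := by rw [e, mul_zero]

lemma norm_ph_sub_le [NeZero N] {w : ℂ} (hw₁ : h₁.bnd ≤ ‖w‖) (hw₂ : h₂.bnd ≤ ‖w‖) {x : ℝ}
    (hx : x ∈ Icc (0 : ℝ) 1) :
    ‖h₂.ph (w ^ 2) x - h₁.ph (w ^ 2) x‖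
      ≤ (h₁.bnd + h₂.bnd) * ‖w‖⁻¹ ^ 2 * Real.exp (|w.im| * x) := by
  have hw0 : w ≠ 0 := norm_pos_iff.1 (by linarith [h₁.one_le_bnd])
  have e1 := (h₁.ph_isSol (w ^ 2)).norm_sub_sin_le h₁.int hw0
    (h₁.two_mul_le_bnd.trans hw₁) (h₁.ph_zero _) (h₁.ph'_zero _) hx
  have e2 := (h₂.ph_isSol (w ^ 2)).norm_sub_sin_le h₂.int hw0
    (h₂.two_mul_le_bnd.trans hw₂) (h₂.ph_zero _) (h₂.ph'_zero _) hx
  have b1 := h₁.two_mul_le_bnd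
  have b2 := h₂.two_mul_le_bnd
  have pos : 0 ≤ ‖w‖⁻¹ ^ 2 * Real.exp (|w.im| * x) := by positivity
  calc ‖h₂.ph (w ^ 2) x - h₁.ph (w ^ 2) x‖
      = ‖(h₂.ph (w ^ 2) x - (Complex.sin (w * x) / w) • (1 : Mat N))
        - (h₁.ph (w ^ 2) x - (Complex.sin (w * x) / w) • (1 : Mat N))‖ := by
        rw [sub_sub_sub_cancel_right]
    _ ≤ _ := norm_sub_le _ _
    _ ≤ _ := add_le_add e2 e1
    _ ≤ _ := by nlinarith

/-- If `Ker φ₁(1,l) ⊆ Ker φ₂(1,l)` for all `l ≠ l₀`, then `φ₂(1,·) φ₁(1,·)⁻¹` has a single pole. -/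
lemma exists_transfer [NeZero N] (l₀ : ℝ)
    (hker : ∀ l : ℝ, l ≠ l₀ → ∀ P, IsKerProj (h₁.ph l 1) P → h₂.ph l 1 * P = 0) :
    ∃ C : Mat N, ∀ᶠ z : ℂ in 𝓝[≠] (l₀ : ℂ),
      (z - l₀) • h₂.ph z 1 = ((z - l₀) • (1 : Mat N) + C) * h₁.ph z 1 := by
  set P₀ := projM (LinearMap.ker (op (h₁.ph l₀ 1)))
  have hP₀ : IsKerProj (h₁.ph l₀ 1) P₀ := isKerProj_projM _
  let k : ℂ → Mat N := fun z => h₂.ph z 1 * P₀ * Ring.inverse (h₁.regular P₀ l₀ z)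
  have hreg : AnalyticAt ℂ (fun z => Ring.inverse (h₁.regular P₀ l₀ z)) l₀ :=
    analyticAt_inverse (h₁.regular_analyticAt P₀ l₀ l₀) (h₁.regular_isUnit hP₀)
  have hk : AnalyticAt ℂ k l₀ := ((h₂.ph_analyticAt 1 l₀).mul analyticAt_const).mul hreg
  -- This is the residue of `φ₂(1,·) φ₁(1,·)⁻¹` at `l₀`.
  set C := k l₀
  let f : ℂ → Mat N := fun z => h₂.ph z 1 * Ring.inverse (h₁.ph z 1) - (z - l₀)⁻¹ • C
  have hpole : ∀ z : ℂ, z ≠ l₀ → AnalyticAt ℂ (fun z : ℂ => (z - l₀)⁻¹ • C) z := fun z hz =>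
    ((analyticAt_id.sub analyticAt_const).inv (sub_ne_zero.2 hz)).smul analyticAt_const
  have hana : ∀ z : ℂ, z ≠ l₀ → IsUnit (h₁.ph z 1) → AnalyticAt ℂ f z := fun z hz hu =>
    ((h₂.ph_analyticAt 1 z).mul (h₁.inverse_analyticAt hu)).sub (hpole z hz)
  have hext : ∀ z, ∃ g : ℂ → Mat N, AnalyticAt ℂ g z ∧ f =ᶠ[𝓝[≠] z] g := by
    intro z
    by_cases hz : z = l₀
    · subst hz
      refine ⟨fun z => dslope k l₀ z + h₂.ph z 1 * (1 - P₀)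
        * Ring.inverse (h₁.regular P₀ l₀ z),
        (analyticAt_dslope hk).add
          (((h₂.ph_analyticAt 1 _).mul analyticAt_const).mul hreg), ?_⟩
      filter_upwards [h₁.inverse_eventuallyEq hP₀, self_mem_nhdsWithin] with z h1 h2
      simp only [f, h1.2]
      rw [dslope_of_ne _ h2, slope_def_module, smul_sub]
      simp only [C, k, add_mul, mul_add, smul_mul_assoc, mul_smul_comm, mul_assoc]
      abel
    · by_cases hu : IsUnit (h₁.ph z 1)
      · exact ⟨f, hana z hz hu, EventuallyEq.rfl⟩
      · obtain ⟨l, hl, rfl⟩ := h₁.eq_ofReal_of_not_isUnit hu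
        set P := projM (LinearMap.ker (op (h₁.ph l 1)))
        have hP : IsKerProj (h₁.ph l 1) P := isKerProj_projM _
        -- The inclusion of kernels removes the simple pole at every point other than `l₀`.
        have hP2 := hker l (fun e => hz (by rw [e])) P hP
        refine ⟨fun z => (dslope (fun z => h₂.ph z 1) l z * P + h₂.ph z 1 * (1 - P))
          * Ring.inverse (h₁.regular P l z) - (z - l₀)⁻¹ • C, ?_, ?_⟩
        · exact ((((h₂.dslope_analyticAt l l).mul analyticAt_const).add
            ((h₂.ph_analyticAt 1 _).mul analyticAt_const)).mul
            (analyticAt_inverse (h₁.regular_analyticAt P l l) (h₁.regular_isUnit hP))).sub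
            (hpole _ hz)
        · filter_upwards [h₁.inverse_eventuallyEq hP, self_mem_nhdsWithin] with z h1 h2
          simp only [f, h1.2]
          rw [dslope_of_ne _ h2, slope_def_module, smul_mul_assoc, sub_mul, hP2, sub_zero]
          simp only [add_mul, mul_add, smul_mul_assoc, mul_smul_comm, mul_assoc]
  -- Both solutions have the leading term `sin w / w`, so their quotient differs from `1` by
  -- `O(1/‖w‖)`. The bound `1 + |l₀| ≤ ‖w‖` guarantees `‖w² - l₀‖ ≥ ‖w‖`.
  have hgood : ∀ w : ℂ, max (max h₁.bnd h₂.bnd) (1 + |l₀|) ≤ ‖w‖ → GoodPt w →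
      IsUnit (h₁.ph (w ^ 2) 1) ∧ w ^ 2 ≠ l₀ ∧
        ‖f (w ^ 2) - 1‖ ≤ (8 * (h₁.bnd + h₂.bnd) + ‖C‖) * ‖w‖⁻¹ := by
    intro w hw hg
    have hw1 : h₁.bnd ≤ ‖w‖ := ((le_max_left _ _).trans (le_max_left _ _)).trans hw
    have hw2 : h₂.bnd ≤ ‖w‖ := ((le_max_right _ _).trans (le_max_left _ _)).trans hw
    have hw3 : 1 + |l₀| ≤ ‖w‖ := (le_max_right _ _).trans hw
    have hwp : 0 < ‖w‖ := by linarith [abs_nonneg l₀]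
    obtain ⟨hu, hi⟩ := h₁.isUnit_of_goodPt hw1 hg
    have hd : ‖w‖ ≤ ‖w ^ 2 - l₀‖ := by
      have a1 : ‖w ^ 2‖ - ‖(l₀ : ℂ)‖ ≤ ‖w ^ 2 - l₀‖ := norm_sub_norm_le _ _
      rw [norm_pow, Complex.norm_real, Real.norm_eq_abs] at a1
      nlinarith [abs_nonneg l₀]
    have hne : w ^ 2 - l₀ ≠ 0 := norm_pos_iff.1 (hwp.trans_le hd)
    refine ⟨hu, sub_ne_zero.1 hne, ?_⟩
    have e : f (w ^ 2) - 1 = (h₂.ph (w ^ 2) 1 - h₁.ph (w ^ 2) 1)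
        * Ring.inverse (h₁.ph (w ^ 2) 1) - (w ^ 2 - l₀)⁻¹ • C := by
      simp only [f, sub_mul, Ring.mul_inverse_cancel _ hu]
      abel
    rw [e, add_mul]
    refine (norm_sub_le _ _).trans (add_le_add ?_ ?_)
    · have a1 := h₁.norm_ph_sub_le h₂ hw1 hw2 (x := 1) (by simp)
      rw [mul_one] at a1
      have b1 := h₁.one_le_bnd
      have b2 := h₂.one_le_bnd
      calc _ ≤ ‖h₂.ph (w ^ 2) 1 - h₁.ph (w ^ 2) 1‖ * ‖Ring.inverse (h₁.ph (w ^ 2) 1)‖ :=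
            norm_mul_le _ _
        _ ≤ ((h₁.bnd + h₂.bnd) * ‖w‖⁻¹ ^ 2 * Real.exp |w.im|)
            * (8 * ‖w‖ * Real.exp (-|w.im|)) := by
            gcongr
        _ = 8 * (h₁.bnd + h₂.bnd) * ‖w‖⁻¹ * (‖w‖⁻¹ * ‖w‖)
            * (Real.exp |w.im| * Real.exp (-|w.im|)) := by ring
        _ = _ := by rw [← Real.exp_add, inv_mul_cancel₀ hwp.ne']; simp
    · rw [norm_smul, norm_inv, mul_comm]
      gcongr
  obtain ⟨K, hK⟩ := exists_const_of_bounded_on_goodPt hext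
    (R := max (max h₁.bnd h₂.bnd) (1 + |l₀|)) (C := 1 + (8 * (h₁.bnd + h₂.bnd) + ‖C‖))
    (fun w hw hg => by
      obtain ⟨a1, a2, a3⟩ := hgood w hw hg
      refine ⟨(hana _ a2 a1).continuousAt, ?_⟩
      have hw3 : 1 ≤ ‖w‖ := by
        have := (le_max_right _ _).trans hw
        linarith [abs_nonneg l₀]
      have b1 := h₁.one_le_bnd
      have b2 := h₂.one_le_bnd
      calc ‖f (w ^ 2)‖ = ‖1 + (f (w ^ 2) - 1)‖ := by rw [add_sub_cancel]
        _ ≤ ‖(1 : Mat N)‖ + ‖f (w ^ 2) - 1‖ := norm_add_le _ _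
        _ ≤ 1 + (8 * (h₁.bnd + h₂.bnd) + ‖C‖) * ‖w‖⁻¹ := by rw [norm_one]; gcongr
        _ ≤ 1 + (8 * (h₁.bnd + h₂.bnd) + ‖C‖) := by
          gcongr
          exact mul_le_of_le_one_right (by positivity) (inv_le_one_of_one_le₀ hw3))
  have hK1 : K - 1 = 0 := by
    refine eq_zero_of_le_div (R := max (max h₁.bnd h₂.bnd) (1 + |l₀|))
      (C := 8 * (h₁.bnd + h₂.bnd) + ‖C‖) fun w hw hg => ?_
    obtain ⟨a1, a2, a3⟩ := hgood w hw hg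
    rw [hK _ (hana _ a2 a1).continuousAt] at a3
    exact a3
  refine ⟨C, ?_⟩
  filter_upwards [h₁.eventually_isUnit l₀, self_mem_nhdsWithin] with z hu hz
  have hz' : z - l₀ ≠ 0 := sub_ne_zero.2 hz
  have e := hK z (hana z hz hu).continuousAt
  rw [sub_eq_zero.1 hK1] at e
  simp only [f] at e
  rw [sub_eq_iff_eq_add] at e
  calc (z - l₀) • h₂.ph z 1
      = (z - l₀) • (h₂.ph z 1 * Ring.inverse (h₁.ph z 1) * h₁.ph z 1) := by
        rw [mul_assoc, Ring.inverse_mul_cancel _ hu, mul_one]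
    _ = _ := by
        rw [e, ← smul_mul_assoc, smul_add, smul_smul, mul_inv_cancel₀ hz', one_smul]

/-- These are the coefficients of order zero and one at `l₀` of the identity in `exists_transfer`.
-/
lemma exists_transfer_at [NeZero N] (l₀ : ℝ)
    (hker : ∀ l : ℝ, l ≠ l₀ → ∀ P, IsKerProj (h₁.ph l 1) P → h₂.ph l 1 * P = 0) :
    ∃ C : Mat N, C * h₁.ph l₀ 1 = 0 ∧
      h₂.ph l₀ 1 = h₁.ph l₀ 1 + C * deriv (fun z => h₁.ph z 1) l₀ := by
  obtain ⟨C, hC⟩ := h₁.exists_transfer h₂ l₀ hker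
  let F : ℂ → Mat N := fun z =>
    (z - l₀) • h₂.ph z 1 - ((z - l₀) • (1 : Mat N) + C) * h₁.ph z 1
  have hd : HasDerivAt F ((h₂.ph l₀ 1) - (h₁.ph l₀ 1 + C * deriv (fun z => h₁.ph z 1) l₀)) l₀ := by
    have a0 : HasDerivAt (fun z : ℂ => z - (l₀ : ℂ)) 1 l₀ := (hasDerivAt_id _).sub_const _
    have a1 := a0.smul (h₂.ph_differentiable 1 l₀).hasDerivAt
    have a2 := ((a0.smul_const (1 : Mat N)).add_const C).mul
      (h₁.ph_differentiable 1 l₀).hasDerivAt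
    refine (a1.sub a2).congr_deriv ?_
    simp
  have hF : F =ᶠ[𝓝[≠] (l₀ : ℂ)] fun _ => 0 := by
    filter_upwards [hC] with z hz
    simp only [F, hz, sub_self]
  have h0 : F l₀ = 0 := by
    have t1 : Tendsto F (𝓝[≠] (l₀ : ℂ)) (𝓝 (F l₀)) :=
      hd.continuousAt.tendsto.mono_left nhdsWithin_le_nhds
    exact tendsto_nhds_unique (t1.congr' hF) tendsto_const_nhds
  have hF' : F =ᶠ[𝓝 (l₀ : ℂ)] fun _ => 0 := by
    rw [Filter.EventuallyEq, eventually_nhdsWithin_iff] at hF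
    filter_upwards [hF] with z hz
    by_cases hzl : z = l₀
    · rw [hzl, h0]
    · exact hz hzl
  have hd0 : HasDerivAt F 0 l₀ := (hasDerivAt_const _ _).congr_of_eventuallyEq hF'
  refine ⟨C, ?_, sub_eq_zero.1 (hd.unique hd0)⟩
  simpa [F] using h0

/-- The kernel of `φ₂(1,l₀)` meets the forbidden subspace of `φ₁` trivially. -/
lemma eq_zero_of_forbidden [NeZero N] {l₀ : ℝ} {P : Mat N} (hP : IsKerProj (h₁.ph l₀ 1) P)
    (hker : ∀ l : ℝ, l ≠ l₀ → ∀ P, IsKerProj (h₁.ph l 1) P → h₂.ph l 1 * P = 0)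
    {X : Mat N} (hX : h₂.ph l₀ 1 * X = 0) (hX2 : P * h₁.gram l₀ * X = 0) : X = 0 := by
  obtain ⟨C, hC1, hC2⟩ := h₁.exists_transfer_at h₂ l₀ hker
  set D := deriv (fun z => h₁.ph z 1) (l₀ : ℂ)
  -- Solving with the invertible polar matrix splits `D X` into a part in the range of `φ₁(1,l₀)`,
  -- which `C` annihilates, and `D P U`. The hypothesis `P S X = 0` makes `P U` vanish, so `C D X =
  -- 0`.
  obtain ⟨U, hU⟩ : ∃ U, (h₁.ph l₀ 1 * (1 - P) + D * P) * U = D * X :=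
    ⟨Ring.inverse (h₁.ph l₀ 1 * (1 - P) + D * P) * (D * X), by
      rw [← mul_assoc, Ring.mul_inverse_cancel _ (h₁.isUnit_polar hP), one_mul]⟩
  have e1 : P * h₁.gram l₀ * P * U = 0 := by
    have a1 : P * star (h₁.ph' l₀ 1) * (D * X) = 0 := by
      rw [← mul_assoc, h₁.proj_mul_deriv hP, hX2]
    rw [← hU, add_mul, mul_add, ← mul_assoc, ← mul_assoc _ (h₁.ph l₀ 1), h₁.proj_mul_ph hP,
      zero_mul, zero_mul, zero_add, ← mul_assoc, ← mul_assoc, h₁.proj_mul_deriv hP] at a1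
    exact a1
  have e2 := h₁.proj_mul_eq_zero hP e1
  have e3 : C * D * X = 0 := by
    rw [mul_assoc, ← hU, add_mul, mul_assoc D, e2, mul_zero, add_zero, mul_assoc, ← mul_assoc,
      hC1, zero_mul]
  have e4 : h₁.ph l₀ 1 * X = 0 := by
    rw [hC2, add_mul, e3, add_zero] at hX
    exact hX
  have e5 := hP.eq X e4
  have e6 := h₁.proj_mul_eq_zero hP (X := X) (by rw [mul_assoc, e5, hX2])
  rw [← e5, e6]

end SAPot
end MatrixSL

end

/-! ### The Weyl function and the solution vanishing at the right end -/

noncomputable section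

namespace MatrixSL

open Filter Topology

namespace SAPot

variable {N : ℕ} {Q Q₁ Q₂ : ℝ → Mat N} (h : SAPot Q) (h₁ : SAPot Q₁) (h₂ : SAPot Q₂)

section Reflection

include h in
/-- The reflected potential `x ↦ Q (1 - x)`. -/
lemma reflect : SAPot (fun x => Q (1 - x)) where
  int := by simpa using (h.int.comp_sub_left 1).symm
  herm := by
    have h1 : MeasurePreserving (fun x : ℝ => 1 - x) volume volume :=
      Measure.measurePreserving_sub_left volume 1
    filter_upwards [h1.quasiMeasurePreserving.ae h.herm] with t ht h2
    exact ht ⟨by linarith [h2.2], by linarith [h2.1]⟩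

lemma reflect_isSol (l : ℂ) : IsSol Q l (fun x => h.reflect.ph l (1 - x))
    (fun x => -h.reflect.ph' l (1 - x)) := by
  have h1 := h.reflect.ph_isSol l
  refine ⟨h1.d1.reflect, h1.d2.reflect.neg.congr (fun _ _ => rfl)
    (Eventually.of_forall fun x _ => ?_)⟩
  simp

end Reflection

section Weyl

/-- The function `φ(1,z)⁻¹ θ(1,z)`. -/
def weyl (z : ℂ) : Mat N := Ring.inverse (h.ph z 1) * h.th z 1

/-- The solution that vanishes at `1` and equals `1` at `0`. -/
def psi (z : ℂ) (x : ℝ) : Mat N := h.th z x - h.ph z x * h.weyl z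

/-- The derivative of `psi`. -/
def psi' (z : ℂ) (x : ℝ) : Mat N := h.th' z x - h.ph' z x * h.weyl z

lemma psi_isSol (z : ℂ) : IsSol Q z (h.psi z) (h.psi' z) :=
  (h.th_isSol z).sub ((h.ph_isSol z).mul_const _)

/-- Both sides vanish at `1` and equal `1` at `0`, which determines a solution when `φ(1,z)` is
invertible. The reflected form displays the decay of `psi`, which the definition hides in a
cancellation. -/
lemma psi_eq {z : ℂ} (hu : IsUnit (h.ph z 1)) (hu' : IsUnit (h.reflect.ph z 1)) {x : ℝ}
    (hx : x ∈ Icc (0 : ℝ) 1) :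
    h.psi z x = h.reflect.ph z (1 - x) * Ring.inverse (h.reflect.ph z 1) ∧
      h.psi' z x = -h.reflect.ph' z (1 - x) * Ring.inverse (h.reflect.ph z 1) := by
  have hd := (h.psi_isSol z).sub
    ((h.reflect_isSol z).mul_const (Ring.inverse (h.reflect.ph z 1)))
  set d := fun x => h.psi z x - h.reflect.ph z (1 - x) * Ring.inverse (h.reflect.ph z 1)
  set d' := fun x => h.psi' z x - -h.reflect.ph' z (1 - x) * Ring.inverse (h.reflect.ph z 1)
  have d0 : d 0 = 0 := by
    simp [d, psi, Ring.mul_inverse_cancel _ hu']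
  have d1 : d 1 = 0 := by
    simp [d, psi, weyl, ← mul_assoc, Ring.mul_inverse_cancel _ hu]
  have key := fun {x : ℝ} (hx : x ∈ Icc (0 : ℝ) 1) =>
    hd.unique h.int ((h.ph_isSol z).mul_const (d' 0)) (by simp [d0]) (by simp) hx
  have e : d' 0 = 0 := by
    have h1 := (key (x := 1) (by simp)).1
    rw [d1] at h1
    calc d' 0 = Ring.inverse (h.ph z 1) * (h.ph z 1 * d' 0) := by
          rw [← mul_assoc, Ring.inverse_mul_cancel _ hu, one_mul]
      _ = 0 := by rw [← h1, mul_zero]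
  obtain ⟨k1, k2⟩ := key hx
  rw [e, mul_zero] at k1 k2
  exact ⟨sub_eq_zero.1 k1, sub_eq_zero.1 k2⟩

/-- The Wronskian identities say that a block matrix of Cauchy data has a left inverse. It is also a
right inverse, and the upper right block of that product is this identity. -/
lemma ph_mul_star_th (z : ℂ) {x : ℝ} (hx : x ∈ Icc (0 : ℝ) 1) :
    h.ph z x * star (h.th (star z) x) = h.th z x * star (h.ph (star z) x) := by
  have e1 := h.ph_wronskian hx z
  have e2 := h.ph_th_wronskian hx z
  have e3 := h.th_wronskian hx z
  have e4 := congrArg star (h.ph_th_wronskian hx (star z))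
  simp only [star_sub, star_mul, star_star, star_one] at e4
  have hLM : Matrix.fromBlocks (star (h.ph' (star z) x)) (-star (h.ph (star z) x))
      (-star (h.th' (star z) x)) (star (h.th (star z) x))
      * Matrix.fromBlocks (h.th z x) (h.ph z x) (h.th' z x) (h.ph' z x) = 1 := by
    rw [Matrix.fromBlocks_multiply, ← Matrix.fromBlocks_one]
    congr 1
    · rw [neg_mul, ← sub_eq_add_neg, e2]
    · rw [neg_mul, ← sub_eq_add_neg, e1, sub_self]
    · rw [neg_mul, e3, neg_add_cancel]
    · rw [neg_mul, neg_add_eq_sub, e4]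
  have hML := mul_eq_one_comm.1 hLM
  rw [Matrix.fromBlocks_multiply, ← Matrix.fromBlocks_one] at hML
  have := (Matrix.fromBlocks_inj.1 hML).2.1
  rw [mul_neg, neg_add_eq_sub, sub_eq_zero] at this
  exact this

lemma star_inverse {X : Mat N} (hX : IsUnit X) : star (Ring.inverse X) = Ring.inverse (star X) := by
  obtain ⟨u, rfl⟩ := hX
  rw [Ring.inverse_unit, ← Units.coe_star u, Ring.inverse_unit]
  simp

lemma star_weyl {z : ℂ} (hu : IsUnit (h.ph z 1)) (hu' : IsUnit (h.ph (star z) 1)) :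
    star (h.weyl (star z)) = h.weyl z := by
  have e := h.ph_mul_star_th z (x := 1) (by simp)
  have hs : IsUnit (star (h.ph (star z) 1)) := hu'.star
  rw [weyl, weyl, star_mul, star_inverse hu']
  calc star (h.th (star z) 1) * Ring.inverse (star (h.ph (star z) 1))
      = Ring.inverse (h.ph z 1) * (h.ph z 1 * star (h.th (star z) 1))
          * Ring.inverse (star (h.ph (star z) 1)) := by
        rw [← mul_assoc, Ring.inverse_mul_cancel _ hu, one_mul]
    _ = _ := by
        rw [e, mul_assoc, mul_assoc, Ring.mul_inverse_cancel _ hs, mul_one]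

/-- The residue of the Weyl function, up to the invertible factor `P S P` on the range of `P`. -/
lemma residue_eq {l : ℝ} {P : Mat N} (hP : IsKerProj (h.ph l 1) P) :
    P * h.gram l * P * (Ring.inverse (h.regular P l l) * h.th l 1) = P := by
  obtain ⟨U, hUe⟩ : ∃ U, U = Ring.inverse (h.regular P l l) * h.th l 1 := ⟨_, rfl⟩
  rw [← hUe]
  have hU : h.regular P l l * U = h.th l 1 := by
    rw [hUe, ← mul_assoc, Ring.mul_inverse_cancel _ (h.regular_isUnit hP), one_mul]
  rw [regular, dslope_same] at hU
  have e1 : P * star (h.ph' l 1) * h.th l 1 = P := by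
    have e := h.ph_th_wronskian (x := 1) (by simp) l
    simp only [RCLike.star_def, Complex.conj_ofReal] at e
    rw [mul_assoc, sub_eq_iff_eq_add.1 e, mul_add, ← mul_assoc, h.proj_mul_star_ph hP]
    simp
  rw [← hU, add_mul, mul_add, ← mul_assoc, ← mul_assoc _ (h.ph l 1), h.proj_mul_ph hP,
    zero_mul, zero_mul, zero_add, ← mul_assoc, ← mul_assoc, h.proj_mul_deriv hP] at e1
  exact e1

/-- Equality of the projectors and norming operators of two potentials at `l`. -/
def SameData (l : ℝ) : Prop :=
  ∃ P, IsKerProj (h₁.ph l 1) P ∧ IsKerProj (h₂.ph l 1) P ∧ P * h₁.gram l * P = P * h₂.gram l * P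

lemma weyl_analyticAt {z : ℂ} (hu : IsUnit (h.ph z 1)) : AnalyticAt ℂ h.weyl z :=
  (h.inverse_analyticAt hu).mul ((h.th_differentiable 1).analyticAt z)

/-- The regular part of the Weyl function at a pole. -/
lemma weyl_polar {l : ℝ} {P : Mat N} (hP : IsKerProj (h.ph l 1) P) :
    ∃ g : ℂ → Mat N, AnalyticAt ℂ g l ∧ ∀ᶠ z : ℂ in 𝓝[≠] (l : ℂ), h.weyl z =
      (z - l)⁻¹ • (P * (Ring.inverse (h.regular P l l) * h.th l 1)) + g z := by
  have hreg : AnalyticAt ℂ (fun z => Ring.inverse (h.regular P l z)) l :=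
    analyticAt_inverse (h.regular_analyticAt P l l) (h.regular_isUnit hP)
  let k : ℂ → Mat N := fun z => P * (Ring.inverse (h.regular P l z) * h.th z 1)
  have hk : AnalyticAt ℂ k l :=
    analyticAt_const.mul (hreg.mul ((h.th_differentiable 1).analyticAt _))
  refine ⟨fun z => dslope k l z + (1 - P) * (Ring.inverse (h.regular P l z) * h.th z 1),
    (analyticAt_dslope hk).add (analyticAt_const.mul (hreg.mul
      ((h.th_differentiable 1).analyticAt _))), ?_⟩
  filter_upwards [h.inverse_eventuallyEq hP, self_mem_nhdsWithin] with z h1 h2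
  rw [weyl, h1.2, dslope_of_ne _ h2, slope_def_module, smul_sub]
  simp only [k, add_mul, smul_mul_assoc, mul_assoc]
  abel

/-- By `residue_eq` the residue is determined by `P` and `P S P`, so the principal parts cancel at
every real point. Off the real axis both functions are analytic. -/
lemma weyl_sub_extends (hdata : ∀ l, h₁.SameData h₂ l) (z : ℂ) :
    ∃ g : ℂ → Mat N, AnalyticAt ℂ g z ∧ (fun z => h₂.weyl z - h₁.weyl z) =ᶠ[𝓝[≠] z] g := by
  by_cases hz : z.im = 0
  · obtain ⟨l, rfl⟩ : ∃ l : ℝ, (l : ℂ) = z := ⟨z.re, Complex.ext (by simp) (by simp [hz])⟩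
    obtain ⟨P, hP₁, hP₂, hg⟩ := hdata l
    obtain ⟨g₁, a₁, e₁⟩ := h₁.weyl_polar hP₁
    obtain ⟨g₂, a₂, e₂⟩ := h₂.weyl_polar hP₂
    refine ⟨fun z => g₂ z - g₁ z, a₂.sub a₁, ?_⟩
    have r₁ := h₁.residue_eq hP₁
    have r₂ := h₂.residue_eq hP₂
    set U₁ := Ring.inverse (h₁.regular P l l) * h₁.th l 1
    set U₂ := Ring.inverse (h₂.regular P l l) * h₂.th l 1
    have e : P * (U₂ - U₁) = 0 := h₁.proj_mul_eq_zero hP₁ (by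
      rw [mul_sub, r₁, hg, r₂, sub_self])
    rw [mul_sub, sub_eq_zero] at e
    filter_upwards [e₁, e₂] with z h1 h2
    rw [h1, h2, e]
    abel
  · exact ⟨_, (h₂.weyl_analyticAt (h₂.ph_isUnit_of_im_ne_zero hz zero_lt_one le_rfl)).sub
      (h₁.weyl_analyticAt (h₁.ph_isUnit_of_im_ne_zero hz zero_lt_one le_rfl)), EventuallyEq.rfl⟩

end Weyl

section Bounds

variable [NeZero N]

lemma norm_ph_le {w : ℂ} (hw : h.bnd ≤ ‖w‖) {x : ℝ} (hx : x ∈ Icc (0 : ℝ) 1) :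
    ‖h.ph (w ^ 2) x‖ ≤ 2 * ‖w‖⁻¹ * Real.exp (|w.im| * x) :=
  (h.ph_isSol (w ^ 2)).norm_le h.int (norm_pos_iff.1 (by linarith [h.one_le_bnd]))
    (h.two_mul_le_bnd.trans hw) (h.ph_zero _) (h.ph'_zero _) hx

lemma norm_ph'_le {w : ℂ} (hw : h.bnd ≤ ‖w‖) {x : ℝ} (hx : x ∈ Icc (0 : ℝ) 1) :
    ‖h.ph' (w ^ 2) x‖ ≤ 2 * Real.exp (|w.im| * x) :=
  (h.ph_isSol (w ^ 2)).norm_deriv_le h.int (norm_pos_iff.1 (by linarith [h.one_le_bnd]))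
    (h.two_mul_le_bnd.trans hw) (h.ph_zero _) (h.ph'_zero _) hx

lemma norm_psi_le {w : ℂ} (hw : h.bnd ≤ ‖w‖) (hw' : h.reflect.bnd ≤ ‖w‖) (hg : GoodPt w) {x : ℝ}
    (hx : x ∈ Icc (0 : ℝ) 1) :
    ‖h.psi (w ^ 2) x‖ ≤ 16 * Real.exp (-(|w.im| * x)) ∧
      ‖h.psi' (w ^ 2) x‖ ≤ 16 * ‖w‖ * Real.exp (-(|w.im| * x)) := by
  have hx' : 1 - x ∈ Icc (0 : ℝ) 1 := ⟨by linarith [hx.2], by linarith [hx.1]⟩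
  obtain ⟨hu, -⟩ := h.isUnit_of_goodPt hw hg
  obtain ⟨hu', hi⟩ := h.reflect.isUnit_of_goodPt hw' hg
  obtain ⟨e1, e2⟩ := h.psi_eq hu hu' hx
  have hwp : 0 < ‖w‖ := by linarith [h.one_le_bnd]
  have ee : Real.exp (|w.im| * (1 - x)) * Real.exp (-|w.im|) = Real.exp (-(|w.im| * x)) := by
    rw [← Real.exp_add]; ring_nf
  rw [e1, e2]
  constructor
  · calc _ ≤ ‖h.reflect.ph (w ^ 2) (1 - x)‖ * ‖Ring.inverse (h.reflect.ph (w ^ 2) 1)‖ :=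
          norm_mul_le _ _
      _ ≤ (2 * ‖w‖⁻¹ * Real.exp (|w.im| * (1 - x))) * (8 * ‖w‖ * Real.exp (-|w.im|)) := by
          gcongr; exact h.reflect.norm_ph_le hw' hx'
      _ = 16 * (‖w‖⁻¹ * ‖w‖) * (Real.exp (|w.im| * (1 - x)) * Real.exp (-|w.im|)) := by ring
      _ = _ := by rw [inv_mul_cancel₀ hwp.ne', ee, mul_one]
  · calc _ ≤ ‖-h.reflect.ph' (w ^ 2) (1 - x)‖ * ‖Ring.inverse (h.reflect.ph (w ^ 2) 1)‖ :=
          norm_mul_le _ _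
      _ ≤ (2 * Real.exp (|w.im| * (1 - x))) * (8 * ‖w‖ * Real.exp (-|w.im|)) := by
          rw [norm_neg]
          gcongr; exact h.reflect.norm_ph'_le hw' hx'
      _ = 16 * ‖w‖ * (Real.exp (|w.im| * (1 - x)) * Real.exp (-|w.im|)) := by ring
      _ = _ := by rw [ee]

lemma goodPt_star {w : ℂ} (hg : GoodPt w) : GoodPt (star w) := by
  unfold GoodPt at *
  rw [RCLike.star_def, Complex.sin_conj, RCLike.norm_conj, Complex.conj_im, abs_neg]
  exact hg

lemma star_psi {w : ℂ} (hw : h.bnd ≤ ‖w‖) (hg : GoodPt w) (x : ℝ) :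
    star (h.psi (star (w ^ 2)) x) = star (h.th (star (w ^ 2)) x)
        - h.weyl (w ^ 2) * star (h.ph (star (w ^ 2)) x) ∧
      star (h.psi' (star (w ^ 2)) x) = star (h.th' (star (w ^ 2)) x)
        - h.weyl (w ^ 2) * star (h.ph' (star (w ^ 2)) x) := by
  have hu := (h.isUnit_of_goodPt hw hg).1
  have hu' := (h.isUnit_of_goodPt (w := star w) (by rwa [norm_star]) (goodPt_star hg)).1
  rw [← star_pow] at hu'
  have e := h.star_weyl hu hu'
  simp only [psi, psi', star_sub, star_mul, e, and_self]

end Bounds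

end SAPot
end MatrixSL

end

/-! ### Uniqueness: the spectral data determine the potential -/

noncomputable section

namespace MatrixSL

open Filter Topology

namespace SAPot

variable {N : ℕ} {Q Q₁ Q₂ : ℝ → Mat N} (h : SAPot Q) (h₁ : SAPot Q₁) (h₂ : SAPot Q₂)

lemma star_star_analyticAt {f : ℂ → Mat N} (hf : Differentiable ℂ f) (z : ℂ) :
    AnalyticAt ℂ (fun z => star (f (star z))) z := by
  have : Differentiable ℂ (fun z => star (f (star z))) := fun z => by
    have := (hf (star z)).star_star
    rw [star_star] at this
    exact this
  exact this.analyticAt z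

/-- The first row of the transfer matrix between two potentials. -/
def transfer₁ (x : ℝ) (z : ℂ) : Mat N :=
  h₂.th z x * star (h₁.ph' (star z) x) - h₂.ph z x * star (h₁.th' (star z) x)
    - h₂.ph z x * (h₂.weyl z - h₁.weyl z) * star (h₁.ph' (star z) x)

/-- The second entry of the first row of the transfer matrix between two potentials. -/
def transfer₂ (x : ℝ) (z : ℂ) : Mat N :=
  h₂.ph z x * star (h₁.th (star z) x) - h₂.th z x * star (h₁.ph (star z) x)
    + h₂.ph z x * (h₂.weyl z - h₁.weyl z) * star (h₁.ph (star z) x)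

/-- Conjugated Wronskian identities give `1` as the coefficient of `φ₂` and `0` as that of every
term with a Weyl function or `θ₂`. -/
lemma transfer_eq {x : ℝ} (hx : x ∈ Icc (0 : ℝ) 1) (z : ℂ) :
    h₂.ph z x = h₁.transfer₁ h₂ x z * h₁.ph z x + h₁.transfer₂ h₂ x z * h₁.ph' z x := by
  have e1 := h₁.ph_wronskian hx z
  have e4 := congrArg star (h₁.ph_th_wronskian hx (star z))
  simp only [star_sub, star_mul, star_star, star_one] at e4
  have key : h₁.transfer₁ h₂ x z * h₁.ph z x + h₁.transfer₂ h₂ x z * h₁.ph' z x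
      = h₂.ph z x * (star (h₁.th (star z) x) * h₁.ph' z x
          - star (h₁.th' (star z) x) * h₁.ph z x)
        + (h₂.th z x - h₂.ph z x * (h₂.weyl z - h₁.weyl z))
          * (star (h₁.ph' (star z) x) * h₁.ph z x - star (h₁.ph (star z) x) * h₁.ph' z x) := by
    unfold transfer₁ transfer₂
    generalize h₂.weyl z - h₁.weyl z = m
    noncomm_ring
  rw [key, e4, e1, sub_self]
  simp

lemma transfer_extends (hdata : ∀ l, h₁.SameData h₂ l) (x : ℝ) (z : ℂ) :
    (∃ g : ℂ → Mat N, AnalyticAt ℂ g z ∧ h₁.transfer₁ h₂ x =ᶠ[𝓝[≠] z] g) ∧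
      ∃ g : ℂ → Mat N, AnalyticAt ℂ g z ∧ h₁.transfer₂ h₂ x =ᶠ[𝓝[≠] z] g := by
  obtain ⟨g, hg, e⟩ := h₁.weyl_sub_extends h₂ hdata z
  have a1 := h₂.ph_analyticAt x z
  have a2 := (h₂.th_differentiable x).analyticAt z
  have b1 := star_star_analyticAt (h₁.ph_differentiable x) z
  have b2 := star_star_analyticAt (h₁.ph'_differentiable x) z
  have b3 := star_star_analyticAt (h₁.th_differentiable x) z
  have b4 := star_star_analyticAt (h₁.th'_differentiable x) z
  constructor
  · refine ⟨_, ((a2.mul b2).sub (a1.mul b4)).sub ((a1.mul hg).mul b2), ?_⟩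
    filter_upwards [e] with z hz
    simp only [transfer₁, hz, Pi.sub_apply, Pi.mul_apply]
  · refine ⟨_, ((a1.mul b3).sub (a2.mul b1)).add ((a1.mul hg).mul b1), ?_⟩
    filter_upwards [e] with z hz
    simp only [transfer₂, hz, Pi.sub_apply, Pi.mul_apply, Pi.add_apply]

lemma transfer_continuousAt (x : ℝ) {z : ℂ} (hu₁ : IsUnit (h₁.ph z 1))
    (hu₂ : IsUnit (h₂.ph z 1)) :
    ContinuousAt (h₁.transfer₁ h₂ x) z ∧ ContinuousAt (h₁.transfer₂ h₂ x) z := by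
  have hg := ((h₂.weyl_analyticAt hu₂).sub (h₁.weyl_analyticAt hu₁)).continuousAt
  have a1 := (h₂.ph_analyticAt x z).continuousAt
  have a2 := ((h₂.th_differentiable x).analyticAt z).continuousAt
  have b1 := (star_star_analyticAt (h₁.ph_differentiable x) z).continuousAt
  have b2 := (star_star_analyticAt (h₁.ph'_differentiable x) z).continuousAt
  have b3 := (star_star_analyticAt (h₁.th_differentiable x) z).continuousAt
  have b4 := (star_star_analyticAt (h₁.th'_differentiable x) z).continuousAt
  exact ⟨((a2.mul b2).sub (a1.mul b4)).sub ((a1.mul hg).mul b2),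
    ((a1.mul b3).sub (a2.mul b1)).add ((a1.mul hg).mul b1)⟩

variable [NeZero N]

lemma transfer_bound {w : ℂ} (hw₁ : h₁.bnd ≤ ‖w‖) (hw₂ : h₂.bnd ≤ ‖w‖)
    (hr₁ : h₁.reflect.bnd ≤ ‖w‖) (hr₂ : h₂.reflect.bnd ≤ ‖w‖) (hg : GoodPt w) {x : ℝ}
    (hx : x ∈ Icc (0 : ℝ) 1) :
    ‖h₁.transfer₁ h₂ x (w ^ 2)‖ ≤ 64 ∧ ‖h₁.transfer₂ h₂ x (w ^ 2)‖ ≤ 64 * ‖w‖⁻¹ := by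
  have hwp : 0 < ‖w‖ := by linarith [h₁.one_le_bnd]
  obtain ⟨s1, s2⟩ := h₁.star_psi hw₁ hg x
  -- The definition, through the difference of Weyl functions, shows analyticity. This form, through
  -- `psi`, shows boundedness: each product pairs `exp(|Im w| x)` with `exp(-|Im w| x)`.
  have e1 : h₁.transfer₁ h₂ x (w ^ 2) = h₂.psi (w ^ 2) x * star (h₁.ph' (star (w ^ 2)) x)
      - h₂.ph (w ^ 2) x * star (h₁.psi' (star (w ^ 2)) x) := by
    rw [s2, transfer₁, psi]; noncomm_ring
  have e2 : h₁.transfer₂ h₂ x (w ^ 2) = h₂.ph (w ^ 2) x * star (h₁.psi (star (w ^ 2)) x)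
      - h₂.psi (w ^ 2) x * star (h₁.ph (star (w ^ 2)) x) := by
    rw [s1, transfer₂, psi]; noncomm_ring
  have ns : ‖star w‖ = ‖w‖ := norm_star w
  have ni : |(star w).im| = |w.im| := by simp
  have c1 := h₁.norm_ph_le (w := star w) (by rwa [ns]) hx
  have c2 := h₁.norm_ph'_le (w := star w) (by rwa [ns]) hx
  obtain ⟨c3, c4⟩ := h₁.norm_psi_le (w := star w) (by rwa [ns]) (by rwa [ns]) (goodPt_star hg) hx
  have d1 := h₂.norm_ph_le hw₂ hx
  obtain ⟨d3, -⟩ := h₂.norm_psi_le hw₂ hr₂ hg hx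
  rw [← star_pow, ns, ni] at c1 c4
  rw [← star_pow, ni] at c2 c3
  have ee : Real.exp (|w.im| * x) * Real.exp (-(|w.im| * x)) = 1 := by
    rw [← Real.exp_add]; simp
  rw [e1, e2]
  constructor
  · calc _ ≤ ‖h₂.psi (w ^ 2) x‖ * ‖h₁.ph' (star (w ^ 2)) x‖
          + ‖h₂.ph (w ^ 2) x‖ * ‖h₁.psi' (star (w ^ 2)) x‖ := by
          refine (norm_sub_le _ _).trans (add_le_add ?_ ?_)
          · exact (norm_mul_le _ _).trans (by rw [norm_star])
          · exact (norm_mul_le _ _).trans (by rw [norm_star])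
      _ ≤ (16 * Real.exp (-(|w.im| * x))) * (2 * Real.exp (|w.im| * x))
          + (2 * ‖w‖⁻¹ * Real.exp (|w.im| * x)) * (16 * ‖w‖ * Real.exp (-(|w.im| * x))) := by
          gcongr
      _ = 32 * (Real.exp (|w.im| * x) * Real.exp (-(|w.im| * x)))
          + 32 * (‖w‖⁻¹ * ‖w‖) * (Real.exp (|w.im| * x) * Real.exp (-(|w.im| * x))) := by ring
      _ = 64 := by rw [ee, inv_mul_cancel₀ hwp.ne']; norm_num
  · calc _ ≤ ‖h₂.ph (w ^ 2) x‖ * ‖h₁.psi (star (w ^ 2)) x‖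
          + ‖h₂.psi (w ^ 2) x‖ * ‖h₁.ph (star (w ^ 2)) x‖ := by
          refine (norm_sub_le _ _).trans (add_le_add ?_ ?_)
          · exact (norm_mul_le _ _).trans (by rw [norm_star])
          · exact (norm_mul_le _ _).trans (by rw [norm_star])
      _ ≤ (2 * ‖w‖⁻¹ * Real.exp (|w.im| * x)) * (16 * Real.exp (-(|w.im| * x)))
          + (16 * Real.exp (-(|w.im| * x))) * (2 * ‖w‖⁻¹ * Real.exp (|w.im| * x)) := by
          gcongr
      _ = 64 * ‖w‖⁻¹ * (Real.exp (|w.im| * x) * Real.exp (-(|w.im| * x))) := by ring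
      _ = _ := by rw [ee, mul_one]

/-- Potentials with the same spectral data have proportional fundamental solutions. -/
lemma exists_ph_eq_mul (hdata : ∀ l, h₁.SameData h₂ l) {x : ℝ} (hx : x ∈ Icc (0 : ℝ) 1) :
    ∃ K : Mat N, ∀ z, h₂.ph z x = K * h₁.ph z x := by
  set R := max (max h₁.bnd h₂.bnd) (max h₁.reflect.bnd h₂.reflect.bnd)
  have hR : ∀ w : ℂ, R ≤ ‖w‖ → GoodPt w → IsUnit (h₁.ph (w ^ 2) 1) ∧ IsUnit (h₂.ph (w ^ 2) 1) ∧
      ‖h₁.transfer₁ h₂ x (w ^ 2)‖ ≤ 64 ∧ ‖h₁.transfer₂ h₂ x (w ^ 2)‖ ≤ 64 * ‖w‖⁻¹ := by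
    intro w hw hg
    have a1 : h₁.bnd ≤ ‖w‖ := ((le_max_left _ _).trans (le_max_left _ _)).trans hw
    have a2 : h₂.bnd ≤ ‖w‖ := ((le_max_right _ _).trans (le_max_left _ _)).trans hw
    have a3 : h₁.reflect.bnd ≤ ‖w‖ := ((le_max_left _ _).trans (le_max_right _ _)).trans hw
    have a4 : h₂.reflect.bnd ≤ ‖w‖ := ((le_max_right _ _).trans (le_max_right _ _)).trans hw
    exact ⟨(h₁.isUnit_of_goodPt a1 hg).1, (h₂.isUnit_of_goodPt a2 hg).1,
      h₁.transfer_bound h₂ a1 a2 a3 a4 hg hx⟩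
  obtain ⟨K, hK⟩ := exists_const_of_bounded_on_goodPt
    (fun z => (h₁.transfer_extends h₂ hdata x z).1) (R := R) (C := 64) fun w hw hg =>
      ⟨(h₁.transfer_continuousAt h₂ x (hR w hw hg).1 (hR w hw hg).2.1).1, (hR w hw hg).2.2.1⟩
  obtain ⟨L, hL⟩ := exists_const_of_bounded_on_goodPt
    (fun z => (h₁.transfer_extends h₂ hdata x z).2) (R := R) (C := 64) fun w hw hg =>
      ⟨(h₁.transfer_continuousAt h₂ x (hR w hw hg).1 (hR w hw hg).2.1).2,
        (hR w hw hg).2.2.2.trans (mul_le_of_le_one_right (by norm_num)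
          (inv_le_one_of_one_le₀ (h₁.one_le_bnd.trans
            (((le_max_left _ _).trans (le_max_left _ _)).trans hw))))⟩
  have hL0 : L = 0 := eq_zero_of_le_div (C := 64) (R := R) fun w hw hg => by
    obtain ⟨u1, u2, -, b⟩ := hR w hw hg
    rwa [hL _ (h₁.transfer_continuousAt h₂ x u1 u2).2] at b
  refine ⟨K, fun z => ?_⟩
  have hdense : Dense {z : ℂ | z.im ≠ 0} := by
    have : Dense (Complex.im ⁻¹' {0}ᶜ) :=
      (dense_compl_singleton (0 : ℝ)).preimage Complex.isOpenMap_im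
    exact this
  have hc1 : Continuous fun z => h₂.ph z x := (h₂.ph_differentiable x).continuous
  have hc2 : Continuous fun z => K * h₁.ph z x :=
    continuous_const.mul (h₁.ph_differentiable x).continuous
  refine congrFun (Continuous.ext_on hdense hc1 hc2 fun z hz => ?_) z
  obtain ⟨c1, c2⟩ := h₁.transfer_continuousAt h₂ x
    (h₁.ph_isUnit_of_im_ne_zero hz zero_lt_one le_rfl)
    (h₂.ph_isUnit_of_im_ne_zero hz zero_lt_one le_rfl)
  have e := h₁.transfer_eq h₂ hx z
  rw [hK z c1, hL z c2, hL0, zero_mul, add_zero] at e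
  exact e

/-- The factor `K` does not depend on `z`. Along `w = iy` both solutions are asymptotic to
`sin(wx)/w`, which gives `‖K - 1‖ y ≤ 4c` for all large `y`. -/
lemma ph_eq_of_sameData (hdata : ∀ l, h₁.SameData h₂ l) {x : ℝ} (hx0 : 0 < x) (hx1 : x ≤ 1)
    (z : ℂ) : h₂.ph z x = h₁.ph z x := by
  have hx : x ∈ Icc (0 : ℝ) 1 := ⟨hx0.le, hx1⟩
  obtain ⟨K, hK⟩ := h₁.exists_ph_eq_mul h₂ hdata hx
  suffices hK1 : K - 1 = 0 by rw [hK, sub_eq_zero.1 hK1, one_mul]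
  -- The term `x⁻¹` ensures `|Im(wx)| ≥ 1`, so that `wx` is a good point.
  set R := max (max h₁.bnd h₂.bnd) x⁻¹
  by_contra hne
  have hKp : 0 < ‖K - 1‖ := norm_pos_iff.2 hne
  set c := (h₁.bnd + h₂.bnd) * (1 + ‖K - 1‖)
  have b1 := h₁.one_le_bnd
  have b2 := h₂.one_le_bnd
  have key : ∀ y : ℝ, R ≤ y → ‖K - 1‖ * y ≤ 4 * c := by
    intro y hy
    have hy1 : h₁.bnd ≤ y := ((le_max_left _ _).trans (le_max_left _ _)).trans hy
    have hy2 : h₂.bnd ≤ y := ((le_max_right _ _).trans (le_max_left _ _)).trans hy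
    have hy3 : x⁻¹ ≤ y := (le_max_right _ _).trans hy
    have hyp : 0 < y := by linarith
    set w : ℂ := y * Complex.I
    have nw : ‖w‖ = y := by simp [w, abs_of_pos hyp]
    have iw : |w.im| = y := by simp [w, abs_of_pos hyp]
    have hw0 : w ≠ 0 := norm_pos_iff.1 (by rw [nw]; exact hyp)
    have a1 := h₁.norm_ph_sub_le h₂ (w := w) (by rwa [nw]) (by rwa [nw]) hx
    have a2 := (h₁.ph_isSol (w ^ 2)).norm_sub_sin_le h₁.int hw0
      (by rw [nw]; exact h₁.two_mul_le_bnd.trans hy1) (h₁.ph_zero _) (h₁.ph'_zero _) hx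
    rw [nw, iw] at a1 a2
    have a3 : Real.exp (y * x) / 4 ≤ ‖Complex.sin (w * x)‖ := by
      have hi : |(w * (x : ℂ)).im| = y * x := by rw [abs_im_mul_ofReal w hx0.le, iw]
      have := goodPt_of_one_le_im (w := w * x) (by
        rw [hi]
        calc (1 : ℝ) = x⁻¹ * x := (inv_mul_cancel₀ hx0.ne').symm
          _ ≤ y * x := by gcongr)
      rwa [GoodPt, hi] at this
    have e : (K - 1) * ((Complex.sin (w * x) / w) • (1 : Mat N))
        = (h₂.ph (w ^ 2) x - h₁.ph (w ^ 2) x)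
          - (K - 1) * (h₁.ph (w ^ 2) x - (Complex.sin (w * x) / w) • (1 : Mat N)) := by
      rw [hK]; noncomm_ring
    have n1 : ‖K - 1‖ * (‖Complex.sin (w * x)‖ * y⁻¹) ≤
        (h₁.bnd + h₂.bnd) * y⁻¹ ^ 2 * Real.exp (y * x)
          + ‖K - 1‖ * ((h₁.bnd + h₂.bnd) * y⁻¹ ^ 2 * Real.exp (y * x)) := by
      calc _ = ‖(K - 1) * ((Complex.sin (w * x) / w) • (1 : Mat N))‖ := by
            rw [mul_smul_comm, mul_one, norm_smul, norm_div, nw]; ring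
        _ ≤ _ := by
            rw [e]
            refine (norm_sub_le _ _).trans (add_le_add a1 ((norm_mul_le _ _).trans ?_))
            gcongr
            refine a2.trans ?_
            gcongr
            linarith [h₁.two_mul_le_bnd]
    have hE := Real.exp_pos (y * x)
    have n2 : ‖K - 1‖ * (Real.exp (y * x) / 4 * y⁻¹) ≤
        (h₁.bnd + h₂.bnd) * y⁻¹ ^ 2 * Real.exp (y * x) * (1 + ‖K - 1‖) := by
      refine le_trans ?_ (n1.trans (le_of_eq (by ring)))
      gcongr
    have n3 := mul_le_mul_of_nonneg_left n2 (show 0 ≤ 4 * y ^ 2 * (Real.exp (y * x))⁻¹ by positivity)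
    calc ‖K - 1‖ * y = 4 * y ^ 2 * (Real.exp (y * x))⁻¹
          * (‖K - 1‖ * (Real.exp (y * x) / 4 * y⁻¹)) := by field_simp
      _ ≤ _ := n3
      _ = 4 * c := by simp only [c]; field_simp
  have k1 := key (max R (4 * c / ‖K - 1‖ + 1)) (le_max_left _ _)
  have k2 : 4 * c / ‖K - 1‖ + 1 ≤ max R (4 * c / ‖K - 1‖ + 1) := le_max_right _ _
  have k3 : ‖K - 1‖ * (4 * c / ‖K - 1‖ + 1) = 4 * c + ‖K - 1‖ := by field_simp
  have k4 := mul_le_mul_of_nonneg_left k2 hKp.le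
  linarith

/-- A potential is determined by its spectral data. -/
theorem ae_eq_of_sameData (hdata : ∀ l, h₁.SameData h₂ l) :
    ∀ᵐ t, t ∈ Ioo (0 : ℝ) 1 → Q₂ t = Q₁ t := by
  have s1 := h₁.ph_isSol Complex.I
  have s2 := h₂.ph_isSol Complex.I
  have e0 : ∀ t ∈ Ioo (0 : ℝ) 1, h₂.ph Complex.I t = h₁.ph Complex.I t := fun t ht =>
    h₁.ph_eq_of_sameData h₂ hdata ht.1 ht.2.le _
  have e1 : ∀ t ∈ Ioo (0 : ℝ) 1, h₂.ph' Complex.I t = h₁.ph' Complex.I t := fun t ht => by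
    refine (s2.d1.hasDerivAt s2.d2.continuousOn ht).unique
      ((s1.d1.hasDerivAt s1.d2.continuousOn ht).congr_of_eventuallyEq ?_)
    filter_upwards [Ioo_mem_nhds ht.1 ht.2] with s hs using e0 s hs
  filter_upwards [s2.d2.ae_eq s1.d2 e1] with t ht ht1
  have e2 := ht ht1
  rw [e0 t ht1] at e2
  -- The spectral parameter was taken nonreal so that `φ` is invertible at every interior point and
  -- cancels from `Q₂ φ = Q₁ φ`.
  have hu := h₁.ph_isUnit_of_im_ne_zero (l := Complex.I) (by simp) ht1.1 ht1.2.le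
  exact hu.mul_right_cancel (sub_left_inj.1 e2)

end SAPot
end MatrixSL

end

/-! ### Double commutation -/

noncomputable section

namespace MatrixSL

section Commutation

variable {N : ℕ} {Q φ φ' R T Y Y' : ℝ → Mat N}

/-- The potential obtained from `Q` by the double commutation with kernel `R`. -/
def commutedPot (Q φ φ' R : ℝ → Mat N) (t : ℝ) : Mat N :=
  Q t - (2 : ℂ) • (φ' t * R t * star (φ t) - φ t * R t * star (φ t) * φ t * R t * star (φ t)
    + φ t * R t * star (φ' t))

/-- The double commutation of a solution. -/
def commuted (φ R T Y : ℝ → Mat N) (t : ℝ) : Mat N := Y t - φ t * R t * T t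

/-- The derivative of `commuted`. -/
def commuted' (φ φ' R T Y Y' : ℝ → Mat N) (t : ℝ) : Mat N :=
  Y' t - (φ' t * R t - φ t * R t * star (φ t) * φ t * R t) * T t
    - φ t * R t * star (φ t) * Y t

lemma star_commutedPot {t : ℝ} (hQ : star (Q t) = Q t) (hR : star (R t) = R t) :
    star (commutedPot Q φ φ' R t) = commutedPot Q φ φ' R t := by
  simp only [commutedPot, star_sub, star_add, star_smul, star_mul, star_star, hQ, hR,
    RCLike.star_def, map_ofNat, mul_assoc]
  congr 2
  abel

lemma intervalIntegrable_commutedPot (hQ : IntervalIntegrable Q volume 0 1)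
    (h : ContinuousOn φ (Icc 0 1)) (h' : ContinuousOn φ' (Icc 0 1))
    (hR : ContinuousOn R (Icc 0 1)) :
    IntervalIntegrable (commutedPot Q φ φ' R) volume 0 1 := by
  refine hQ.sub (ContinuousOn.intervalIntegrable ?_)
  rw [uIcc_of_le zero_le_one]
  exact ((((h'.mul hR).mul h.star).sub (((((h.mul hR).mul h.star).mul h).mul hR).mul h.star)).add
    ((h.mul hR).mul h'.star)).const_smul (2 : ℂ)

/-- The Riccati equation for `R` identifies `commutedPot` with `Q - 2(φRφ*)'`. Once the two
Wronskian relations are substituted, the equation for the new solution is an identity between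
noncommutative polynomials. -/
lemma IsSol.commuted {l₀ l : ℂ} (h : IsSol Q l₀ φ φ') (k : IsSol Q l Y Y')
    (hw : ∀ x ∈ Icc (0 : ℝ) 1, star (φ x) * φ' x = star (φ' x) * φ x)
    (hR : HasACDeriv R (fun x => -(R x * (star (φ x) * φ x) * R x)))
    (hT : HasACDeriv T (fun x => star (φ x) * Y x))
    (hTw : ∀ x ∈ Icc (0 : ℝ) 1,
      star (φ' x) * Y x - star (φ x) * Y' x = (l - l₀) • T x) :
    IsSol (commutedPot Q φ φ' R) l (commuted φ R T Y) (commuted' φ φ' R T Y Y') := by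
  constructor
  · refine (k.d1.sub ((h.d1.mul hR).mul hT)).congr (fun _ _ => rfl)
      (Filter.Eventually.of_forall fun t _ => ?_)
    simp only [commuted']
    noncomm_ring
  · have hk := h.d1.mul hR
    refine ((k.d2.sub (((h.d2.mul hR).sub (((hk.mul h.d1.star).mul h.d1).mul hR)).mul hT)).sub
      ((hk.mul h.d1.star).mul k.d1)).congr (fun _ _ => rfl)
      (Filter.Eventually.of_forall fun t ht => ?_)
    have ht' := Ioo_subset_Icc_self ht
    have e1 := hw t ht'
    -- The parameter `l` multiplying `T` is traded for `l₀`, which matches the term coming from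
    -- `φ''`.
    have e2 : l • T t = l₀ • T t + (star (φ' t) * Y t - star (φ t) * Y' t) := by
      rw [hTw t ht', sub_smul]; abel
    simp only [commutedPot, MatrixSL.commuted]
    generalize hp : star (φ t) = p at *
    generalize hp' : star (φ' t) = p' at *
    generalize φ t = f at *
    generalize φ' t = f' at *
    generalize R t = r at *
    generalize T t = s at *
    generalize Y t = y at *
    generalize Y' t = y' at *
    generalize Q t = q at *
    rw [smul_sub l y, ← mul_smul_comm l, e2]
    simp only [sub_mul, mul_sub, add_mul, mul_add, smul_mul_assoc, mul_smul_comm, two_smul,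
      mul_neg, neg_mul, mul_assoc]
    have e3 : ∀ z, p * (f' * z) = p' * (f * z) := fun z => by rw [← mul_assoc, e1, mul_assoc]
    simp only [e3]
    abel

/-- The Gram matrix of a double commutation. -/
lemma integral_commuted (hRh : ∀ x ∈ Icc (0 : ℝ) 1, star (R x) = R x)
    (hR : HasACDeriv R (fun x => -(R x * (star (φ x) * φ x) * R x)))
    (hT : HasACDeriv T (fun x => star (φ x) * Y x)) (hT0 : T 0 = 0)
    (hY : ContinuousOn Y (Icc 0 1)) :
    ∫ t in (0 : ℝ)..1, star (commuted φ R T Y t) * commuted φ R T Y t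
      = (∫ t in (0 : ℝ)..1, star (Y t) * Y t) - star (T 1) * R 1 * T 1 := by
  have h1 : HasACDeriv (fun x => 0 + ∫ t in (0 : ℝ)..x, star (Y t) * Y t)
      (fun t => star (Y t) * Y t) := HasACDeriv.of_continuousOn 0 (hY.star.mul hY)
  -- The integrand equals `Y*Y` minus the derivative of `T* R T`.
  have h2 := (h1.sub ((hT.star.mul hR).mul hT)).congr
    (g' := fun t => star (commuted φ R T Y t) * commuted φ R T Y t) (fun _ _ => rfl)
    (Filter.Eventually.of_forall fun t ht => by
      simp only [commuted, star_sub, star_mul, star_star, hRh t (Ioo_subset_Icc_self ht)]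
      noncomm_ring)
  have h3 := h2.eq 1 (by simp)
  simp only [intervalIntegral.integral_same, hT0, mul_zero, sub_zero, zero_add] at h3
  rw [← h3]

end Commutation

section PseudoInverse

open scoped ComplexOrder MatrixOrder

variable {N : ℕ}

/-- The inverse of a positive operator in the range of a projector. -/
lemma exists_pseudoInverse {P G : Mat N} (hP : star P = P) (hPP : P * P = P) (hG : star G = G)
    (hPG : P * G = G) (hinj : ∀ X, G * X = 0 → P * X = 0) (hpos : 0 ≤ G) :
    ∃ A : Mat N, star A = A ∧ 0 ≤ A ∧ P * A = A ∧ A * P = A ∧ A * G = P ∧ G * A = P := by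
  have hGP : G * P = G := by
    have := congrArg star hPG
    rwa [star_mul, hP, hG] at this
  -- This matrix is `G` on the range of `P` and the identity on the complement; its inverse cut down
  -- by `P` is the required `A`.
  have hu : IsUnit (G + 1 - P) := by
    refine isUnit_of_forall_mul_eq_zero fun X hX => ?_
    have e1 : G * X = 0 := by
      have := congrArg (P * ·) hX
      simp only [mul_zero, ← mul_assoc] at this
      rwa [show P * (G + 1 - P) = G by rw [mul_sub, mul_add, hPG, hPP, mul_one]; abel] at this
    have e2 := hinj X e1
    rw [sub_mul, add_mul, e1, e2] at hX
    simpa using hX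
  obtain ⟨u, hu⟩ := hu
  have c1 : (u : Mat N) * P = G := by rw [hu, sub_mul, add_mul, hGP, hPP, one_mul]; abel
  have c2 : P * (u : Mat N) = G := by rw [hu, mul_sub, mul_add, hPG, hPP, mul_one]; abel
  have hc : (↑u⁻¹ : Mat N) * P = P * (↑u⁻¹ : Mat N) := by
    rw [Units.inv_mul_eq_iff_eq_mul, ← mul_assoc, c1, ← c2, mul_assoc, Units.mul_inv, mul_one]
  have hA : (↑u⁻¹ : Mat N) * P * G = P := by
    rw [mul_assoc, hPG, ← c1, Units.inv_mul_cancel_left]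
  have hA' : G * ((↑u⁻¹ : Mat N) * P) = P := by
    rw [hc, ← mul_assoc, hGP, ← c2, mul_assoc, Units.mul_inv, mul_one]
  have hPA : P * ((↑u⁻¹ : Mat N) * P) = (↑u⁻¹ : Mat N) * P := by rw [← mul_assoc, ← hc, mul_assoc, hPP]
  have hAP : ((↑u⁻¹ : Mat N) * P) * P = (↑u⁻¹ : Mat N) * P := by rw [mul_assoc, hPP]
  generalize (↑u⁻¹ : Mat N) * P = A at *
  have hsA : star A = A := by
    have e1 : star A * G = P := by
      have := congrArg star hA'
      rwa [star_mul, hG, hP] at this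
    have e2 : star A * P = star A := by
      have := congrArg star hPA
      rwa [star_mul, hP] at this
    calc star A = star A * G * A := by rw [mul_assoc, hA', e2]
      _ = A := by rw [e1, hPA]
  refine ⟨A, hsA, ?_, hPA, hAP, hA, hA'⟩
  have := star_left_conjugate_nonneg hpos A
  rwa [hsA, hA, hPA] at this

end PseudoInverse

end MatrixSL

end

/-! ### Prescribing the data at one eigenvalue -/

noncomputable section

namespace MatrixSL

variable {N : ℕ} {Q : ℝ → Mat N} (h : SAPot Q)

namespace SAPot

open scoped ComplexOrder MatrixOrder

/-- The incomplete Gram matrix `∫₀ˣ φ(t, l)* φ(t, m) dt`. -/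
def cross (l m : ℂ) (x : ℝ) : Mat N := ∫ t in (0 : ℝ)..x, star (h.ph l t) * h.ph m t

lemma cross_hasACDeriv (l m : ℂ) :
    HasACDeriv (h.cross l m) (fun t => star (h.ph l t) * h.ph m t) := by
  have hc : ContinuousOn (fun t => star (h.ph l t) * h.ph m t) (Icc 0 1) :=
    ((h.ph_continuous l).star.mul (h.ph_continuous m)).continuousOn
  exact (HasACDeriv.of_continuousOn 0 hc).congr (fun x _ => zero_add _) (.of_forall fun _ _ => rfl)

@[simp] lemma cross_zero (l m : ℂ) : h.cross l m 0 = 0 := intervalIntegral.integral_same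

lemma star_cross_self (l : ℂ) (x : ℝ) : star (h.cross l l x) = h.cross l l x := star_gram _ _ _

lemma wronskian_cross (l₀ : ℝ) (l : ℂ) {x : ℝ} (hx : x ∈ Icc (0 : ℝ) 1) :
    star (h.ph' l₀ x) * h.ph l x - star (h.ph l₀ x) * h.ph' l x
      = (l - l₀) • h.cross l₀ l x := by
  have := (h.ph_isSol l₀).wronskian_eq h.herm (h.ph_isSol l) hx
  simp only [ph_zero, ph'_zero, star_zero, mul_zero, zero_mul, sub_zero, zero_add,
    RCLike.star_def, Complex.conj_ofReal] at this
  exact this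

/-- The invertibility that makes a double commutation regular. -/
lemma isUnit_one_add_mul_cross {l₀ : ℝ} {P P' A A' G : Mat N}
    (hAs : star A = A) (hPA : P * A = A) (hASA : A * h.gram l₀ * A = A)
    (hA's : star A' = A') (hA'0 : 0 ≤ A') (hGA' : G * A' = P')
    (hinj : ∀ X, P' * h.gram l₀ * P * X = 0 → P * X = 0)
    {x : ℝ} (hx : x ∈ Icc (0 : ℝ) 1) : IsUnit (1 + (A' - A) * h.cross l₀ l₀ x) := by
  refine isUnit_of_forall_mul_eq_zero fun X hX => ?_
  rcases hx.1.eq_or_lt with rfl | hx0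
  · simpa using hX
  set s := h.cross l₀ l₀ x with hs
  set u := s * X with hu
  have hss : star s = s := h.star_cross_self l₀ x
  have hus : star X * s = star u := by rw [hu, star_mul, hss]
  have hX1 : X - A * u = -(A' * u) := by
    have : X + A' * u - A * u = 0 := by rw [← hX, hu]; noncomm_ring
    rw [eq_neg_iff_add_eq_zero, ← this]; abel
  have hc : Continuous (h.ph l₀) := h.ph_continuous l₀
  have hsplit : h.gram l₀ - s = ∫ t in x..1, star (h.ph l₀ t) * h.ph l₀ t := by
    have hi : ∀ a b, IntervalIntegrable (fun t => star (h.ph l₀ t) * h.ph l₀ t) volume a b :=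
      (hc.star.mul hc).intervalIntegrable
    rw [gram, hs, cross, ← intervalIntegral.integral_add_adjacent_intervals (hi 0 x) (hi x 1)]
    abel
  have p1 : 0 ≤ star (X - A * u) * s * (X - A * u) :=
    star_left_conjugate_nonneg (gram_posSemidef hx.1 hc.continuousOn) _
  have p2 : 0 ≤ star u * A' * u := star_left_conjugate_nonneg hA'0 _
  have p3 : 0 ≤ star (A * u) * (h.gram l₀ - s) * (A * u) := by
    rw [hsplit]
    exact star_left_conjugate_nonneg (gram_posSemidef hx.2 hc.continuousOn) _
  -- From `X - A u = -A' u` and `A S A = A`, three nonnegative forms add up to zero, so each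
  -- vanishes. Positivity of `s` for `x > 0` gives `X = A u`, and positivity of `S - s` for `x < 1`
  -- gives `A u = 0`.
  have hsum : star (X - A * u) * s * (X - A * u) + star u * A' * u
      + star (A * u) * (h.gram l₀ - s) * (A * u) = 0 := by
    have e1 : star (A * u) * h.gram l₀ * (A * u) = star u * A * u := by
      rw [star_mul, hAs]
      calc _ = star u * (A * h.gram l₀ * A) * u := by noncomm_ring
        _ = _ := by rw [hASA]
    have e2 : star (X - A * u) * u = - (star u * A' * u) := by
      rw [hX1, star_neg, star_mul, hA's, neg_mul]
    have e3 : star (X - A * u) * s * (X - A * u) = star (X - A * u) * u - star u * A * u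
        + star (A * u) * s * (A * u) := by
      have : star (X - A * u) * s * (X - A * u) = star (X - A * u) * (s * X)
          - (star X * s) * (A * u) + star (A * u) * s * (A * u) := by
        rw [star_sub]; noncomm_ring
      rw [this, hus, ← hu, mul_assoc (star u)]
    rw [e3, e2, mul_sub, sub_mul, e1]
    abel
  have q3 := (add_eq_zero_iff_of_nonneg (add_nonneg p1 p2) p3).1 hsum
  have q1 := ((add_eq_zero_iff_of_nonneg p1 p2).1 q3.1).1
  have z1 : X - A * u = 0 := h.eq_zero_of_gram le_rfl hx0 hx.2 q1
  have z1' := sub_eq_zero.1 z1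
  rw [z1']
  rcases hx.2.eq_or_lt with hx1 | hx1
  -- At the right end `S - s` is zero and gives nothing. Here `A' u = 0` reads `P' S P (A u) = 0`,
  -- and nondegeneracy of the pairing takes over.
  · rw [← hPA, mul_assoc]
    apply hinj
    have z2 : A' * u = 0 := by rw [hX1] at z1; exact neg_eq_zero.1 z1
    have z3 : s = h.gram l₀ := by rw [hs, hx1]; rfl
    calc _ = G * (A' * (h.gram l₀ * (P * A * u))) := by rw [← hGA']; noncomm_ring
      _ = 0 := by rw [hPA, ← z1', ← z3, ← hu, z2, mul_zero]
  · rw [hsplit] at q3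
    exact h.eq_zero_of_gram hx.1 hx1 le_rfl q3.2

end SAPot

lemma IsKerProj.of_unit_mul {M M' W W' P : Mat N} (hP : IsKerProj M P) (hM : M' = W * M)
    (hW : W' * W = 1) : IsKerProj M' P where
  herm := hP.herm
  mul_self := hP.mul_self
  ker := by rw [hM, mul_assoc, hP.ker, mul_zero]
  eq X hX := hP.eq X (by
    rw [hM, mul_assoc] at hX
    have := congrArg (W' * ·) hX
    simpa only [← mul_assoc, hW, one_mul, mul_zero] using this)

lemma isKerProj_exists (M : Mat N) : ∃ P, IsKerProj M P := ⟨_, isKerProj_projM M⟩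

namespace SAPot

open scoped ComplexOrder MatrixOrder

/-- The spectral data at one point can be prescribed, the others being kept. -/
theorem exists_commuted {l₀ : ℝ} {P P' G Z : Mat N} (hP : IsKerProj (h.ph l₀ 1) P)
    (hP's : star P' = P') (hP'P' : P' * P' = P') (hG : star G = G) (hPG : P' * G = G)
    (hG0 : 0 ≤ G) (hGinj : ∀ X, G * X = 0 → P' * X = 0)
    (hZ1 : Z * (P * h.gram l₀ * P') = P') (hZ2 : P * h.gram l₀ * P' * Z = P) :
    ∃ (Q' : ℝ → Mat N) (h' : SAPot Q'), (∀ l : ℝ, l ≠ l₀ → h.SameData h' l) ∧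
      IsKerProj (h'.ph l₀ 1) P' ∧ P' * h'.gram l₀ * P' = G := by
  set S := h.gram l₀ with hS
  have hSs : star S = S := h.star_cross_self l₀ 1
  have hY1 : P' * S * P * star Z = P' := by
    have := congrArg star hZ1
    simpa only [star_mul, hP's, hP.herm, hSs, mul_assoc] using this
  have hY2 : star Z * (P' * S * P) = P := by
    have := congrArg star hZ2
    simpa only [star_mul, hP's, hP.herm, hSs, mul_assoc] using this
  obtain ⟨A, hAs, -, hPA, hAP, hAS, -⟩ := exists_pseudoInverse (G := P * S * P) hP.herm hP.mul_self
    (by simp only [star_mul, hP.herm, hSs, mul_assoc])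
    (by rw [← mul_assoc, ← mul_assoc, hP.mul_self]) (fun X hX => h.proj_mul_eq_zero hP hX)
    (by
      have := star_left_conjugate_nonneg
        (gram_posSemidef zero_le_one (h.ph_continuous l₀).continuousOn) P
      rwa [hP.herm] at this)
  obtain ⟨A', hA's, hA'0, hPA', hAP', hA'G, hGA'⟩ :=
    exists_pseudoInverse hP's hP'P' hG hPG hGinj hG0
  have hASP : A * S * P = P := by
    calc A * S * P = A * P * S * P := by rw [hAP]
      _ = A * (P * S * P) := by noncomm_ring
      _ = P := hAS
  have hASA : A * S * A = A := by
    calc A * S * A = A * S * P * A := by rw [mul_assoc _ P, hPA]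
      _ = A := by rw [hASP, hPA]
  -- Subtracting `A` removes the old norming operator at `l₀`, and adding `A'` installs the new one.
  set B := A' - A with hB
  have hBs : star B = B := by rw [hB, star_sub, hAs, hA's]
  set s := h.cross l₀ l₀ with hs
  have hss : ∀ x, star (s x) = s x := h.star_cross_self l₀
  have hunit : ∀ x ∈ Icc (0 : ℝ) 1, IsUnit (1 + B * s x) := fun x hx =>
    h.isUnit_one_add_mul_cross hAs hPA hASA hA's hA'0 hGA' (fun X hX => by
      rw [← hY2, mul_assoc, hX, mul_zero]) hx
  set D : ℝ → Mat N := fun x => Ring.inverse (1 + B * s x) with hD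
  have hD1 : ∀ x ∈ Icc (0 : ℝ) 1, D x * (1 + B * s x) = 1 := fun x hx =>
    Ring.inverse_mul_cancel _ (hunit x hx)
  have hD2 : ∀ x ∈ Icc (0 : ℝ) 1, (1 + B * s x) * D x = 1 := fun x hx =>
    Ring.mul_inverse_cancel _ (hunit x hx)
  have hsd := h.cross_hasACDeriv l₀ l₀
  have hUd : HasACDeriv (fun x => 1 + B * s x) (fun x => B * (star (h.ph l₀ x) * h.ph l₀ x)) :=
    ((HasACDeriv.const 1).add (hsd.const_mul B)).congr (fun _ _ => rfl)
      (.of_forall fun _ _ => zero_add _)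
  set R : ℝ → Mat N := fun x => D x * B with hR
  have hRd : HasACDeriv R (fun x => -(R x * (star (h.ph l₀ x) * h.ph l₀ x) * R x)) :=
    ((hUd.inv hD1 hD2).mul_const B).congr (fun _ _ => rfl) (.of_forall fun x _ => by
      simp only [hR]; noncomm_ring)
  have hRs : ∀ x ∈ Icc (0 : ℝ) 1, star (R x) = R x := fun x hx => by
    have e2 : (1 + s x * B) * star (D x) = 1 := by
      have := congrArg star (hD1 x hx)
      simpa only [star_mul, star_add, star_one, hss, hBs] using this
    calc star (R x) = D x * (1 + B * s x) * (B * star (D x)) := by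
          rw [hD1 x hx, one_mul]; simp only [hR, star_mul, hBs]
      _ = D x * B * ((1 + s x * B) * star (D x)) := by noncomm_ring
      _ = R x := by rw [e2, mul_one]
  have hφ := h.ph_isSol l₀
  let Q' := commutedPot Q (h.ph l₀) (h.ph' l₀) R
  have h' : SAPot Q' := ⟨intervalIntegrable_commutedPot h.int hφ.d1.continuousOn
    hφ.d2.continuousOn hRd.continuousOn, by
      filter_upwards [h.herm] with t ht ht1
      exact star_commutedPot (ht ht1) (hRs t (Ioo_subset_Icc_self ht1))⟩
  have hreal : star (l₀ : ℂ) = l₀ := by simp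
  have hsol : ∀ l : ℂ, ∀ x ∈ Icc (0 : ℝ) 1,
      h'.ph l x = commuted (h.ph l₀) R (h.cross l₀ l) (h.ph l) x := fun l x hx => by
    have k := hφ.commuted (h.ph_isSol l) (fun x hx => by
      have := h.ph_wronskian hx l₀
      rw [hreal] at this
      exact this.symm) hRd (h.cross_hasACDeriv l₀ l) (fun x hx => h.wronskian_cross l₀ l hx)
    exact ((h'.ph_isSol l).unique h'.int k (by simp [commuted]) (by simp [commuted']) hx).1
  have hgram : ∀ l : ℂ, h'.gram l = h.gram l
      - star (h.cross l₀ l 1) * R 1 * h.cross l₀ l 1 := fun l => by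
    rw [gram, gram, ← integral_commuted hRs hRd (h.cross_hasACDeriv l₀ l) (h.cross_zero _ _)
      (h.ph_continuous l).continuousOn]
    refine intervalIntegral.integral_congr fun t ht => ?_
    rw [uIcc_of_le zero_le_one] at ht
    simp only [hsol l t ht]
  have h1 : (1 : ℝ) ∈ Icc (0 : ℝ) 1 := by simp
  have hs1 : s 1 = S := rfl
  have hUP : (1 + B * s 1) * P = A' * S * P := by
    calc _ = P + A' * S * P - A * S * P := by rw [hs1, hB]; noncomm_ring
      _ = _ := by rw [hASP]; abel
  -- The matrix `D(1)` carries the range of `P'` into that of `P`. As the new solution at `1` is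
  -- `φ(1,l₀) D(1)`, this puts the range of `P'` into its kernel.
  have hDP' : D 1 * P' = P * star Z * G := by
    have : (1 + B * s 1) * (P * star Z * G) = P' := by
      calc _ = (1 + B * s 1) * P * star Z * G := by noncomm_ring
        _ = A' * (P' * S * P * star Z) * G := by
          rw [hUP, ← hAP']
          simp only [mul_assoc]
          rw [← mul_assoc P' P', hP'P']
        _ = P' := by rw [hY1, hAP', hA'G]
    rw [← this, ← mul_assoc, hD1 1 h1, one_mul]
  have hφDP' : h.ph l₀ 1 * D 1 * P' = 0 := by
    rw [mul_assoc, hDP', ← mul_assoc, ← mul_assoc, hP.ker]; simp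
  -- This vanishing boundary term is what keeps the data at the other spectral points unchanged.
  have hφRφ : h.ph l₀ 1 * R 1 * star (h.ph l₀ 1) = 0 := by
    have e1 : A * star (h.ph l₀ 1) = 0 := by
      rw [← hAP, mul_assoc, h.proj_mul_star_ph hP, mul_zero]
    calc _ = h.ph l₀ 1 * D 1 * (A' * star (h.ph l₀ 1) - A * star (h.ph l₀ 1)) := by
          simp only [hR, hB]; noncomm_ring
      _ = h.ph l₀ 1 * D 1 * P' * (A' * star (h.ph l₀ 1)) := by
          rw [e1, sub_zero, mul_assoc _ P', ← mul_assoc P', hPA']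
      _ = 0 := by rw [hφDP', zero_mul]
  have hRS : 1 - R 1 * S = D 1 := by
    have := hD1 1 h1
    rw [mul_add, mul_one, ← mul_assoc, hs1] at this
    rw [← this]; simp only [hR]; abel
  clear_value R
  refine ⟨Q', h', fun l hl => ?_, ?_, ?_⟩
  · obtain ⟨Pl, hPl⟩ := isKerProj_exists (h.ph l 1)
    have hl' : (l : ℂ) - l₀ ≠ 0 := sub_ne_zero.2 (by exact_mod_cast hl)
    set c := ((l : ℂ) - l₀)⁻¹
    have hT : h.cross l₀ l 1
        = c • (star (h.ph' l₀ 1) * h.ph l 1 - star (h.ph l₀ 1) * h.ph' l 1) := by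
      rw [h.wronskian_cross l₀ l h1, smul_smul, inv_mul_cancel₀ hl', one_smul]
    set C := h.ph l₀ 1 * R 1 * star (h.ph' l₀ 1) with hC
    -- Nilpotency makes `1 - cC` invertible with inverse `1 + cC`, so `φ(1,l)` is only multiplied
    -- from the left by a unit and keeps its kernel.
    have hCC : C * C = 0 := by
      have hw := h.ph_wronskian h1 l₀
      rw [hreal] at hw
      calc C * C = h.ph l₀ 1 * R 1 * (star (h.ph' l₀ 1) * h.ph l₀ 1) * R 1 * star (h.ph' l₀ 1) := by
            rw [hC]; noncomm_ring
        _ = (h.ph l₀ 1 * R 1 * star (h.ph l₀ 1)) * h.ph' l₀ 1 * R 1 * star (h.ph' l₀ 1) := by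
            rw [hw]; noncomm_ring
        _ = 0 := by rw [hφRφ]; simp
    have hM : h'.ph l 1 = (1 - c • C) * h.ph l 1 := by
      have : h.ph l₀ 1 * R 1 * h.cross l₀ l 1 = c • (C * h.ph l 1) := by
        rw [hT, mul_smul_comm, mul_sub, ← mul_assoc, ← mul_assoc, hφRφ, zero_mul, sub_zero]
      rw [hsol l 1 h1, commuted, this, sub_mul, one_mul, smul_mul_assoc]
    refine ⟨Pl, hPl, hPl.of_unit_mul (W' := 1 + c • C) hM ?_, ?_⟩
    · rw [add_mul, mul_sub, one_mul, one_mul, mul_sub, mul_one, smul_mul_smul_comm, hCC]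
      simp
    · have hTP : h.cross l₀ l 1 * Pl = - (c • (star (h.ph l₀ 1) * (h.ph' l 1 * Pl))) := by
        rw [hT, smul_mul_assoc, sub_mul, mul_assoc, hPl.ker, mul_zero, zero_sub, smul_neg, mul_assoc]
      have hz : h.ph l₀ 1 * (R 1 * (h.cross l₀ l 1 * Pl)) = 0 := by
        rw [hTP, mul_neg, mul_neg, mul_smul_comm, mul_smul_comm]
        simp only [← mul_assoc]
        rw [hφRφ]; simp
      -- On the kernel at `l`, the boundary value of the cross Gram matrix factors through
      -- `φ(1,l₀)*`, so the correction to the norming operator contains `φRφ*` and vanishes.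
      have hz2 : star (h.cross l₀ l 1 * Pl) * R 1 * (h.cross l₀ l 1 * Pl) = 0 := by
        have e : star (h.cross l₀ l 1 * Pl)
            = - (star c • (star (h.ph' l 1 * Pl) * h.ph l₀ 1)) := by
          rw [hTP, star_neg, star_smul, star_mul, star_star]
        rw [e, mul_assoc, neg_mul, smul_mul_assoc, mul_assoc, hz]
        simp
      rw [star_mul, hPl.herm] at hz2
      rw [hgram, mul_sub, sub_mul]
      have e : Pl * (star (h.cross l₀ l 1) * R 1 * h.cross l₀ l 1) * Pl
        = Pl * star (h.cross l₀ l 1) * R 1 * (h.cross l₀ l 1 * Pl) := by noncomm_ring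
      rw [e, hz2, sub_zero]
  · have hM : h'.ph l₀ 1 = h.ph l₀ 1 * D 1 := by
      rw [hsol l₀ 1 h1, commuted, ← hRS, mul_sub, mul_one, mul_assoc]
      rfl
    refine ⟨hP's, hP'P', by rw [hM, hφDP'], fun X hX => ?_⟩
    rw [hM, mul_assoc] at hX
    have e := hP.eq _ hX
    have e2 : X = A' * S * P * (D 1 * X) := by
      rw [← hUP, mul_assoc, e, ← mul_assoc, hD2 1 h1, one_mul]
    rw [e2]
    simp only [← mul_assoc]
    rw [hPA']
  · have e : h'.gram l₀ = S * D 1 := by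
      rw [hgram, ← hs, ← hS, hss, hs1, ← hRS, mul_sub, mul_one, ← mul_assoc]
    rw [e]
    calc _ = P' * S * (D 1 * P') := by noncomm_ring
      _ = P' * S * P * star Z * G := by rw [hDP']; noncomm_ring
      _ = G := by rw [hY1, hPG]

end SAPot
end MatrixSL

end

/-! ### From matrices back to potentials and subspaces -/

noncomputable section

namespace MatrixSL

section Projectors

variable {N : ℕ}

lemma IsKerProj.unique {M P P' : Mat N} (h : IsKerProj M P) (h' : IsKerProj M P') : P = P' := by
  have e1 := congrArg star (h.eq P' h'.ker)
  rw [star_mul, h.herm, h'.herm, h'.eq P h.ker] at e1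
  exact e1

lemma IsKerProj.isUnit_iff {M P : Mat N} (h : IsKerProj M P) : IsUnit M ↔ P = 0 := by
  constructor
  · intro hu
    exact hu.mul_left_cancel (by rw [h.ker, mul_zero])
  · rintro rfl
    exact isUnit_of_forall_mul_eq_zero fun X hX => by rw [← h.eq X hX, zero_mul]

lemma inner_op_eq (M : Mat N) (v : Vec N) :
    inner ℂ v (op M v) = star (v : Fin N → ℂ) ⬝ᵥ (M *ᵥ (v : Fin N → ℂ)) := by
  rw [EuclideanSpace.inner_eq_star_dotProduct, dotProduct_comm]
  rfl

lemma star_colM_mul (M : Mat N) (v : Vec N) (i j : Fin N) :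
    (star (colM v) * M * colM v) i j = inner ℂ v (op M v) := by
  rw [inner_op_eq, mul_assoc, Matrix.mul_apply]
  simp [colM_apply, dotProduct, Matrix.mulVec, Matrix.mul_apply, Matrix.star_apply]

lemma SAPot.inner_gram_pos {Q : ℝ → Mat N} (h : SAPot Q) (l : ℂ) {v : Vec N} (hv : v ≠ 0) :
    0 < (inner ℂ v (op (h.gram l) v)).re := by
  have e := (inner_op_eq (h.gram l) v).trans
    (gram_quadratic (h.ph_continuous l).continuousOn (v : Fin N → ℂ))
  set I : ℝ := ∫ t in (0 : ℝ)..1, ∑ j, ‖(h.ph l t *ᵥ (v : Fin N → ℂ)) j‖ ^ 2 with hI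
  have h0 : 0 ≤ I := intervalIntegral.integral_nonneg zero_le_one fun t _ => by positivity
  rw [e, Complex.ofReal_re]
  refine lt_of_le_of_ne h0 fun hz => hv (colM_injective ?_)
  rw [map_zero]
  refine h.eq_zero_of_gram (l := l) le_rfl zero_lt_one le_rfl ?_
  ext i j
  change (star (colM v) * h.gram l * colM v) i j = 0
  rw [star_colM_mul, e, ← hz, Complex.ofReal_zero]

lemma star_dataM {p : SubspaceWithOp N} (hp : IsPosDefOp p.2) : star (dataM p) = dataM p := by
  rw [star_eq_iff_inner]
  intro u v
  rw [op_dataM', op_dataM']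
  have e1 := Submodule.inner_orthogonalProjectionOnto_eq_of_mem_left
    (p.2 (p.1.orthogonalProjectionOnto u)) v
  have e2 := Submodule.inner_orthogonalProjectionOnto_eq_of_mem_right
    (p.2 (p.1.orthogonalProjectionOnto v)) u
  rw [← e1, ← e2]
  exact hp.1 _ _

lemma projM_mul_dataM (p : SubspaceWithOp N) : projM p.1 * dataM p = dataM p :=
  mat_ext fun v => by
    rw [op_mul, op_dataM']
    exact op_projM_of_mem (Subtype.mem _)

lemma inner_dataM (p : SubspaceWithOp N) (v : Vec N) :
    inner ℂ v (op (dataM p) v) = inner ℂ (p.1.orthogonalProjectionOnto v)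
      (p.2 (p.1.orthogonalProjectionOnto v)) := by
  rw [op_dataM']
  exact (Submodule.inner_orthogonalProjectionOnto_eq_of_mem_right
    (p.2 (p.1.orthogonalProjectionOnto v)) v).symm

open scoped ComplexOrder MatrixOrder in
lemma dataM_nonneg {p : SubspaceWithOp N} (hp : IsPosDefOp p.2) : 0 ≤ dataM p := by
  rw [Matrix.nonneg_iff_posSemidef]
  refine Matrix.PosSemidef.of_dotProduct_mulVec_nonneg (star_dataM hp) fun v => ?_
  have e := inner_op_eq (dataM p) (WithLp.toLp 2 v)
  change 0 ≤ star (WithLp.toLp 2 v : Vec N).ofLp ⬝ᵥ (dataM p *ᵥ (WithLp.toLp 2 v : Vec N).ofLp)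
  rw [← e, inner_dataM]
  set u := p.1.orthogonalProjectionOnto (WithLp.toLp 2 v)
  have him : (inner ℂ u (p.2 u)).im = 0 := by
    have h1 : (starRingEnd ℂ) (inner ℂ u (p.2 u)) = inner ℂ u (p.2 u) := by
      rw [Submodule.coe_inner, inner_conj_symm, ← Submodule.coe_inner, hp.1]
      rfl
    exact Complex.conj_eq_iff_im.1 h1
  rw [Complex.nonneg_iff]
  refine ⟨?_, him.symm⟩
  by_cases hu : u = 0
  · simp [hu]
  · exact (hp.2 u hu).le

lemma projM_mul_eq_zero {p : SubspaceWithOp N} (hp : IsPosDefOp p.2) {X : Mat N}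
    (hX : dataM p * X = 0) : projM p.1 * X = 0 := by
  refine mat_ext fun v => ?_
  have e : op (dataM p) (op X v) = 0 := by rw [← op_mul, hX]; simp
  rw [op_dataM'] at e
  have e2 : p.2 (p.1.orthogonalProjectionOnto (op X v)) = 0 := Subtype.ext e
  have e3 : p.1.orthogonalProjectionOnto (op X v) = 0 := by
    by_contra hne
    have := hp.2 _ hne
    rw [e2, Submodule.coe_inner, Submodule.coe_zero, inner_zero_right] at this
    simp at this
  rw [op_mul, op_projM, Submodule.starProjection_apply, e3]
  simp

/-- A pairing that is nondegenerate on two subspaces of the same dimension is invertible. -/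
lemma exists_inverse_pairing {K L : Submodule ℂ (Vec N)} {M : Mat N}
    (hd : Module.finrank ℂ L = Module.finrank ℂ K)
    (hinj : ∀ v ∈ L, (∀ u ∈ K, inner ℂ u (op M v) = 0) → v = 0) :
    ∃ Z : Mat N, Z * (projM K * M * projM L) = projM L ∧ projM K * M * projM L * Z = projM K := by
  let f : L →ₗ[ℂ] K := (K.orthogonalProjectionOnto : Vec N →ₗ[ℂ] K) ∘ₗ op M ∘ₗ L.subtype
  have hf : Function.Injective f := by
    rw [← LinearMap.ker_eq_bot, Submodule.eq_bot_iff]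
    intro v hv
    refine Subtype.ext (hinj v v.2 fun u hu => ?_)
    have e := Submodule.inner_orthogonalProjectionOnto_eq_of_mem_left (⟨u, hu⟩ : K) (op M v)
    rw [← e]
    have : K.orthogonalProjectionOnto (op M v) = 0 := hv
    rw [this, inner_zero_right]
  let e : L ≃ₗ[ℂ] K := LinearMap.linearEquivOfInjective f hf hd
  have he : ∀ v, e v = f v := fun v => rfl
  have key : ∀ v : Vec N, op (projM K * M * projM L) v = f (L.orthogonalProjectionOnto v) := by
    intro v
    rw [op_mul, op_mul, op_projM, op_projM]
    rfl
  let Z : Mat N := ofLin (L.subtype ∘ₗ e.symm.toLinearMap ∘ₗ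
    (K.orthogonalProjectionOnto : Vec N →ₗ[ℂ] K))
  have hZ : ∀ v : Vec N, op Z v = e.symm (K.orthogonalProjectionOnto v) := fun v => by
    simp [Z]
  refine ⟨Z, mat_ext fun v => ?_, mat_ext fun v => ?_⟩
  · rw [op_mul, hZ, key, Submodule.orthogonalProjectionOnto_mem_subspace_eq_self, ← he,
      LinearEquiv.symm_apply_apply, op_projM]
    rfl
  · rw [op_mul, key, hZ, Submodule.orthogonalProjectionOnto_mem_subspace_eq_self, ← he,
      LinearEquiv.apply_symm_apply, op_projM]
    rfl

end Projectors

section Main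

variable {N : ℕ} {V W : Potential N}

/-- Passing to the class in `L¹` alters the function on a null set only, which the integrated
equation does not see. -/
lemma SAPot.exists_potential {Q : ℝ → Mat N} (h : SAPot Q) :
    ∃ (W : Potential N) (hW : IsSelfAdjointPotential W), ∀ l : ℂ, ∀ x ∈ Icc (0 : ℝ) 1,
      (saPot hW).ph l x = h.ph l x := by
  have hi : Integrable Q μ01 := by
    have := h.int
    rwa [intervalIntegrable_iff_integrableOn_Ioo_of_le zero_le_one] at this
  let W : Potential N := hi.toL1 Q
  have hWQ : ∀ᵐ t ∂μ01, W t = Q t := hi.coeFn_toL1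
  have hW : IsSelfAdjointPotential W := by
    have := (ae_restrict_iff' measurableSet_Ioo).2 h.herm
    filter_upwards [hWQ, this] with t h1 h2
    rw [h1]; exact h2
  have hWQ' := (ae_restrict_iff' measurableSet_Ioo).1 hWQ
  refine ⟨W, hW, fun l x hx => ?_⟩
  have s := (saPot hW).ph_isSol l
  have s' : IsSol Q l ((saPot hW).ph l) ((saPot hW).ph' l) := ⟨s.d1, s.d2.congr (fun _ _ => rfl) (by
    filter_upwards [hWQ'] with t ht ht1
    simp only [ht ht1])⟩
  exact (s'.unique h.int (h.ph_isSol l) (by simp) (by simp) hx).1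

lemma SAPot.gram_congr {Q Q' : ℝ → Mat N} (h : SAPot Q) (h' : SAPot Q') {l : ℂ}
    (e : ∀ x ∈ Icc (0 : ℝ) 1, h.ph l x = h'.ph l x) : h.gram l = h'.gram l := by
  refine intervalIntegral.integral_congr fun t ht => ?_
  rw [uIcc_of_le zero_le_one] at ht
  simp only [e t ht]

lemma isPosDefOp_g (hV : IsSelfAdjointPotential V) (α : ℕ) : IsPosDefOp (g V α) := by
  have hs : star (dataM (spectralData V α)) = dataM (spectralData V α) := by
    rw [dataM_spectralData hV]
    simp only [star_mul, star_projM, mul_assoc]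
    congr 2
    exact star_gram _ _ _
  constructor
  · intro u v
    have e := (star_eq_iff_inner _).1 hs u v
    rw [show op (dataM (spectralData V α)) u = g V α u from op_dataM (spectralData V α) u,
      show op (dataM (spectralData V α)) v = g V α v from op_dataM (spectralData V α) v] at e
    exact e
  · intro u hu
    have e1 : op (dataM (spectralData V α)) u = g V α u := op_dataM (spectralData V α) u
    have e2 : inner ℂ u (g V α u) = inner ℂ (u : Vec N) (op ((saPot hV).gram (eigenvalue V α)) u) := by
      rw [Submodule.coe_inner, ← e1, dataM_spectralData hV, op_mul, op_mul,
        op_projM_of_mem u.2]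
      have := inner_op_left (projM (E V α)) u (op ((saPot hV).gram (eigenvalue V α)) u)
      rw [star_projM, op_projM_of_mem u.2] at this
      exact this.symm
    rw [e2]
    exact (saPot hV).inner_gram_pos _ fun h0 => hu (Subtype.ext h0)

lemma spectralData_eq_of_sameData (hV : IsSelfAdjointPotential V) (hW : IsSelfAdjointPotential W)
    {β : ℕ} (he : eigenvalue W β = eigenvalue V β)
    (hd : (saPot hV).SameData (saPot hW) (eigenvalue V β)) :
    spectralData W β = spectralData V β := by
  obtain ⟨P, h1, h2, h3⟩ := hd
  have k1 := h1.unique (isKerProj_E hV β)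
  rw [← he] at h2
  have k2 := h2.unique (isKerProj_E hW β)
  refine data_ext (k2.symm.trans k1) ?_
  rw [dataM_spectralData hV, dataM_spectralData hW, ← k1, ← k2, he, h3]

variable [NeZero N]

/-- Away from the common eigenvalues both kernels are trivial and `P = 0` serves, so data listed by
index become data at every real point. -/
lemma sameData_of_spectralData_eq (hV : IsSelfAdjointPotential V)
    (hW : IsSelfAdjointPotential W) (he : ∀ β, 1 ≤ β → eigenvalue W β = eigenvalue V β) {l : ℝ}
    (hd : ∀ β, 1 ≤ β → eigenvalue V β = l → spectralData W β = spectralData V β) :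
    (saPot hV).SameData (saPot hW) l := by
  by_cases hl : l ∈ eigenvalues V
  · obtain ⟨β, hβ, rfl⟩ := exists_eigenvalue_eq hV hl
    have hdβ := hd β hβ rfl
    have hE : E W β = E V β := congrArg Sigma.fst hdβ
    have hdM := congrArg dataM hdβ
    have hk := isKerProj_E hW β
    rw [dataM_spectralData hV, dataM_spectralData hW, hE, he β hβ] at hdM
    rw [hE, he β hβ] at hk
    exact ⟨_, isKerProj_E hV β, hk, hdM.symm⟩
  · have hl' : l ∉ eigenvalues W := by
      intro h
      obtain ⟨β, hβ, rfl⟩ := exists_eigenvalue_eq hW h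
      exact hl (he β hβ ▸ (eigenvalue_spec hV hβ).1)
    rw [mem_eigenvalues_iff hV, not_not] at hl
    rw [mem_eigenvalues_iff hW, not_not] at hl'
    have z1 := isKerProj_projM ((saPot hV).ph l 1)
    have z2 := isKerProj_projM ((saPot hW).ph l 1)
    rw [z1.isUnit_iff.1 hl] at z1
    rw [z2.isUnit_iff.1 hl'] at z2
    exact ⟨0, z1, z2, by simp⟩

/-- Potentials with the same spectral data agree almost everywhere. -/
lemma eq_of_spectralData_eq (hV : IsSelfAdjointPotential V) (hW : IsSelfAdjointPotential W)
    (he : ∀ β, 1 ≤ β → eigenvalue W β = eigenvalue V β)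
    (hd : ∀ β, 1 ≤ β → spectralData W β = spectralData V β) : W = V := by
  refine Lp.ext ((ae_restrict_iff' measurableSet_Ioo).2 ?_)
  exact (saPot hV).ae_eq_of_sameData (saPot hW) fun l =>
    sameData_of_spectralData_eq hV hW he fun β hβ _ => hd β hβ

/-- Since `S` is self-adjoint, `F` is the kernel of `P S`; both the obstruction and the construction
use it in this form. -/
lemma mem_F_iff (hV : IsSelfAdjointPotential V) (α : ℕ) (v : Vec N) :
    v ∈ F V α ↔ ∀ u ∈ E V α, inner ℂ u (op ((saPot hV).gram (eigenvalue V α)) v) = 0 := by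
  have hs : star ((saPot hV).gram (eigenvalue V α)) = (saPot hV).gram (eigenvalue V α) :=
    star_gram _ _ _
  rw [F, Submodule.mem_orthogonal, S_eq hV]
  constructor
  · intro h u hu
    have := h _ (Submodule.mem_map_of_mem hu)
    rwa [inner_op_left, hs] at this
  · rintro h _ ⟨u, hu, rfl⟩
    rw [inner_op_left, hs]
    exact h u hu

/-- The range of the spectral data avoids the forbidden subspace. -/
lemma E_inf_F (hV : IsSelfAdjointPotential V) (hW : IsSelfAdjointPotential W) {α : ℕ}
    (hα : 1 ≤ α) (he : ∀ β, 1 ≤ β → eigenvalue W β = eigenvalue V β)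
    (hd : ∀ β, 1 ≤ β → β ≠ α → spectralData W β = spectralData V β) :
    E W α ⊓ F V α = ⊥ := by
  refine (Submodule.eq_bot_iff _).2 ?_
  rintro v ⟨hv1, hv2⟩
  rw [SetLike.mem_coe, E_eq hW, LinearMap.mem_ker, he α hα] at hv1
  rw [SetLike.mem_coe, mem_F_iff hV] at hv2
  apply colM_injective
  rw [map_zero]
  refine (saPot hV).eq_zero_of_forbidden (saPot hW) (isKerProj_E hV α) (fun l hl P hP => ?_)
    (by rw [← colM_op, hv1, map_zero]) ?_
  · obtain ⟨P', h1, h2, -⟩ := sameData_of_spectralData_eq hV hW he (l := l) fun β hβ hβl =>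
      hd β hβ (by rintro rfl; exact hl hβl.symm)
    rw [← h1.eq P hP.ker, ← mul_assoc, h2.ker, zero_mul]
  · rw [← colM_op]
    have : op (projM (E V α) * (saPot hV).gram (eigenvalue V α)) v = 0 := by
      refine ext_inner_left ℂ fun u => ?_
      rw [op_mul, inner_zero_right]
      have h1 := inner_op_left (projM (E V α)) u (op ((saPot hV).gram (eigenvalue V α)) v)
      rw [star_projM] at h1
      rw [← h1]
      exact hv2 _ (op_projM_mem _ _)
    rw [this, map_zero]

/-- The spectral data at one eigenvalue can be prescribed. -/
lemma exists_potential_of_data (hV : IsSelfAdjointPotential V) {α : ℕ} (hα : 1 ≤ α)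
    {p : SubspaceWithOp N} (hd : Module.finrank ℂ p.1 = multiplicity V α) (hp : IsPosDefOp p.2)
    (hF : p.1 ⊓ F V α = ⊥) :
    ∃ W, IsSelfAdjointPotential W ∧ eigenvalue W = eigenvalue V ∧
      (∀ β, 1 ≤ β → β ≠ α → spectralData W β = spectralData V β) ∧ spectralData W α = p := by
  obtain ⟨Z, hZ1, hZ2⟩ := exists_inverse_pairing (K := E V α) (L := p.1)
    (M := (saPot hV).gram (eigenvalue V α)) (hd.trans (multiplicity_eq hV α)) fun v hv hv2 => by
      have : v ∈ p.1 ⊓ F V α := ⟨hv, (mem_F_iff hV α v).2 hv2⟩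
      rwa [hF] at this
  obtain ⟨Q', h', hsame, hker, hgram⟩ := (saPot hV).exists_commuted (isKerProj_E hV α)
    (star_projM p.1) (projM_mul_self p.1) (star_dataM hp) (projM_mul_dataM p) (dataM_nonneg hp)
    (fun X hX => projM_mul_eq_zero hp hX) hZ1 hZ2
  obtain ⟨W, hW, hWph⟩ := h'.exists_potential
  have hWg : ∀ l : ℂ, (saPot hW).gram l = h'.gram l := fun l =>
    (saPot hW).gram_congr h' (hWph l)
  have h1 : (1 : ℝ) ∈ Icc (0 : ℝ) 1 := by simp
  have hsame' : ∀ l : ℝ, l ≠ eigenvalue V α → (saPot hV).SameData (saPot hW) l := fun l hl => by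
    obtain ⟨P, k1, k2, k3⟩ := hsame l hl
    exact ⟨P, k1, by rwa [hWph _ 1 h1], by rwa [hWg]⟩
  rw [← hWph _ 1 h1] at hker
  rw [← hWg] at hgram
  have hev : eigenvalues W = eigenvalues V := by
    ext l
    rw [mem_eigenvalues_iff hV, mem_eigenvalues_iff hW, not_iff_not]
    -- At this point the old and new projectors vanish together, because each is a product
    -- containing the other by the relations for `Z`.
    by_cases hl : l = eigenvalue V α
    · subst hl
      rw [hker.isUnit_iff, (isKerProj_E hV α).isUnit_iff]
      constructor
      · intro h0
        rw [← hZ2, h0]; simp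
      · intro h0
        rw [← hZ1, h0]; simp
    · obtain ⟨P, k1, k2, -⟩ := hsame' l hl
      rw [k1.isUnit_iff, k2.isUnit_iff]
  have hee : eigenvalue W = eigenvalue V := by
    funext β
    rw [eigenvalue, eigenvalue, hev]
  refine ⟨W, hW, hee, fun β hβ hne => ?_, ?_⟩
  · exact spectralData_eq_of_sameData hV hW (congrFun hee β)
      (hsame' _ fun h => hne (eigenvalue_injective hV hβ hα h))
  · rw [← hee] at hker hgram
    have k := (isKerProj_E hW α).unique hker
    refine data_ext k ?_
    rw [dataM_spectralData hW, k, hgram]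

end Main

end MatrixSL

end

theorem theorem1p3 (N : ℕ) (hN : 1 ≤ N) (V : MatrixSL.Potential N)
    (hV : MatrixSL.IsSelfAdjointPotential V) (α : ℕ) (hα : 1 ≤ α) :
    Set.BijOn (fun W : MatrixSL.Potential N => MatrixSL.spectralData W α)
      {W | W ∈ MatrixSL.Iso V ∧
        ∀ β : ℕ, 1 ≤ β → β ≠ α → MatrixSL.spectralData W β = MatrixSL.spectralData V β}
      {p | Module.finrank ℂ p.1 = MatrixSL.multiplicity V α ∧ MatrixSL.IsPosDefOp p.2 ∧
        p.1 ⊓ MatrixSL.F V α = ⊥} := by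
  have : NeZero N := ⟨by omega⟩
  refine ⟨?_, ?_, ?_⟩
  · rintro W ⟨⟨hW, hiso⟩, hd⟩
    exact ⟨(MatrixSL.multiplicity_eq hW α).symm.trans (hiso α hα).2, MatrixSL.isPosDefOp_g hW α,
      MatrixSL.E_inf_F hV hW hα (fun β hβ => (hiso β hβ).1) hd⟩
  · rintro W ⟨⟨hW, hiso⟩, hd⟩ W' ⟨⟨hW', hiso'⟩, hd'⟩ he
    refine MatrixSL.eq_of_spectralData_eq hW' hW
      (fun β hβ => (hiso β hβ).1.trans (hiso' β hβ).1.symm) fun β hβ => ?_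
    by_cases hβα : β = α
    · rw [hβα]; exact he
    · exact (hd β hβ hβα).trans (hd' β hβ hβα).symm
  · rintro p ⟨hk, hp, hF⟩
    obtain ⟨W, hW, hee, hd, hα'⟩ := MatrixSL.exists_potential_of_data hV hα hk hp hF
    refine ⟨W, ⟨⟨hW, fun β hβ => ⟨congrFun hee β, ?_⟩⟩, hd⟩, hα'⟩
    by_cases hβα : β = α
    · subst hβα
      rw [MatrixSL.multiplicity_eq hW, ← hk]
      have : MatrixSL.E W β = p.1 := congrArg Sigma.fst hα'
      rw [this]
    · have : MatrixSL.E W β = MatrixSL.E V β := congrArg Sigma.fst (hd β hβ hβα)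
      rw [MatrixSL.multiplicity_eq hW, MatrixSL.multiplicity_eq hV, this]
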